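/- **Setting.** Let $\xi:\mathbb R^3\to\mathbb R$ be $C^3$ such that $\Omega=\{\xi<0\}$ is bounded with $\partial\Omega=\{\xi=0\}$; assume that for some $c>0$, $\zeta\cdot\nabla^2\xi(x)\zeta\ge c|\zeta|^2$ for all $x\in\overline\Omega$, $\zeta\in\mathbb R^3$, and that $\nabla\xi(x)\ne0$ for $x\in\overline\Omega$ with $|\xi(x)|$ small. Put $n=\nabla\xi/|\nabla\xi|$, $R_xv=v-2(n(x)\cdot v)n(x)$ and $\langle v\rangle=(1+|v|^2)^{1/2}$. Let $T>0$ and let $E\in C^2([0,T]\times\overline\Omega;\mathbb R^3)$ satisfy $E(t,x)\cdot n(x)>C_E>0$ for all $t\in[0,T]$, $x\in\partial\Omega$. Write $\|E\|_\infty$, $\|\nabla E\|_\infty$ for the suprema of $|E|$, $|\nabla_xE|$ over $[0,T]\times\overline\Omega$. *Weight.* For small $\rho>0$ let $\delta'=\min\{|\xi(x)|:x\in\Omega,\ d(x,\partial\Omega)=\rho\}$, and let $\chi:[0,\infty)\to[0,\infty)$ be smooth with $\chi(y)=y$ on $[0,\delta'/4]$, $\chi$ increasing on $(\delta'/4,\delta'/2)$,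 $\chi$ equal to a constant $C_{\delta'}$ on $[\delta'/2,\infty)$, and $\chi'\le1$. With $\bar x$ the point of $\partial\Omega$ nearest to $x$, let $$\alpha(t,x,v)=\chi\Big(\big[|v\cdot\nabla\xi(x)|^2+\xi(x)^2-2(v\cdot\nabla^2\xi(x)v)\,\xi(x)-2(E(t,\bar x)\cdot\nabla\xi(\bar x))\,\xi(x)\big]^{1/2}\Big)$$ if $d(x,\partial\Omega)<\rho$, and $\alpha(t,x,v)=C_{\delta'}$ otherwise. *Trajectories.* $(X,V)(s)=(X,V)(s;t,x,v)$ solves $\dot X=V$, $\dot V=E(s,X)$ with $(X,V)(t)=(x,v)$, and $t_{\mathbf b}(t,x,v)=\sup\{s\ge0:X(\tau)\in\Omega\text{ for all }\tau\in(t-s,t)\}$. Since $E$ is given for times in $[0,T]$, trajectories are followed backward no further than time $0$. Let $(t^0,x^0,v^0)=(t,x,v)$, and for $\ell\ge0$ let $t^{\ell+1}=\max\{0,\,t^\ell-t_{\mathbf b}(t^\ell,x^\ell,v^\ell)\}$, $x^{\ell+1}=X(t^{\ell+1};t^\ell,x^\ell,v^\ell)$, $v^{\ell+1}=R_{x^{\ell+1}}V(t^{\ell+1};t^\ell,x^\ell,v^\ell)$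 (the cycles stop once time $0$ is reached). Let $(X_{\mathbf{cl}},V_{\mathbf{cl}})(s;t,x,v)=(X,V)(s;t^\ell,x^\ell,v^\ell)$ for $s\in[t^{\ell+1},t^\ell)$. **Claim.** There are $\rho_0>0$ and $C_\xi>0$ depending only on $\xi$ such that the following holds for every $\rho\in(0,\rho_0)$ and every $\chi$ as above. Let $1<\beta<3$, $0<\kappa\le1$, $C_\theta>0$, $\theta>0$. (1) There is a constant $C>0$ depending only on $\xi,\rho,\chi,T,\beta,\kappa,C_\theta,\theta$ such that for every $E$ and $C_E$ as above there are $\varpi_0>0$ and $\delta_0>0$ for which, for all $\varpi\ge\varpi_0$, all $0<\delta<\delta_0$ and all $(t,x,v)\in[0,T]\times\Omega\times\mathbb R^3$, $$\int_{\max\{0,t-t_{\mathbf b}\}}^t\int_{\mathbb R^3}e^{-\int_s^t\frac{\varpi}{2}\langle V(\tau)\rangle d\tau}\,\frac{e^{-\frac{C_\theta}{2}|V(s)-u|^2}}{|V(s)-u|^{2-\kappa}}\,\frac{1}{\alpha(s,X(s),u)^\beta}\,du\,ds$$ $$\le C\Bigg[e^{2C_\xi\frac{\|\nabla E\|_\infty+\|E\|_\infty^2+\|E\|_\infty}{C_E}}\frac{\delta^{\frac{3-\beta}{2}}}{\langle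 v\rangle^2(C_E+1)^{\frac{\beta-1}{2}}\alpha(t,x,v)^{\beta-2}(\|E\|_\infty^2+1)^{\frac{3-\beta}{2}}}+\frac{(\|E\|_\infty^2+1)^{\beta-1}}{C_E^{\beta-1}\delta^{\beta-1}\alpha(t,x,v)^{\beta-1}}\,\frac{2}{\varpi}\Bigg].$$ (2) For every $E$ and $C_E$ as above there are constants $K_r$ $(r>0)$ such that for every $\varepsilon>0$ there is $l_0\ge1$ with the following property. For all $l\ge l_0$, all $r>0$, all $Z(s,x,v)\ge0$ that are bounded on $[0,T]\times\Omega\times\mathbb R^3$, and all $(t,x,v)\in[0,T]\times\Omega\times\mathbb R^3$, $$\int_0^t\int_{\mathbb R^3}e^{-l\langle v\rangle(t-s)}\frac{e^{-\theta|V_{\mathbf{cl}}(s)-u|^2}}{|V_{\mathbf{cl}}(s)-u|^{2-\kappa}}\frac{\langle u\rangle^r}{\langle v\rangle^r}\frac{Z(s,x,v)}{\alpha(s,X_{\mathbf{cl}}(s),u)^\beta}\,du\,ds\le\frac{K_r\,\varepsilon}{\langle v\rangle\,\alpha(t,x,v)^{\beta-1}}\sup_{0\le s\le t}\Big\{e^{-\frac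 l2\langle v\rangle(t-s)}Z(s,x,v)\Big\},$$ where $(X_{\mathbf{cl}},V_{\mathbf{cl}})(s)=(X_{\mathbf{cl}},V_{\mathbf{cl}})(s;t,x,v)$. -/

import Mathlib

open Set MeasureTheory
open scoped ContDiff ENNReal

noncomputable section

namespace SpecularBoltzmann

/-- Three-dimensional Euclidean space. -/
abbrev R3 := EuclideanSpace ℝ (Fin 3)

/-- The Japanese bracket `⟨v⟩ = (1 + |v|²)^{1/2}`. -/
def bracket (v : R3) : ℝ := Real.sqrt (1 + ‖v‖ ^ 2)

/-! ### The domain -/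

/-- The domain `Ω = {ξ < 0}`. -/
def domain (ξ : R3 → ℝ) : Set R3 := {x | ξ x < 0}

/-- The quadratic form `v ⬝ ∇²ξ(x) ⬝ v`. -/
def hessForm (ξ : R3 → ℝ) (x v : R3) : ℝ := fderiv ℝ (fderiv ℝ ξ) x v v

/-- `ξ` is a `C³` defining function of a bounded, strictly convex domain. -/
structure IsDefiningFunction (ξ : R3 → ℝ) : Prop where
  contDiff : ContDiff ℝ 3 ξ
  bounded : Bornology.IsBounded (domain ξ)
  frontier_eq : frontier (domain ξ) = {x | ξ x = 0}
  strictlyConvex : ∃ c > 0, ∀ x ∈ closure (domain ξ), ∀ ζ : R3, c * ‖ζ‖ ^ 2 ≤ hessForm ξ x ζ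
  gradient_ne_zero : ∃ ε > 0, ∀ x ∈ closure (domain ξ), |ξ x| < ε → gradient ξ x ≠ 0

/-- The outward normal `n(x) = ∇ξ(x) / |∇ξ(x)|`. -/
def normal (ξ : R3 → ℝ) (x : R3) : R3 := ‖gradient ξ x‖⁻¹ • gradient ξ x

/-- The specular reflection `R_x v = v - 2 (n(x) ⬝ v) n(x)`. -/
def reflect (ξ : R3 → ℝ) (x v : R3) : R3 := v - (2 * inner ℝ (normal ξ x) v) • normal ξ x

/-- The distance `d(x, ∂Ω)`. -/
def bdryDist (ξ : R3 → ℝ) (x : R3) : ℝ := Metric.infDist x (frontier (domain ξ))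

/-- A nearest boundary point `x̄` of `x`; it is unique when `x ∈ Ω` is close to `∂Ω`. -/
def bdryProj (ξ : R3 → ℝ) (x : R3) : R3 :=
  Classical.epsilon fun y => y ∈ frontier (domain ξ) ∧ dist x y = bdryDist ξ x

/-! ### The field -/

/-- `E` is of class `C²` on `[0,T] × closure Ω`. As this set is compact, `‖E‖_{C²} < ∞`. -/
def IsC2Field (ξ : R3 → ℝ) (T : ℝ) (E : ℝ → R3 → R3) : Prop :=
  ContDiffOn ℝ 2 (fun p : ℝ × R3 => E p.1 p.2) (Icc 0 T ×ˢ closure (domain ξ))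

/-- The sign condition `E(t,x) ⬝ n(x) > C_E > 0` for `t ∈ [0,T]` and `x ∈ ∂Ω`. -/
def SignCondition (ξ : R3 → ℝ) (T : ℝ) (E : ℝ → R3 → R3) (CE : ℝ) : Prop :=
  0 < CE ∧ ∀ t ∈ Icc 0 T, ∀ x ∈ frontier (domain ξ), CE < inner ℝ (E t x) (normal ξ x)

/-- `‖E‖_{L^∞}`, the supremum of `|E|` over `[0,T] × closure Ω`. -/
def fieldSup (ξ : R3 → ℝ) (T : ℝ) (E : ℝ → R3 → R3) : ℝ :=
  sSup ((fun p : ℝ × R3 => ‖E p.1 p.2‖) '' (Icc 0 T ×ˢ closure (domain ξ)))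

/-- `‖∇E‖_{L^∞}`, the supremum of the spatial gradient over `[0,T] × closure Ω`. -/
def fieldGradSup (ξ : R3 → ℝ) (T : ℝ) (E : ℝ → R3 → R3) : ℝ :=
  sSup ((fun p : ℝ × R3 => ‖fderivWithin ℝ (E p.1) (closure (domain ξ)) p.2‖) ''
    (Icc 0 T ×ˢ closure (domain ξ)))

/-! ### The weight -/

/-- `χ : [0,∞) → [0,∞)` is a smooth cutoff with `χ(x) = x` on `[0, ε/4]`, increasing on
`(ε/4, ε/2)`, equal to the constant `c` on `[ε/2, ∞)`, and with `χ' ≤ 1`. -/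
structure IsCutoff (ε : ℝ) (χ : ℝ → ℝ) (c : ℝ) : Prop where
  smooth : ContDiffOn ℝ ∞ χ (Ici 0)
  eq_id : ∀ x, 0 ≤ x → x ≤ ε / 4 → χ x = x
  eq_const : ∀ x, ε / 2 ≤ x → χ x = c
  mono : MonotoneOn χ (Ioo (ε / 4) (ε / 2))
  deriv_le : ∀ x, 0 ≤ x → derivWithin χ (Ici 0) x ≤ 1

/-- `δ' = min {|ξ(x)| : x ∈ Ω, d(x, ∂Ω) = ρ}`. -/
def collarDepth (ξ : R3 → ℝ) (ρ : ℝ) : ℝ :=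
  sInf ((fun x => |ξ x|) '' {x | x ∈ domain ξ ∧ bdryDist ξ x = ρ})

/-- `[ |v⬝∇ξ(x)|² + ξ(x)² - 2 (v⬝∇²ξ(x)⬝v) ξ(x) - 2 (E(t,x̄)⬝∇ξ(x̄)) ξ(x) ]^{1/2}`. -/
def preWeight (ξ : R3 → ℝ) (E : ℝ → R3 → R3) (t : ℝ) (x v : R3) : ℝ :=
  Real.sqrt ((inner ℝ v (gradient ξ x)) ^ 2 + (ξ x) ^ 2 - 2 * hessForm ξ x v * ξ x
    - 2 * inner ℝ (E t (bdryProj ξ x)) (gradient ξ (bdryProj ξ x)) * ξ x)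

/-- The weight `α(t,x,v)`, built with the collar width `ρ` and the cutoff `χ`, `c`. -/
def weight (ξ : R3 → ℝ) (ρ : ℝ) (χ : ℝ → ℝ) (c : ℝ) (E : ℝ → R3 → R3)
    (t : ℝ) (x v : R3) : ℝ :=
  open Classical in if bdryDist ξ x < ρ then χ (preWeight ξ E t x v) else c

/-! ### Characteristics and specular cycles -/

/-- `(X, V)` solves `X' = V`, `V' = E(s, X)` on `[a, t]`, equals `(x, v)` at time `t`, and `X`
stays in `Ω` during `(a, t)`. -/
def IsCharacteristic (ξ : R3 → ℝ) (E : ℝ → R3 → R3) (t : ℝ) (x v : R3) (a : ℝ)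
    (X V : ℝ → R3) : Prop :=
  X t = x ∧ V t = v ∧
  (∀ s ∈ Icc a t, HasDerivWithinAt X (V s) (Icc a t) s ∧
    HasDerivWithinAt V (E s (X s)) (Icc a t) s) ∧
  ∀ τ ∈ Ioo a t, X τ ∈ domain ξ

/-- The backward exit time: the largest `s` for which the characteristic through `(t,x,v)` stays
in `Ω` during `(t - s, t)`. The field is given for nonnegative times only, so a characteristic is
followed back to time `0` at most; that is, this is `min {t, t_b(t,x,v)}`, and
`t - exitTime = max {0, t - t_b}`. -/
def exitTime (ξ : R3 → ℝ) (E : ℝ → R3 → R3) (t : ℝ) (x v : R3) : ℝ :=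
  sSup {s | 0 ≤ s ∧ s ≤ t ∧ ∃ X V, IsCharacteristic ξ E t x v (t - s) X V}

/-- The (unique) characteristic `(X, V)` through `(t,x,v)`, on `[t - exitTime, t]`. -/
def charPair (ξ : R3 → ℝ) (E : ℝ → R3 → R3) (t : ℝ) (x v : R3) : (ℝ → R3) × (ℝ → R3) :=
  Classical.epsilon fun p => IsCharacteristic ξ E t x v (t - exitTime ξ E t x v) p.1 p.2

/-- `X(s; t, x, v)`. -/
def charX (ξ : R3 → ℝ) (E : ℝ → R3 → R3) (t : ℝ) (x v : R3) (s : ℝ) : R3 :=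
  (charPair ξ E t x v).1 s

/-- `V(s; t, x, v)`. -/
def charV (ξ : R3 → ℝ) (E : ℝ → R3 → R3) (t : ℝ) (x v : R3) (s : ℝ) : R3 :=
  (charPair ξ E t x v).2 s

/-- The specular cycles `(t^ℓ, x^ℓ, v^ℓ)`. Once time `0` has been reached, `t^ℓ = 0` from then
on. -/
def cycle (ξ : R3 → ℝ) (E : ℝ → R3 → R3) (t : ℝ) (x v : R3) : ℕ → ℝ × R3 × R3
  | 0 => (t, x, v)
  | ℓ + 1 =>
    let p := cycle ξ E t x v ℓ
    let t' := p.1 - exitTime ξ E p.1 p.2.1 p.2.2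
    let x' := charX ξ E p.1 p.2.1 p.2.2 t'
    (t', x', reflect ξ x' (charV ξ E p.1 p.2.1 p.2.2 t'))

/-- `X_cl(s; t, x, v) = ∑_ℓ 1_{[t^{ℓ+1}, t^ℓ)}(s) X(s; t^ℓ, x^ℓ, v^ℓ)`. -/
def cycleX (ξ : R3 → ℝ) (E : ℝ → R3 → R3) (t : ℝ) (x v : R3) (s : ℝ) : R3 :=
  ∑' ℓ : ℕ, (Ico (cycle ξ E t x v (ℓ + 1)).1 (cycle ξ E t x v ℓ).1).indicator
    (charX ξ E (cycle ξ E t x v ℓ).1 (cycle ξ E t x v ℓ).2.1 (cycle ξ E t x v ℓ).2.2) s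

/-- `V_cl(s; t, x, v) = ∑_ℓ 1_{[t^{ℓ+1}, t^ℓ)}(s) V(s; t^ℓ, x^ℓ, v^ℓ)`. -/
def cycleV (ξ : R3 → ℝ) (E : ℝ → R3 → R3) (t : ℝ) (x v : R3) (s : ℝ) : R3 :=
  ∑' ℓ : ℕ, (Ico (cycle ξ E t x v (ℓ + 1)).1 (cycle ξ E t x v ℓ).1).indicator
    (charV ξ E (cycle ξ E t x v ℓ).1 (cycle ξ E t x v ℓ).2.1 (cycle ξ E t x v ℓ).2.2) s

end SpecularBoltzmann

end

namespace SpecularBoltzmann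

/-! ### Integrals of the collision kernel against the weight -/

/-! Along a trajectory let h = -ξ(X(s)) be the depth and n = ∇ξ(X)·V, so that h' = -n. Near the
boundary α(s,x,u)² is comparable with (u·∇ξ)² + ⟨u⟩²|ξ|.

Integral in u. Choose a coordinate in which ∇ξ is large. The other two coordinates absorb the
singularity |V-u|^{κ-2}, and integrating α^{-β} in the chosen one leaves at most a multiple of 1 +
(⟨V⟩²h)^{-p} with p = (β-1)/2 (`exists_lintegral_kernel_inv_weight_le`). It remains to integrate a
decaying exponential times h(s)^{-p} in time, where p < 1 because β < 3.

Velocity lemma. The functional W = n² + 2hn' + 2A⟨V⟩²h² satisfies W ≥ n² + 2m⟨V⟩²h, by convexity of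
ξ and the sign of E·n. The terms 2nn' cancel in W', which gives W' ≤ C⟨V⟩W. At the boundary W = n²,
which specular reflection preserves. So W decreases backward in time at most like exp(-Λ(t-s)), with
Λ a constant times ⟨v⟩, through all bounces (`IsCharacteristic.kinetic_le_exp`, `cycleInvariant`).
Since W(t) dominates α(t,x,v)², n and h cannot both be small.

Arch potential. Put ψ = exp(-l(t-s))·(R - g(h)σ(n)), where g(h) behaves like h^{1-p} and saturates
beyond a depth M, and σ is a smoothed sign. Then ψ' dominates a constant times
α·exp(-(l+Λ)(t-s))·h^{-p} (`arch_pointwise`): where |n| is large because -g(h)σ(n) has derivative of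
order h^{-p}|n|, where h is large because R was chosen so. As g(0) = 0, ψ does not see the jump of n
at a bounce, so its increments telescope over all arches and the whole integral is at most 2R, with
no count of the bounces (`lintegral_cycle_le`).

With M = δα²/⟨v⟩² this yields the bound K⟨v⟩^r(δ^{(3-β)/2}α^{2-β}/⟨v⟩² + δ^{-(β-1)/2}α^{1-β}/l) of
`exists_lintegral_cycle_kernel_le`, and both parts follow from it. Part (1) is the first arch. The
claim allows δ^{-(β-1)} where δ^{-(β-1)/2} is obtained, so after replacing δ by ηδ, a small η and
then a small δ₀ absorb all constants that depend on E; this is why C and C_ξ can be 1. Part (2)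
fixes δ by ε and then takes l large. The rate Λ does not involve r, hence neither does l₀. -/

theorem lintegral_abs_rpow_mul_exp_lt_top {σ θ : ℝ} (hσ : σ < 1) (hθ : 0 < θ) :
    ∫⁻ y : ℝ, ENNReal.ofReal (|y| ^ (-σ) * Real.exp (-θ * y ^ 2)) < ⊤ := by
  have h1 : IntegrableOn (fun y : ℝ => y ^ (-σ) * Real.exp (-θ * y ^ 2)) (Ioi 0) :=
    (integrable_rpow_mul_exp_neg_mul_sq hθ (by linarith)).integrableOn
  have h2 : IntegrableOn (fun y : ℝ => |y| ^ (-σ) * Real.exp (-θ * y ^ 2)) (Ioi 0) := by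
    refine h1.congr_fun (fun y hy => ?_) measurableSet_Ioi
    simp only [abs_of_pos (mem_Ioi.1 hy)]
  have h3 : Integrable (fun y : ℝ => |y| ^ (-σ) * Real.exp (-θ * y ^ 2)) := by
    rw [← integrableOn_univ, ← Set.Iic_union_Ioi (a := (0 : ℝ)), integrableOn_union]
    refine ⟨?_, h2⟩
    rw [integrableOn_Iic_iff_integrableOn_Iio]
    have := (Measure.measurePreserving_neg (volume : Measure ℝ)).integrableOn_comp_preimage
      (Homeomorph.neg ℝ).measurableEmbedding (f := fun y : ℝ => |y| ^ (-σ) * Real.exp (-θ * y ^ 2))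
      (s := Ioi 0)
    have h4 := this.2 h2
    have hset : (Neg.neg ⁻¹' Ioi (0 : ℝ)) = Iio 0 := by ext y; simp
    have hfun : (fun y : ℝ => |y| ^ (-σ) * Real.exp (-θ * y ^ 2)) ∘ Neg.neg =
        fun y : ℝ => |y| ^ (-σ) * Real.exp (-θ * y ^ 2) := by ext y; simp
    rw [hset, hfun] at h4
    exact h4
  exact h3.lintegral_lt_top

/-- Since |a||b| ≤ c², a singularity of order 2 - κ in the plane splits into two one-dimensional
singularities of order 1 - κ/2, each integrable when κ > 0. -/
theorem norm_rpow_inv_le {κ a b c : ℝ} (hκ1 : κ ≤ 1) (ha : a ≠ 0) (hb : b ≠ 0)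
    (hc : a ^ 2 + b ^ 2 ≤ c ^ 2) (hc0 : 0 ≤ c) :
    1 / c ^ (2 - κ) ≤ |a| ^ (-(1 - κ / 2)) * |b| ^ (-(1 - κ / 2)) := by
  have ha' := abs_pos.2 ha
  have hb' := abs_pos.2 hb
  have h1 : |a| * |b| ≤ c ^ 2 := by
    nlinarith [sq_abs a, sq_abs b, sq_nonneg (|a| - |b|), mul_pos ha' hb']
  have hcpos : 0 < c := by
    rcases hc0.eq_or_lt with h | h
    · rw [← h] at h1; nlinarith [mul_pos ha' hb']
    · exact h
  rw [← Real.mul_rpow ha'.le hb'.le, Real.rpow_neg (by positivity), one_div]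
  apply inv_anti₀ (by positivity)
  calc (|a| * |b|) ^ (1 - κ / 2) ≤ (c ^ 2) ^ (1 - κ / 2) :=
        Real.rpow_le_rpow (by positivity) h1 (by linarith)
    _ = c ^ (2 - κ) := by
        rw [← Real.rpow_natCast, ← Real.rpow_mul hc0]; congr 1; push_cast; ring

theorem ae_coord_ne (i : Fin 3) (a : ℝ) : ∀ᵐ u : R3, u i ≠ a := by
  have h := (EuclideanSpace.volume_preserving_symm_measurableEquiv_toLp (Fin 3)).quasiMeasurePreserving.ae
    (p := fun f : Fin 3 → ℝ => f i ≠ a) (by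
      have := Measure.pi_hyperplane (fun _ : Fin 3 => (volume : Measure ℝ)) i a
      rw [ae_iff, volume_pi]; simpa only [ne_eq, not_not] using this)
  exact h

theorem measurePreserving_splitCoord (i : Fin 3) :
    MeasurePreserving (fun u : R3 => ((u i, fun j => u (i.succAbove j)) : ℝ × (Fin 2 → ℝ))) := by
  have h1 := EuclideanSpace.volume_preserving_symm_measurableEquiv_toLp (Fin 3)
  have h2 := volume_preserving_piFinSuccAbove (fun _ : Fin 3 => ℝ) i
  exact h2.comp h1

theorem sum_coord_sq_le (i : Fin 3) (w : R3) :
    w (i.succAbove 0) ^ 2 + w (i.succAbove 1) ^ 2 + w i ^ 2 = ‖w‖ ^ 2 := by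
  rw [EuclideanSpace.norm_sq_eq, Fin.sum_univ_succAbove _ i]
  simp [Fin.sum_univ_two]; ring

/-- The two coordinates other than `i` carry the whole singularity of the kernel, so `Φ` is
integrated along coordinate `i` with no kernel left. Translation invariance makes the constant
independent of `V`. -/
theorem lintegral_kernel_mul_le {θ κ : ℝ} (hθ : 0 < θ) (hκ : 0 < κ) (hκ1 : κ ≤ 1) :
    ∃ K : ℝ≥0∞, K ≠ ⊤ ∧ ∀ (i : Fin 3) (V : R3) (Φ : ℝ × (Fin 2 → ℝ) → ℝ≥0∞) (B : ℝ≥0∞),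
      Measurable Φ → (∀ z, ∫⁻ y, Φ (y, z) ≤ B) →
      ∫⁻ u : R3, ENNReal.ofReal (Real.exp (-θ * ‖V - u‖ ^ 2) / ‖V - u‖ ^ (2 - κ)) *
        Φ (u i, fun j => u (i.succAbove j)) ≤ K * B := by
  set k : ℝ → ℝ≥0∞ := fun y =>
    ENNReal.ofReal (|y| ^ (-(1 - κ / 2)) * Real.exp (-θ * y ^ 2)) with hk
  have hkm : Measurable k := by fun_prop
  have hfin : ∫⁻ y, k y < ⊤ := lintegral_abs_rpow_mul_exp_lt_top (by linarith) hθ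
  refine ⟨(∫⁻ y, k y) * ∫⁻ y, k y, ENNReal.mul_ne_top hfin.ne hfin.ne, ?_⟩
  intro i V Φ B hΦ hB
  set H : ℝ × (Fin 2 → ℝ) → ℝ≥0∞ := fun q =>
    k (V (i.succAbove 0) - q.2 0) * k (V (i.succAbove 1) - q.2 1) * Φ q with hH
  have hHm : Measurable H := by fun_prop
  calc _ ≤ ∫⁻ u : R3, H (u i, fun j => u (i.succAbove j)) := by
        apply lintegral_mono_ae
        filter_upwards [ae_coord_ne (i.succAbove 0) (V (i.succAbove 0)),
          ae_coord_ne (i.succAbove 1) (V (i.succAbove 1))] with u h0 h1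
        simp only [hH, hk]
        gcongr
        rw [← ENNReal.ofReal_mul (by positivity)]
        apply ENNReal.ofReal_le_ofReal
        have hs := sum_coord_sq_le i (V - u)
        simp only [PiLp.sub_apply] at hs
        have hs' : (V (i.succAbove 0) - u (i.succAbove 0)) ^ 2 +
          (V (i.succAbove 1) - u (i.succAbove 1)) ^ 2 ≤ ‖V - u‖ ^ 2 := by
            nlinarith [sq_nonneg (V i - u i)]
        have e1 := norm_rpow_inv_le hκ1 (sub_ne_zero.2 h0.symm) (sub_ne_zero.2 h1.symm) hs'
          (norm_nonneg _)
        have e2 : Real.exp (-θ * ‖V - u‖ ^ 2) ≤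
            Real.exp (-θ * (V (i.succAbove 0) - u (i.succAbove 0)) ^ 2) *
            Real.exp (-θ * (V (i.succAbove 1) - u (i.succAbove 1)) ^ 2) := by
          rw [← Real.exp_add]; apply Real.exp_le_exp.2; nlinarith
        calc _ = Real.exp (-θ * ‖V - u‖ ^ 2) * (1 / ‖V - u‖ ^ (2 - κ)) := by ring
          _ ≤ _ := mul_le_mul e2 e1 (by positivity) (by positivity)
          _ = _ := by ring
    _ = ∫⁻ q, H q := (measurePreserving_splitCoord i).lintegral_comp hHm
    _ = ∫⁻ z, ∫⁻ y, H (y, z) := by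
        rw [Measure.volume_eq_prod]; exact lintegral_prod_symm' _ hHm
    _ ≤ ∫⁻ z : Fin 2 → ℝ,
          (k (V (i.succAbove 0) - z 0) * k (V (i.succAbove 1) - z 1)) * B := by
        apply lintegral_mono
        intro z
        simp only [hH]
        rw [lintegral_const_mul _ (by fun_prop)]
        gcongr
        exact hB z
    _ = (∫⁻ z : Fin 2 → ℝ, k (V (i.succAbove 0) - z 0) * k (V (i.succAbove 1) - z 1)) * B := by
        rw [lintegral_mul_const _ (by fun_prop)]
    _ = (∫⁻ q : ℝ × ℝ, k (V (i.succAbove 0) - q.1) * k (V (i.succAbove 1) - q.2)) * B := by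
        rw [← (volume_preserving_finTwoArrow ℝ).lintegral_comp (by fun_prop)]
        rfl
    _ = _ := by
        rw [Measure.volume_eq_prod,
          lintegral_prod_mul (f := fun y => k (V (i.succAbove 0) - y))
            (g := fun y => k (V (i.succAbove 1) - y)) (by fun_prop) (by fun_prop),
          lintegral_sub_left_eq_self, lintegral_sub_left_eq_self]

/-- Rescaling by √A turns the integrand into A^{-β/2}(1 + y²)^{-β/2}, integrable for β > 1; the
Jacobian returns one factor √A. -/
theorem lintegral_line_le {β m : ℝ} (hβ : 1 < β) (hm : 0 < m) :
    ∃ K > (0 : ℝ), ∀ a b A : ℝ, m ≤ |a| → 0 < A →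
      ∫⁻ y : ℝ, ENNReal.ofReal (((a * y + b) ^ 2 + A) ^ (-(β / 2))) ≤
        ENNReal.ofReal (K * A ^ (-((β - 1) / 2))) := by
  set φ : ℝ → ℝ := fun x => (1 + ‖x‖ ^ 2) ^ (-β / 2) with hφ
  have hint : Integrable φ := integrable_rpow_neg_one_add_norm_sq (by simpa using hβ)
  have hpos : 0 ≤ ∫ x, φ x := integral_nonneg fun x => by positivity
  refine ⟨(∫ x, φ x) / m + 1, by positivity, fun a b A ha hA => ?_⟩
  have hs : 0 < Real.sqrt A := Real.sqrt_pos.2 hA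
  have ha0 : a ≠ 0 := by intro h; simp [h] at ha; linarith
  have hc : a / Real.sqrt A ≠ 0 := div_ne_zero ha0 hs.ne'
  have key : ∀ y : ℝ, ((a * y + b) ^ 2 + A) ^ (-(β / 2)) =
      A ^ (-(β / 2)) * φ (a / Real.sqrt A * y + b / Real.sqrt A) := by
    intro y
    have : (a * y + b) ^ 2 + A = A * (1 + ‖a / Real.sqrt A * y + b / Real.sqrt A‖ ^ 2) := by
      rw [Real.norm_eq_abs, sq_abs]
      have : a / Real.sqrt A * y + b / Real.sqrt A = (a * y + b) / Real.sqrt A := by ring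
      rw [this, div_pow, Real.sq_sqrt hA.le]; field_simp; ring
    rw [this, Real.mul_rpow hA.le (by positivity), hφ, neg_div]
  have hint2 : Integrable fun y : ℝ => φ (a / Real.sqrt A * y + b / Real.sqrt A) :=
    (hint.comp_add_right (b / Real.sqrt A)).comp_mul_left' hc
  have hval : ∫ y : ℝ, φ (a / Real.sqrt A * y + b / Real.sqrt A) =
      |(a / Real.sqrt A)⁻¹| * ∫ x, φ x := by
    rw [Measure.integral_comp_mul_left (fun y => φ (y + b / Real.sqrt A)),
      integral_add_right_eq_self φ]; rfl
  simp_rw [key]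
  rw [← ofReal_integral_eq_lintegral_ofReal (hint2.const_mul _)
    (Filter.Eventually.of_forall fun y => by simp only [hφ]; positivity), integral_const_mul, hval]
  apply ENNReal.ofReal_le_ofReal
  have e1 : A ^ (-(β / 2)) * Real.sqrt A = A ^ (-((β - 1) / 2)) := by
    rw [Real.sqrt_eq_rpow, ← Real.rpow_add hA]; congr 1; ring
  rw [inv_div, abs_div, abs_of_pos hs]
  calc A ^ (-(β / 2)) * (Real.sqrt A / |a| * ∫ x, φ x)
      = (A ^ (-(β / 2)) * Real.sqrt A) * ((∫ x, φ x) / |a|) := by ring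
    _ = A ^ (-((β - 1) / 2)) * ((∫ x, φ x) / |a|) := by rw [e1]
    _ ≤ A ^ (-((β - 1) / 2)) * ((∫ x, φ x) / m + 1) := by
        gcongr
        have : (∫ x, φ x) / |a| ≤ (∫ x, φ x) / m := by gcongr
        linarith
    _ = _ := by ring

/-! ### Comparison of ⟨u⟩, ⟨V⟩ and ⟨V - u⟩; polynomial factors against the Gaussian. -/

theorem one_le_bracket (v : R3) : 1 ≤ bracket v := by
  unfold bracket
  rw [Real.one_le_sqrt]
  nlinarith [sq_nonneg ‖v‖]

theorem bracket_pos (v : R3) : 0 < bracket v := lt_of_lt_of_le one_pos (one_le_bracket v)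

theorem bracket_sq (v : R3) : bracket v ^ 2 = 1 + ‖v‖ ^ 2 := by
  unfold bracket
  rw [Real.sq_sqrt (by positivity)]

theorem norm_le_bracket (v : R3) : ‖v‖ ≤ bracket v :=
  abs_le_of_sq_le_sq' (by rw [bracket_sq]; linarith) (bracket_pos v).le |>.2

theorem bracket_sq_le_mul (u w : R3) : bracket u ^ 2 ≤ 2 * bracket w ^ 2 * bracket (w - u) ^ 2 := by
  simp only [bracket_sq]
  have h : ‖u‖ ≤ ‖w‖ + ‖w - u‖ := by
    have := norm_sub_le w (w - u); simpa using this
  have h2 : ‖u‖ ^ 2 ≤ 2 * ‖w‖ ^ 2 + 2 * ‖w - u‖ ^ 2 := by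
    nlinarith [sq_nonneg (‖w‖ - ‖w - u‖), norm_nonneg u, norm_nonneg w, norm_nonneg (w - u)]
  nlinarith [mul_nonneg (sq_nonneg ‖w‖) (sq_nonneg ‖w - u‖)]

theorem bracket_le_mul (u w : R3) : bracket u ≤ 2 * bracket w * bracket (w - u) := by
  refine (abs_le_of_sq_le_sq' ?_ ?_).2
  · have := bracket_sq_le_mul u w
    nlinarith [mul_nonneg (sq_nonneg (bracket w)) (sq_nonneg (bracket (w - u)))]
  · have := bracket_pos w; have := bracket_pos (w - u); positivity

theorem bracket_sq_rpow (v : R3) (r : ℝ) : (bracket v ^ 2) ^ (r / 2) = bracket v ^ r := by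
  rw [← Real.rpow_natCast, ← Real.rpow_mul (bracket_pos v).le]; congr 1; push_cast; ring

theorem exp_mul_bracket_rpow_le {θ k : ℝ} (hθ : 0 < θ) (hk : 0 ≤ k) :
    ∃ C > (0 : ℝ), ∀ w : R3, Real.exp (-θ * ‖w‖ ^ 2) * bracket w ^ k ≤
      C * Real.exp (-(θ / 2) * ‖w‖ ^ 2) := by
  -- The bound c ≤ 1 gives ⟨w⟩² ≤ c⁻¹exp(c|w|²), and ck ≤ θ ensures that the power k of the bracket
  -- uses at most half of the Gaussian.
  set c := min 1 (θ / (k + 1)) with hc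
  have hc0 : 0 < c := by positivity
  have hck : c * k ≤ θ := by
    have h1 : c ≤ θ / (k + 1) := min_le_right _ _
    calc c * k ≤ θ / (k + 1) * (k + 1) := by gcongr; linarith
      _ = θ := by field_simp
  refine ⟨(1 / c) ^ (k / 2), by positivity, fun w => ?_⟩
  have h1 : bracket w ^ 2 ≤ (1 / c) * Real.exp (c * ‖w‖ ^ 2) := by
    rw [bracket_sq, one_div, ← div_eq_inv_mul, le_div_iff₀ hc0]
    have := Real.add_one_le_exp (c * ‖w‖ ^ 2)
    have : c ≤ 1 := min_le_left _ _
    nlinarith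
  have h2 : bracket w ^ k ≤ (1 / c) ^ (k / 2) * Real.exp (c * ‖w‖ ^ 2 * (k / 2)) := by
    rw [← bracket_sq_rpow, Real.exp_mul, ← Real.mul_rpow (by positivity) (by positivity)]
    exact Real.rpow_le_rpow (by positivity) h1 (by positivity)
  calc _ ≤ Real.exp (-θ * ‖w‖ ^ 2) * ((1 / c) ^ (k / 2) * Real.exp (c * ‖w‖ ^ 2 * (k / 2))) := by
        gcongr
    _ = (1 / c) ^ (k / 2) * Real.exp (-θ * ‖w‖ ^ 2 + c * ‖w‖ ^ 2 * (k / 2)) := by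
        rw [Real.exp_add]; ring
    _ ≤ _ := by
        gcongr
        nlinarith [sq_nonneg ‖w‖, mul_le_mul_of_nonneg_right hck (sq_nonneg ‖w‖)]

theorem exists_coord_ge (N : R3) : ∃ i : Fin 3, ‖N‖ / 2 ≤ |N i| := by
  by_contra! h
  have e : ‖N‖ ^ 2 = |N 0| ^ 2 + |N 1| ^ 2 + |N 2| ^ 2 := by
    rw [EuclideanSpace.norm_sq_eq]; simp [Fin.sum_univ_three]
  have hn := norm_nonneg N
  have h' : ∀ i, |N i| ^ 2 < (‖N‖ / 2) ^ 2 := fun i =>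
    pow_lt_pow_left₀ (h i) (abs_nonneg _) two_ne_zero
  nlinarith [h' 0, h' 1, h' 2, sq_nonneg ‖N‖]

theorem inner_eq_coord (i : Fin 3) (u N : R3) :
    inner ℝ u N = N i * u i + ∑ j : Fin 2, N (i.succAbove j) * u (i.succAbove j) := by
  rw [PiLp.inner_apply, Fin.sum_univ_succAbove _ i]
  simp [mul_comm]

theorem bracket_rpow_le_mul {r : ℝ} (hr : 0 ≤ r) (u V : R3) :
    bracket u ^ r ≤ 2 ^ r * bracket V ^ r * bracket (V - u) ^ r := by
  have hV := bracket_pos V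
  have hw := bracket_pos (V - u)
  rw [← Real.mul_rpow (by positivity) (by positivity),
    ← Real.mul_rpow (by positivity) (by positivity)]
  exact Real.rpow_le_rpow (bracket_pos u).le (bracket_le_mul u V) hr

/-- Replacing ⟨u⟩ by ⟨V⟩ makes the additive term constant in u, as the line integral requires. The
cost ⟨V - u⟩^β is left to the Gaussian. -/
theorem kinetic_rpow_le_mul {β h a : ℝ} (hβ : 1 < β) (hh : 0 < h) (u V : R3) :
    (a ^ 2 + bracket u ^ 2 * h) ^ (-(β / 2)) ≤
      2 ^ (β / 2) * bracket (V - u) ^ β * (a ^ 2 + bracket V ^ 2 * h) ^ (-(β / 2)) := by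
  have hu := bracket_pos u
  have hV := bracket_pos V
  have hw := bracket_pos (V - u)
  have hx : (a ^ 2 + bracket V ^ 2 * h) / (2 * bracket (V - u) ^ 2) ≤
      a ^ 2 + bracket u ^ 2 * h := by
    rw [div_le_iff₀ (by positivity)]
    have p1 := bracket_sq_le_mul V u
    rw [← neg_sub V u, show bracket (-(V - u)) = bracket (V - u) by simp [bracket, norm_sub_rev]] at p1
    have p2 : 1 ≤ bracket (V - u) ^ 2 := one_le_pow₀ (one_le_bracket _)
    nlinarith [sq_nonneg a, mul_le_mul_of_nonneg_right p1 hh.le,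
      mul_le_mul_of_nonneg_left p2 (sq_nonneg a)]
  calc _ ≤ ((a ^ 2 + bracket V ^ 2 * h) / (2 * bracket (V - u) ^ 2)) ^ (-(β / 2)) :=
        Real.rpow_le_rpow_of_nonpos (by positivity) hx (by linarith)
    _ = _ := by
        rw [Real.div_rpow (by positivity) (by positivity), Real.rpow_neg
          (by positivity : 0 ≤ 2 * bracket (V - u) ^ 2), div_inv_eq_mul,
          Real.mul_rpow (by positivity) (by positivity), bracket_sq_rpow]
        ring

/-- For a pure moment no weight is available to integrate in the remaining coordinate; a part of the
Gaussian takes its place. -/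
theorem exp_le_exp_mul_exp_coord {θ : ℝ} (hθ : 0 < θ) (i : Fin 3) (w : R3) :
    Real.exp (-(θ / 2) * ‖w‖ ^ 2) ≤
      Real.exp (-(θ / 4) * ‖w‖ ^ 2) * Real.exp (-(θ / 4) * w i ^ 2) := by
  rw [← Real.exp_add]
  apply Real.exp_le_exp.2
  nlinarith [sum_coord_sq_le i w, sq_nonneg (w (i.succAbove 0)), sq_nonneg (w (i.succAbove 1))]

/-- The collision kernel integrated against a moment. -/
theorem lintegral_kernel_moment_le {θ κ r : ℝ} (hθ : 0 < θ) (hκ : 0 < κ) (hκ1 : κ ≤ 1)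
    (hr : 0 ≤ r) : ∃ K > (0 : ℝ), ∀ V : R3,
      ∫⁻ u : R3, ENNReal.ofReal (Real.exp (-θ * ‖V - u‖ ^ 2) / ‖V - u‖ ^ (2 - κ) *
        bracket u ^ r) ≤ ENNReal.ofReal (K * bracket V ^ r) := by
  obtain ⟨C, hC, hCb⟩ := exp_mul_bracket_rpow_le hθ hr
  obtain ⟨K, hK, hKb⟩ := lintegral_kernel_mul_le (θ := θ / 4) (by positivity) hκ hκ1
  obtain ⟨B, hB⟩ : ∃ B, B = ∫⁻ y : ℝ, ENNReal.ofReal (Real.exp (-(θ / 4) * y ^ 2)) := ⟨_, rfl⟩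
  have hBf : B ≠ ⊤ := hB ▸ (integrable_exp_neg_mul_sq (by positivity)).lintegral_lt_top.ne
  obtain ⟨k, hk0, hk⟩ : ∃ k : ℝ, 0 ≤ k ∧ K * B = ENNReal.ofReal k :=
    ⟨_, ENNReal.toReal_nonneg, (ENNReal.ofReal_toReal (ENNReal.mul_ne_top hK hBf)).symm⟩
  refine ⟨2 ^ r * C * (k + 1), by positivity, fun V => ?_⟩
  have hV := bracket_pos V
  have h1 := hKb 0 V (fun q => ENNReal.ofReal (Real.exp (-(θ / 4) * (V 0 - q.1) ^ 2))) B
    (by fun_prop) (fun z => by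
      rw [hB]
      exact (lintegral_sub_left_eq_self
        (fun y : ℝ => ENNReal.ofReal (Real.exp (-(θ / 4) * y ^ 2))) (V 0)).le)
  calc _ ≤ ∫⁻ u : R3, ENNReal.ofReal (2 ^ r * C * bracket V ^ r) *
        (ENNReal.ofReal (Real.exp (-(θ / 4) * ‖V - u‖ ^ 2) / ‖V - u‖ ^ (2 - κ)) *
          ENNReal.ofReal (Real.exp (-(θ / 4) * (V 0 - u 0) ^ 2))) := by
        apply lintegral_mono
        intro u
        have hu := bracket_pos u
        have hw := bracket_pos (V - u)
        beta_reduce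
        rw [← ENNReal.ofReal_mul (by positivity), ← ENNReal.ofReal_mul (by positivity)]
        apply ENNReal.ofReal_le_ofReal
        calc _ ≤ Real.exp (-θ * ‖V - u‖ ^ 2) / ‖V - u‖ ^ (2 - κ) *
              (2 ^ r * bracket V ^ r * bracket (V - u) ^ r) := by
              gcongr; exact bracket_rpow_le_mul hr u V
          _ = 2 ^ r * bracket V ^ r * (Real.exp (-θ * ‖V - u‖ ^ 2) * bracket (V - u) ^ r) /
              ‖V - u‖ ^ (2 - κ) := by ring
          _ ≤ 2 ^ r * bracket V ^ r * (C * (Real.exp (-(θ / 4) * ‖V - u‖ ^ 2) *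
            Real.exp (-(θ / 4) * (V 0 - u 0) ^ 2))) / ‖V - u‖ ^ (2 - κ) := by
              gcongr ?_ / _
              refine mul_le_mul_of_nonneg_left ?_ (by positivity)
              refine (hCb _).trans (mul_le_mul_of_nonneg_left ?_ hC.le)
              exact exp_le_exp_mul_exp_coord hθ 0 (V - u)
          _ = _ := by ring
    _ = ENNReal.ofReal (2 ^ r * C * bracket V ^ r) * _ :=
        lintegral_const_mul' _ _ ENNReal.ofReal_ne_top
    _ ≤ ENNReal.ofReal (2 ^ r * C * bracket V ^ r) * (K * B) := by gcongr
    _ ≤ _ := by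
        rw [hk, ← ENNReal.ofReal_mul (by positivity)]
        apply ENNReal.ofReal_le_ofReal
        have h3 : 0 < 2 ^ r * C * bracket V ^ r := by positivity
        nlinarith

theorem kernel_pointwise_le {e e' n U W Wb Wc V D D' q C a : ℝ} (h1 : e * Wc ≤ C * e')
    (h2 : Wc = W * Wb) (h3 : U ≤ a * V * W) (h4 : D ≤ q * Wb * D') (he : 0 ≤ e) (hn : 0 ≤ n)
    (hD : 0 ≤ D) (hD' : 0 ≤ D') (haV : 0 ≤ a * V * W) (hqV : 0 ≤ q * (a * V)) :
    e / n * U * D ≤ a * q * C * V * (e' / n * D') := by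
  have hen : 0 ≤ e / n := div_nonneg he hn
  calc e / n * U * D ≤ e / n * (a * V * W) * (q * Wb * D') :=
        mul_le_mul (mul_le_mul_of_nonneg_left h3 hen) h4 hD (mul_nonneg hen haV)
    _ = (e * Wc) * (q * (a * V) * D' / n) := by rw [h2]; ring
    _ ≤ (C * e') * (q * (a * V) * D' / n) := by
        apply mul_le_mul_of_nonneg_right h1
        exact div_nonneg (mul_nonneg hqV hD') hn
    _ = _ := by ring

/-- The collision kernel integrated against a moment and a kinetic weight. -/
theorem lintegral_kernel_weight_le {θ κ β r m : ℝ} (hθ : 0 < θ) (hκ : 0 < κ) (hκ1 : κ ≤ 1)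
    (hβ : 1 < β) (hr : 0 ≤ r) (hm : 0 < m) : ∃ K > (0 : ℝ), ∀ (V N : R3) (h : ℝ),
      m ≤ ‖N‖ → 0 < h →
      ∫⁻ u : R3, ENNReal.ofReal (Real.exp (-θ * ‖V - u‖ ^ 2) / ‖V - u‖ ^ (2 - κ) *
        bracket u ^ r * (inner ℝ u N ^ 2 + bracket u ^ 2 * h) ^ (-(β / 2))) ≤
        ENNReal.ofReal (K * bracket V ^ r * (bracket V ^ 2 * h) ^ (-((β - 1) / 2))) := by
  obtain ⟨C, hC, hCb⟩ := exp_mul_bracket_rpow_le hθ (by linarith : 0 ≤ r + β)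
  obtain ⟨K, hK, hKb⟩ := lintegral_kernel_mul_le (θ := θ / 2) (by positivity) hκ hκ1
  obtain ⟨L, hL, hLb⟩ := lintegral_line_le hβ (by positivity : 0 < m / 2)
  obtain ⟨k, hk0, hk⟩ : ∃ k : ℝ, 0 ≤ k ∧ K = ENNReal.ofReal k :=
    ⟨_, ENNReal.toReal_nonneg, (ENNReal.ofReal_toReal hK).symm⟩
  refine ⟨2 ^ r * 2 ^ (β / 2) * C * (k + 1) * L, by positivity, fun V N h hN hh => ?_⟩
  -- Along this coordinate the slope of u·N is at least m/2, uniformly in N.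
  obtain ⟨i, hi⟩ := exists_coord_ge N
  have hV := bracket_pos V
  obtain ⟨A, hA⟩ : ∃ A, A = bracket V ^ 2 * h := ⟨_, rfl⟩
  have hA0 : 0 < A := by rw [hA]; positivity
  rw [← hA]
  have h1 := hKb i V (fun q => ENNReal.ofReal
    (((N i * q.1 + ∑ j : Fin 2, N (i.succAbove j) * q.2 j) ^ 2 + A) ^ (-(β / 2))))
    (ENNReal.ofReal (L * A ^ (-((β - 1) / 2)))) (by fun_prop)
    (fun z => hLb (N i) (∑ j : Fin 2, N (i.succAbove j) * z j) A (by linarith) hA0)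
  calc _ ≤ ∫⁻ u : R3, ENNReal.ofReal (2 ^ r * 2 ^ (β / 2) * C * bracket V ^ r) *
        (ENNReal.ofReal (Real.exp (-(θ / 2) * ‖V - u‖ ^ 2) / ‖V - u‖ ^ (2 - κ)) *
          ENNReal.ofReal (((N i * u i + ∑ j : Fin 2, N (i.succAbove j) * u (i.succAbove j)) ^ 2
            + A) ^ (-(β / 2)))) := by
        apply lintegral_mono
        intro u
        have hu := bracket_pos u
        have hw := bracket_pos (V - u)
        beta_reduce
        rw [← inner_eq_coord, ← ENNReal.ofReal_mul (by positivity),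
          ← ENNReal.ofReal_mul (by positivity)]
        apply ENNReal.ofReal_le_ofReal
        have e3 : bracket (V - u) ^ (r + β) = bracket (V - u) ^ r * bracket (V - u) ^ β :=
          Real.rpow_add hw _ _
        have e2 := kinetic_rpow_le_mul (a := inner ℝ u N) hβ hh u V
        rw [← hA] at e2
        exact kernel_pointwise_le (hCb (V - u)) e3 (bracket_rpow_le_mul hr u V) e2 (by positivity)
          (by positivity) (by positivity) (by positivity) (by positivity) (by positivity)
    _ = ENNReal.ofReal (2 ^ r * 2 ^ (β / 2) * C * bracket V ^ r) * _ :=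
        lintegral_const_mul' _ _ ENNReal.ofReal_ne_top
    _ ≤ ENNReal.ofReal (2 ^ r * 2 ^ (β / 2) * C * bracket V ^ r) *
        (K * ENNReal.ofReal (L * A ^ (-((β - 1) / 2)))) := by gcongr
    _ ≤ _ := by
        rw [hk, ← ENNReal.ofReal_mul hk0, ← ENNReal.ofReal_mul (by positivity)]
        apply ENNReal.ofReal_le_ofReal
        have h3 : 0 < 2 ^ r * 2 ^ (β / 2) * C * bracket V ^ r * L * A ^ (-((β - 1) / 2)) := by
          positivity
        calc _ = 2 ^ r * 2 ^ (β / 2) * C * bracket V ^ r * L * A ^ (-((β - 1) / 2)) * k := by ring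
          _ ≤ 2 ^ r * 2 ^ (β / 2) * C * bracket V ^ r * L * A ^ (-((β - 1) / 2)) * (k + 1) := by
              gcongr; linarith
          _ = _ := by ring

end SpecularBoltzmann

namespace SpecularBoltzmann

/-! ### The domain and the field -/

section Geometry

set_option maxSynthPendingDepth 5

variable {ξ : R3 → ℝ}

theorem inner_gradient (ξ : R3 → ℝ) (x v : R3) : inner ℝ v (gradient ξ x) = fderiv ℝ ξ x v := by
  rw [real_inner_comm]
  exact InnerProductSpace.toDual_symm_apply

theorem IsDefiningFunction.contDiff_fderiv (hξ : IsDefiningFunction ξ) :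
    ContDiff ℝ 2 (fderiv ℝ ξ) := hξ.contDiff.fderiv_right (by norm_num)

theorem IsDefiningFunction.contDiff_fderiv2 (hξ : IsDefiningFunction ξ) :
    ContDiff ℝ 1 (fderiv ℝ (fderiv ℝ ξ)) := hξ.contDiff_fderiv.fderiv_right (by norm_num)

theorem IsDefiningFunction.continuous_fderiv3 (hξ : IsDefiningFunction ξ) :
    Continuous (fderiv ℝ (fderiv ℝ (fderiv ℝ ξ))) :=
  (hξ.contDiff_fderiv2.fderiv_right (m := 0) (by norm_num)).continuous

theorem IsDefiningFunction.continuous_gradient (hξ : IsDefiningFunction ξ) :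
    Continuous (gradient ξ) :=
  (LinearIsometryEquiv.continuous _).comp hξ.contDiff_fderiv.continuous

theorem IsDefiningFunction.isOpen_domain (hξ : IsDefiningFunction ξ) : IsOpen (domain ξ) :=
  isOpen_lt hξ.contDiff.continuous continuous_const

theorem IsDefiningFunction.mem_closure_iff (hξ : IsDefiningFunction ξ) {x : R3} :
    x ∈ closure (domain ξ) ↔ ξ x ≤ 0 := by
  rw [closure_eq_self_union_frontier, hξ.frontier_eq]
  simp [domain, le_iff_lt_or_eq]

theorem IsDefiningFunction.mem_frontier_iff (hξ : IsDefiningFunction ξ) {x : R3} :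
    x ∈ frontier (domain ξ) ↔ ξ x = 0 := by
  rw [hξ.frontier_eq]; rfl

theorem IsDefiningFunction.isCompact_closure (hξ : IsDefiningFunction ξ) :
    IsCompact (closure (domain ξ)) := hξ.bounded.isCompact_closure

/-- The maximum of f and g is positive at every point of K and attains its minimum. With g the depth
-ξ, this turns a positivity known only on the boundary into a dichotomy on the whole closure. -/
theorem exists_pos_le_max {X : Type*} [TopologicalSpace X] {K : Set X} (hK : IsCompact K)
    {f g : X → ℝ} (hf : ContinuousOn f K) (hg : ContinuousOn g K) (h0 : ∀ x ∈ K, 0 ≤ g x)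
    (h : ∀ x ∈ K, g x = 0 → 0 < f x) : ∃ m > (0 : ℝ), ∀ x ∈ K, m ≤ max (f x) (g x) := by
  rcases K.eq_empty_or_nonempty with rfl | hne
  · exact ⟨1, one_pos, by simp⟩
  obtain ⟨z, hz, hmin⟩ := hK.exists_isMinOn hne (f := fun x => max (f x) (g x)) (hf.sup hg)
  refine ⟨max (f z) (g z), ?_, fun x hx => hmin hx⟩
  rcases (h0 z hz).eq_or_lt with h1 | h1
  · exact lt_max_of_lt_left (h z hz h1.symm)
  · exact lt_max_of_lt_right h1

theorem exists_bound_norm {X F : Type*} [TopologicalSpace X] [SeminormedAddCommGroup F] {K : Set X}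
    (hK : IsCompact K) {f : X → F} (hf : ContinuousOn f K) :
    ∃ C > (0 : ℝ), ∀ x ∈ K, ‖f x‖ ≤ C := by
  obtain ⟨C, hC⟩ := hK.exists_bound_of_continuousOn hf
  exact ⟨max C 1, by positivity, fun x hx => (hC x hx).trans (le_max_left _ _)⟩

theorem IsDefiningFunction.exists_gradient_lower (hξ : IsDefiningFunction ξ) :
    ∃ m > (0 : ℝ), ∀ x ∈ closure (domain ξ), m ≤ max ‖gradient ξ x‖ (-ξ x) := by
  refine exists_pos_le_max hξ.isCompact_closure hξ.continuous_gradient.norm.continuousOn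
    hξ.contDiff.continuous.neg.continuousOn
    (fun x hx => by linarith [hξ.mem_closure_iff.1 hx]) (fun x hx h => ?_)
  obtain ⟨ε, hε, h2⟩ := hξ.gradient_ne_zero
  exact norm_pos_iff.2 (h2 x hx (by rw [neg_eq_zero.1 h]; simpa using hε))

/-- Near each of its points, the closure of the domain is convex. -/
theorem IsDefiningFunction.exists_convex_inter_ball (hξ : IsDefiningFunction ξ) {x₀ : R3}
    (hx₀ : x₀ ∈ closure (domain ξ)) :
    ∃ r > 0, Convex ℝ (closure (domain ξ) ∩ Metric.ball x₀ r) := by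
  obtain ⟨c, hc, hcv⟩ := hξ.strictlyConvex
  have hcont := hξ.contDiff_fderiv2.continuous.continuousAt (x := x₀)
  obtain ⟨r, hr, hball⟩ := Metric.continuousAt_iff.1 hcont c hc
  -- Segments between points of the closure are not yet known to stay in it, so the Hessian must be
  -- nonnegative on the whole ball; continuity at x₀ with tolerance c gives this.
  have hpos : ∀ x ∈ Metric.ball x₀ r, ∀ ζ, 0 ≤ hessForm ξ x ζ := by
    intro x hx ζ
    have h1 := hball hx
    rw [dist_eq_norm] at h1
    have h2 : |(fderiv ℝ (fderiv ℝ ξ) x - fderiv ℝ (fderiv ℝ ξ) x₀) ζ ζ| ≤ c * ‖ζ‖ ^ 2 := by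
      rw [← Real.norm_eq_abs]
      calc _ ≤ ‖fderiv ℝ (fderiv ℝ ξ) x - fderiv ℝ (fderiv ℝ ξ) x₀‖ * ‖ζ‖ * ‖ζ‖ :=
            ContinuousLinearMap.le_opNorm₂ _ _ _
        _ ≤ c * ‖ζ‖ * ‖ζ‖ := by gcongr
        _ = _ := by ring
    have h3 := hcv x₀ hx₀ ζ
    have h4 := (abs_le.1 h2).1
    simp only [sub_apply] at h4
    unfold hessForm at h3 ⊢
    linarith
  refine ⟨r, hr, fun x hx y hy a b ha hb hab => ⟨?_, convex_ball x₀ r hx.2 hy.2 ha hb hab⟩⟩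
  rw [hξ.mem_closure_iff]
  set L : ℝ → R3 := fun τ => x + τ • (y - x) with hL
  have hLd : ∀ τ, HasDerivAt L (y - x) τ := by
    intro τ
    simpa [hL] using ((hasDerivAt_id τ).smul_const (y - x)).const_add x
  have hd1 : ∀ τ, HasDerivAt (fun τ => ξ (L τ)) (fderiv ℝ ξ (L τ) (y - x)) τ := fun τ =>
    ((hξ.contDiff.differentiable (by norm_num)) (L τ)).hasFDerivAt.comp_hasDerivAt τ (hLd τ)
  have hd2 : ∀ τ, HasDerivAt (fun τ => fderiv ℝ ξ (L τ) (y - x)) (hessForm ξ (L τ) (y - x)) τ := by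
    intro τ
    have h1 := ((hξ.contDiff_fderiv.differentiable (by norm_num)) (L τ)).hasFDerivAt.comp_hasDerivAt
      τ (hLd τ)
    simpa [hessForm] using h1.clm_apply (hasDerivAt_const τ (y - x))
  have hderiv : deriv (fun τ => ξ (L τ)) = fun τ => fderiv ℝ ξ (L τ) (y - x) :=
    funext fun τ => (hd1 τ).deriv
  have hconv : ConvexOn ℝ (Icc (0 : ℝ) 1) (fun τ => ξ (L τ)) := by
    apply convexOn_of_deriv2_nonneg' (convex_Icc 0 1)
    · exact fun τ _ => (hd1 τ).differentiableAt.differentiableWithinAt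
    · rw [hderiv]; exact fun τ _ => (hd2 τ).differentiableAt.differentiableWithinAt
    · intro τ hτ
      simp only [Function.iterate_succ, Function.iterate_zero, Function.comp, id]
      rw [hderiv, (hd2 τ).deriv]
      apply hpos
      have := convex_ball x₀ r hx.2 hy.2 (sub_nonneg.2 hτ.2) hτ.1 (by ring)
      convert this using 1
      simp only [hL]; module
  have hc1 := hconv.2 (left_mem_Icc.2 zero_le_one) (right_mem_Icc.2 zero_le_one) ha hb hab
  have e0 : L 0 = x := by simp [hL]
  have e1 : L 1 = y := by simp [hL]
  have e2 : L (a • 0 + b • 1) = a • x + b • y := by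
    simp only [hL, smul_eq_mul]
    rw [show a = 1 - b by linarith]; module
  simp only [e0, e1, e2] at hc1
  simp only [smul_eq_mul] at hc1
  have hx1 := hξ.mem_closure_iff.1 hx.1
  have hy1 := hξ.mem_closure_iff.1 hy.1
  nlinarith

/-- Differentiability up to the boundary gives Lipschitz bounds on convex pieces. Local convexity of
the closure supplies such pieces, and compactness combines them. -/
theorem IsC2Field.exists_lipschitz (hξ : IsDefiningFunction ξ) {T : ℝ} {E : ℝ → R3 → R3}
    (hE : IsC2Field ξ T E) :
    ∃ K, LipschitzOnWith K (fun p : ℝ × R3 => E p.1 p.2) (Icc 0 T ×ˢ closure (domain ξ)) := by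
  apply LocallyLipschitzOn.exists_lipschitzOnWith_of_compact
    (isCompact_Icc.prod hξ.isCompact_closure)
  rintro ⟨t, x⟩ ⟨ht, hx⟩
  obtain ⟨r, hr, hconv⟩ := hξ.exists_convex_inter_ball hx
  have hsub : Icc 0 T ×ˢ (closure (domain ξ) ∩ Metric.ball x r) ⊆ Icc 0 T ×ˢ closure (domain ξ) :=
    prod_mono le_rfl inter_subset_left
  have h1 : ContDiffWithinAt ℝ 1 (fun p : ℝ × R3 => E p.1 p.2)
      (Icc 0 T ×ˢ (closure (domain ξ) ∩ Metric.ball x r)) (t, x) :=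
    ((hE (t, x) ⟨ht, hx⟩).of_le (by norm_num)).mono hsub
  obtain ⟨K, u, hu, hK⟩ := h1.exists_lipschitzOnWith ((convex_Icc 0 T).prod hconv)
  refine ⟨K, u, ?_, hK⟩
  have hset : Icc 0 T ×ˢ (closure (domain ξ) ∩ Metric.ball x r) =
      (Icc 0 T ×ˢ closure (domain ξ)) ∩ (univ ×ˢ Metric.ball x r) := by
    rw [prod_inter_prod, inter_univ]
  rw [hset, nhdsWithin_inter_of_mem'] at hu
  · exact hu
  · exact mem_nhdsWithin_of_mem_nhds (prod_mem_nhds Filter.univ_mem (Metric.ball_mem_nhds x hr))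

/-- Quantitative form of the hypotheses on the domain and the field. -/
structure FieldBounds (ξ : R3 → ℝ) (T : ℝ) (E : ℝ → R3 → R3) (A m : ℝ) : Prop where
  one_le : 1 ≤ A
  m_pos : 0 < m
  abs_le : ∀ x ∈ closure (domain ξ), |ξ x| ≤ A
  fderiv_le : ∀ x ∈ closure (domain ξ), ‖fderiv ℝ ξ x‖ ≤ A
  fderiv2_le : ∀ x ∈ closure (domain ξ), ‖fderiv ℝ (fderiv ℝ ξ) x‖ ≤ A
  fderiv3_le : ∀ x ∈ closure (domain ξ), ‖fderiv ℝ (fderiv ℝ (fderiv ℝ ξ)) x‖ ≤ A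
  field_le : ∀ t ∈ Icc 0 T, ∀ x ∈ closure (domain ξ), ‖E t x‖ ≤ A
  field_lip : LipschitzOnWith A.toNNReal (fun p : ℝ × R3 => E p.1 p.2)
    (Icc 0 T ×ˢ closure (domain ξ))
  field_diff : ∀ t ∈ Ioo 0 T, ∀ x ∈ domain ξ,
    DifferentiableAt ℝ (fun p : ℝ × R3 => E p.1 p.2) (t, x)
  hess_ge : ∀ x ∈ closure (domain ξ), ∀ v, m * ‖v‖ ^ 2 ≤ hessForm ξ x v
  normal_ge : ∀ t ∈ Icc 0 T, ∀ x ∈ frontier (domain ξ), m ≤ fderiv ℝ ξ x (E t x)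
  coercive : ∀ t ∈ Icc 0 T, ∀ x ∈ closure (domain ξ), ∀ v,
    m * bracket v ^ 2 ≤ hessForm ξ x v + fderiv ℝ ξ x (E t x) + A * bracket v ^ 2 * (-ξ x)
  gradient_ge : ∀ x ∈ closure (domain ξ), m ≤ max ‖gradient ξ x‖ (-ξ x)

/-- Everything is compactness, except the coercivity of Hess ξ(v,v) + ∇ξ·E. Near the boundary the
sign condition makes ∇ξ·E positive and convexity provides the |v|² part; deep inside, a large
multiple of -ξ compensates a negative ∇ξ·E. -/
theorem exists_fieldBounds (hξ : IsDefiningFunction ξ) {T : ℝ} {E : ℝ → R3 → R3} {CE : ℝ}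
    (hE : IsC2Field ξ T E) (hs : SignCondition ξ T E CE) : ∃ A m, FieldBounds ξ T E A m := by
  have hK := hξ.isCompact_closure
  have hKT : IsCompact (Icc 0 T ×ˢ closure (domain ξ)) := isCompact_Icc.prod hK
  obtain ⟨A0, hA0, h0⟩ := exists_bound_norm hK hξ.contDiff.continuous.continuousOn
  obtain ⟨A1, hA1, h1⟩ := exists_bound_norm hK hξ.contDiff_fderiv.continuous.continuousOn
  obtain ⟨A2, hA2, h2⟩ := exists_bound_norm hK hξ.contDiff_fderiv2.continuous.continuousOn
  obtain ⟨A3, hA3, h3⟩ := exists_bound_norm hK hξ.continuous_fderiv3.continuousOn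
  have hEc : ContinuousOn (fun p : ℝ × R3 => E p.1 p.2) (Icc 0 T ×ˢ closure (domain ξ)) :=
    ContDiffOn.continuousOn hE
  obtain ⟨A4, hA4, h4⟩ := exists_bound_norm hKT hEc
  obtain ⟨K, hK'⟩ := hE.exists_lipschitz hξ
  obtain ⟨c, hc, hcv⟩ := hξ.strictlyConvex
  obtain ⟨m1, hm1, hg1⟩ := hξ.exists_gradient_lower
  have hFc : ContinuousOn (fun p : ℝ × R3 => fderiv ℝ ξ p.2 (E p.1 p.2))
      (Icc 0 T ×ˢ closure (domain ξ)) :=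
    (hξ.contDiff_fderiv.continuous.comp continuous_snd).continuousOn.clm_apply hEc
  have hfr : ∀ t ∈ Icc 0 T, ∀ x ∈ frontier (domain ξ), CE * m1 ≤ fderiv ℝ ξ x (E t x) := by
    intro t ht x hx
    have hx0 := hξ.mem_frontier_iff.1 hx
    have hg := hg1 x (frontier_subset_closure hx)
    rw [hx0, neg_zero, le_max_iff] at hg
    have hg : m1 ≤ ‖gradient ξ x‖ := hg.resolve_right (not_le.2 hm1)
    have hgp : 0 < ‖gradient ξ x‖ := hm1.trans_le hg
    have h := hs.2 t ht x hx
    rw [normal, real_inner_smul_right, inner_gradient, lt_inv_mul_iff₀ hgp] at h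
    nlinarith [hs.1]
  obtain ⟨m2, hm2, hg2⟩ := exists_pos_le_max (g := fun p : ℝ × R3 => -ξ p.2) hKT hFc
    (hξ.contDiff.continuous.comp continuous_snd).neg.continuousOn
    (fun p hp => by linarith [hξ.mem_closure_iff.1 hp.2])
    (fun p hp h => lt_of_lt_of_le (mul_pos hs.1 hm1)
      (hfr p.1 hp.1 p.2 (hξ.mem_frontier_iff.2 (neg_eq_zero.1 h))))
  set m := min (min c m1) (min (CE * m1) m2) with hm
  have hCm : 0 < CE * m1 := mul_pos hs.1 hm1
  have hmp : 0 < m := by positivity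
  have hmc : m ≤ c := (min_le_left _ _).trans (min_le_left _ _)
  have hmm1 : m ≤ m1 := (min_le_left _ _).trans (min_le_right _ _)
  have hmC : m ≤ CE * m1 := (min_le_right _ _).trans (min_le_left _ _)
  have hmm2 : m ≤ m2 := (min_le_right _ _).trans (min_le_right _ _)
  -- The last summand gives A(-ξ) ≥ A1·A4 + m wherever -ξ ≥ m, which outweighs |∇ξ·E| ≤ A1·A4.
  set A := 1 + A0 + A1 + A2 + A3 + A4 + K + (A1 * A4 + m) / m with hA
  have hK0 : (0 : ℝ) ≤ K := K.2
  have hA5 : 0 < (A1 * A4 + m) / m := by positivity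
  have hFb : ∀ t ∈ Icc 0 T, ∀ x ∈ closure (domain ξ), |fderiv ℝ ξ x (E t x)| ≤ A1 * A4 := by
    intro t ht x hx
    rw [← Real.norm_eq_abs]
    exact (ContinuousLinearMap.le_opNorm _ _).trans
      (mul_le_mul (h1 x hx) (h4 (t, x) ⟨ht, hx⟩) (norm_nonneg _) hA1.le)
  refine ⟨A, m, by linarith, hmp, fun x hx => (h0 x hx).trans (by linarith),
    fun x hx => (h1 x hx).trans (by linarith), fun x hx => (h2 x hx).trans (by linarith),
    fun x hx => (h3 x hx).trans (by linarith),
    fun t ht x hx => (h4 (t, x) ⟨ht, hx⟩).trans (by linarith), hK'.weaken ?_, ?_, ?_,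
    fun t ht x hx => hmC.trans (hfr t ht x hx), ?_, fun x hx => hmm1.trans (hg1 x hx)⟩
  · rw [← NNReal.coe_le_coe, Real.coe_toNNReal _ (by linarith)]; linarith
  · intro t ht x hx
    refine (ContDiffOn.contDiffAt hE (prod_mem_nhds (Icc_mem_nhds ht.1 ht.2) ?_)).differentiableAt
      (by norm_num)
    exact Filter.mem_of_superset (hξ.isOpen_domain.mem_nhds hx) subset_closure
  · intro x hx v
    exact (mul_le_mul_of_nonneg_right hmc (sq_nonneg _)).trans (hcv x hx v)
  · intro t ht x hx v
    have hq := hcv x hx v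
    have hx0 : 0 ≤ -ξ x := by linarith [hξ.mem_closure_iff.1 hx]
    have hb := bracket_sq v
    have hb1 : 1 ≤ bracket v ^ 2 := one_le_pow₀ (one_le_bracket v)
    have hmv := mul_le_mul_of_nonneg_right hmc (sq_nonneg ‖v‖)
    have hAx : 0 ≤ A * bracket v ^ 2 * (-ξ x) := mul_nonneg (mul_nonneg (by linarith) (by positivity)) hx0
    rcases le_max_iff.1 (hg2 (t, x) ⟨ht, hx⟩) with h | h
    · simp only at h
      rw [hb] at hAx ⊢
      nlinarith
    · simp only at h
      have hAm : (A1 * A4 + m) ≤ A * (-ξ x) := by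
        calc A1 * A4 + m = (A1 * A4 + m) / m * m := by field_simp
          _ ≤ A * (-ξ x) := by
            apply mul_le_mul (by linarith) (hmm2.trans h) hmp.le (by linarith)
      have h6 : A * (-ξ x) ≤ A * bracket v ^ 2 * (-ξ x) := by
        have : 0 ≤ A * (-ξ x) := mul_nonneg (by linarith) hx0
        nlinarith
      have h7 := (abs_le.1 (hFb t ht x hx)).1
      rw [hb] at h6 ⊢
      nlinarith

end Geometry

end SpecularBoltzmann

namespace SpecularBoltzmann

/-! ### The weight -/

theorem IsCutoff.le_id {δ c : ℝ} {χ : ℝ → ℝ} (hδ : 0 < δ) (h : IsCutoff δ χ c) {y : ℝ}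
    (hy : 0 ≤ y) : χ y ≤ y := by
  have h0 : χ 0 = 0 := h.eq_id 0 le_rfl (by positivity)
  have h1 := Convex.image_sub_le_mul_sub_of_deriv_le (convex_Ici (0 : ℝ)) (C := 1)
    h.smooth.continuousOn (by
      rw [interior_Ici]
      exact (h.smooth.differentiableOn (by simp)).mono Ioi_subset_Ici_self) (by
      rw [interior_Ici]
      intro x hx
      rw [← derivWithin_of_mem_nhds (Ici_mem_nhds hx)]
      exact h.deriv_le x (le_of_lt hx)) 0 self_mem_Ici y hy hy
  linarith

/-- Monotonicity is given only on the open interval; the bounds at its ends come from continuity,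
letting the comparison point tend to δ/4 or δ/2. -/
theorem IsCutoff.mem_Icc {δ c : ℝ} {χ : ℝ → ℝ} (hδ : 0 < δ) (h : IsCutoff δ χ c) :
    δ / 4 ≤ c ∧ ∀ y, 0 ≤ y → min y (δ / 4) ≤ χ y ∧ χ y ≤ c := by
  have hcont : ∀ y : ℝ, 0 < y → ContinuousAt χ y := fun y hy =>
    (h.smooth.continuousOn y hy.le).continuousAt (Ici_mem_nhds hy)
  have hq : χ (δ / 4) = δ / 4 := h.eq_id _ (by positivity) le_rfl
  have hh : χ (δ / 2) = c := h.eq_const _ le_rfl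
  have hlow : ∀ y ∈ Ioo (δ / 4) (δ / 2), δ / 4 ≤ χ y := by
    intro y hy
    have ht : Filter.Tendsto χ (nhdsWithin (δ / 4) (Ioi (δ / 4))) (nhds (χ (δ / 4))) :=
      (hcont _ (by positivity)).tendsto.mono_left nhdsWithin_le_nhds
    rw [hq] at ht
    refine le_of_tendsto ht ?_
    filter_upwards [Ioo_mem_nhdsGT hy.1] with z hz
    exact h.mono ⟨hz.1, hz.2.trans hy.2⟩ hy hz.2.le
  have hup : ∀ y ∈ Ioo (δ / 4) (δ / 2), χ y ≤ c := by
    intro y hy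
    have ht : Filter.Tendsto χ (nhdsWithin (δ / 2) (Iio (δ / 2))) (nhds (χ (δ / 2))) :=
      (hcont _ (by positivity)).tendsto.mono_left nhdsWithin_le_nhds
    rw [hh] at ht
    refine ge_of_tendsto ht ?_
    filter_upwards [Ioo_mem_nhdsLT hy.2] with z hz
    exact h.mono hy ⟨hy.1.trans hz.1, hz.2⟩ hz.1.le
  have hc : δ / 4 ≤ c := by
    have hy : 3 * δ / 8 ∈ Ioo (δ / 4) (δ / 2) := ⟨by linarith, by linarith⟩
    exact (hlow _ hy).trans (hup _ hy)
  refine ⟨hc, fun y hy => ?_⟩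
  rcases le_or_gt y (δ / 4) with h1 | h1
  · rw [h.eq_id y hy h1]; exact ⟨min_le_left _ _, h1.trans hc⟩
  rcases lt_or_ge y (δ / 2) with h2 | h2
  · exact ⟨(min_le_right _ _).trans (hlow y ⟨h1, h2⟩), hup y ⟨h1, h2⟩⟩
  · rw [h.eq_const y h2]; exact ⟨(min_le_right _ _).trans hc, le_rfl⟩

section Weight

variable {ξ : R3 → ℝ}

theorem IsDefiningFunction.frontier_nonempty (hξ : IsDefiningFunction ξ)
    (hne : (domain ξ).Nonempty) : (frontier (domain ξ)).Nonempty := by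
  by_contra h
  rw [not_nonempty_iff_eq_empty, ← isClopen_iff_frontier_eq_empty] at h
  have hb := hξ.bounded
  rw [h.eq_univ hne] at hb
  exact NormedSpace.unbounded_univ ℝ R3 hb

theorem bdryDist_pos (hξ : IsDefiningFunction ξ) {x : R3} (hx : x ∈ domain ξ) :
    0 < bdryDist ξ x := by
  rw [bdryDist, ← isClosed_frontier.notMem_iff_infDist_pos (hξ.frontier_nonempty ⟨x, hx⟩)]
  rw [hξ.mem_frontier_iff]
  exact ne_of_lt hx

theorem bdryProj_spec (hξ : IsDefiningFunction ξ) (hne : (domain ξ).Nonempty) (x : R3) :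
    bdryProj ξ x ∈ frontier (domain ξ) ∧ dist x (bdryProj ξ x) = bdryDist ξ x := by
  obtain ⟨y, hy, h⟩ := isClosed_frontier.exists_infDist_eq_dist (hξ.frontier_nonempty hne) x
  exact Classical.epsilon_spec (p := fun y => y ∈ frontier (domain ξ) ∧ dist x y = bdryDist ξ x)
    ⟨y, hy, h.symm⟩

/-- A positive lower bound of `|ξ|` at distance at least `ρ` from the boundary. -/
theorem exists_depth_lower (hξ : IsDefiningFunction ξ) {ρ : ℝ} (hρ : 0 < ρ) :
    ∃ d > (0 : ℝ), ∀ x ∈ domain ξ, ρ ≤ bdryDist ξ x → d ≤ -ξ x := by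
  have hc : Continuous (bdryDist ξ) := Metric.continuous_infDist_pt _
  set S := closure (domain ξ) ∩ {x | ρ ≤ bdryDist ξ x} with hS
  have hSc : IsCompact S := hξ.isCompact_closure.inter_right (isClosed_le continuous_const hc)
  rcases S.eq_empty_or_nonempty with h | h
  · refine ⟨1, one_pos, fun x hx hd => ?_⟩
    have : x ∈ S := ⟨subset_closure hx, hd⟩
    rw [h] at this; exact this.elim
  · obtain ⟨z, hz, hmin⟩ := hSc.exists_isMinOn h hξ.contDiff.continuous.neg.continuousOn
    refine ⟨-ξ z, ?_, fun x hx hd => hmin ⟨subset_closure hx, hd⟩⟩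
    have h1 := hξ.mem_closure_iff.1 hz.1
    rcases h1.lt_or_eq with h2 | h2
    · linarith
    · have h3 : bdryDist ξ z = 0 :=
        Metric.infDist_zero_of_mem (hξ.mem_frontier_iff.2 h2)
      have := hz.2
      simp only [mem_ofPred_eq, h3] at this
      linarith

/-- The infimum of an empty set is 0, so a point at distance exactly ρ must be produced. It lies on
the segment from a fixed interior point to its nearest boundary point, which is why ρ₀ is the
boundary distance of that fixed point. -/
theorem exists_collarDepth_pos (hξ : IsDefiningFunction ξ) :
    ∃ ρ₀ > (0 : ℝ), ∀ ρ, 0 < ρ → ρ < ρ₀ → (domain ξ).Nonempty → 0 < collarDepth ξ ρ := by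
  rcases (domain ξ).eq_empty_or_nonempty with he | ⟨x₀, hx₀⟩
  · exact ⟨1, one_pos, fun ρ _ _ h => by simp [he] at h⟩
  refine ⟨bdryDist ξ x₀, bdryDist_pos hξ hx₀, fun ρ hρ hρ' hne => ?_⟩
  obtain ⟨d, hd, hdl⟩ := exists_depth_lower hξ hρ
  have hc : Continuous (bdryDist ξ) := Metric.continuous_infDist_pt _
  have key : ∃ z ∈ domain ξ, bdryDist ξ z = ρ := by
    obtain ⟨hy, hyd⟩ := bdryProj_spec hξ hne x₀
    set y := bdryProj ξ x₀
    set L : ℝ → R3 := fun τ => y + τ • (x₀ - y) with hL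
    have hLc : Continuous L := by fun_prop
    have h0 : bdryDist ξ (L 0) = 0 := by
      simp only [hL, zero_smul, add_zero]; exact Metric.infDist_zero_of_mem hy
    have h1 : bdryDist ξ (L 1) = bdryDist ξ x₀ := by simp [hL]
    obtain ⟨τ, hτ, hτρ⟩ := intermediate_value_Icc (zero_le_one (α := ℝ))
      (hc.comp hLc).continuousOn (show ρ ∈ Icc ((bdryDist ξ ∘ L) 0) ((bdryDist ξ ∘ L) 1) by
        simp only [Function.comp, h0, h1]; exact ⟨hρ.le, hρ'.le⟩)
    refine ⟨L τ, ?_, hτρ⟩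
    have hτ0 : 0 < τ := by
      rcases hτ.1.eq_or_lt with h | h
      · rw [← h] at hτρ; simp only [Function.comp, h0] at hτρ; linarith
      · exact h
    -- The ball is connected, contains no boundary point, and its centre lies in the domain.
    have hball : Metric.ball x₀ (bdryDist ξ x₀) ⊆ domain ξ := by
      have hsub : Metric.ball x₀ (bdryDist ξ x₀) ⊆ domain ξ ∪ (closure (domain ξ))ᶜ := by
        intro w hw
        by_cases hwc : w ∈ closure (domain ξ)
        · left
          rcases (hξ.mem_closure_iff.1 hwc).lt_or_eq with h | h
          · exact h
          · have h2 := Metric.infDist_le_dist_of_mem (x := x₀) (hξ.mem_frontier_iff.2 h)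
            rw [Metric.mem_ball, dist_comm] at hw
            exact absurd hw (not_lt.2 h2)
        · exact Or.inr hwc
      exact ((convex_ball x₀ _).isPreconnected).subset_left_of_subset_union hξ.isOpen_domain
        isClosed_closure.isOpen_compl
        (disjoint_compl_right.mono_left subset_closure) hsub
        ⟨x₀, Metric.mem_ball_self (bdryDist_pos hξ hx₀), hx₀⟩
    apply hball
    rw [Metric.mem_ball, dist_eq_norm, show L τ - x₀ = (1 - τ) • (y - x₀) by
      simp only [hL]; module, norm_smul, ← dist_eq_norm y x₀, dist_comm, hyd, Real.norm_eq_abs,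
      abs_of_nonneg (sub_nonneg.2 hτ.2)]
    nlinarith [bdryDist_pos hξ hx₀]
  refine lt_of_lt_of_le hd (le_csInf ?_ ?_)
  · obtain ⟨z, hz, hzρ⟩ := key
    exact ⟨_, z, ⟨hz, hzρ⟩, rfl⟩
  · rintro _ ⟨z, ⟨hz, hzρ⟩, rfl⟩
    exact (hdl z hz hzρ.ge).trans (neg_le_abs _)

theorem hessForm_le {T A m : ℝ} {E : ℝ → R3 → R3} (hB : FieldBounds ξ T E A m) {x : R3}
    (hx : x ∈ closure (domain ξ)) (v : R3) : |hessForm ξ x v| ≤ A * ‖v‖ ^ 2 := by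
  rw [← Real.norm_eq_abs, hessForm]
  calc _ ≤ ‖fderiv ℝ (fderiv ℝ ξ) x‖ * ‖v‖ * ‖v‖ := ContinuousLinearMap.le_opNorm₂ _ _ _
    _ ≤ A * ‖v‖ * ‖v‖ := by gcongr; exact hB.fderiv2_le x hx
    _ = _ := by ring

/-- Of ⟨u⟩² = |u|² + 1, the Hessian term controls |u|² and the field term at the projected boundary
point, where the sign condition applies, controls 1. -/
theorem preWeight_sq {T A m : ℝ} {E : ℝ → R3 → R3} (hξ : IsDefiningFunction ξ)
    (hB : FieldBounds ξ T E A m) {s : ℝ} (hs : s ∈ Icc 0 T) {x : R3} (hx : x ∈ domain ξ) (u : R3) :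
    (fderiv ℝ ξ x u) ^ 2 + m * bracket u ^ 2 * (-ξ x) ≤ preWeight ξ E s x u ^ 2 ∧
    preWeight ξ E s x u ^ 2 ≤ (fderiv ℝ ξ x u) ^ 2 + 5 * A ^ 2 * bracket u ^ 2 * (-ξ x) := by
  have hxc := subset_closure hx
  have hx0 : 0 < -ξ x := neg_pos.2 hx
  obtain ⟨hy, -⟩ := bdryProj_spec hξ ⟨x, hx⟩ x
  have h1 := hB.hess_ge x hxc u
  have h2 := (abs_le.1 (hessForm_le hB hxc u)).2
  have h3 := hB.normal_ge s hs _ hy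
  have h4 : fderiv ℝ ξ (bdryProj ξ x) (E s (bdryProj ξ x)) ≤ A * A :=
    ((Real.le_norm_self _).trans (ContinuousLinearMap.le_opNorm _ _)).trans
      (mul_le_mul (hB.fderiv_le _ (frontier_subset_closure hy))
        (hB.field_le s hs _ (frontier_subset_closure hy)) (norm_nonneg _) (by linarith [hB.one_le]))
  have h5 := (abs_le.1 (hB.abs_le x hxc)).1
  have hA := hB.one_le
  have hm := hB.m_pos
  have hb := bracket_sq u
  have hlow : (fderiv ℝ ξ x u) ^ 2 + m * bracket u ^ 2 * (-ξ x) ≤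
      (fderiv ℝ ξ x u) ^ 2 + (ξ x) ^ 2 - 2 * hessForm ξ x u * ξ x
        - 2 * fderiv ℝ ξ (bdryProj ξ x) (E s (bdryProj ξ x)) * ξ x := by
    have e1 := mul_le_mul_of_nonneg_right h1 hx0.le
    have e2 := mul_le_mul_of_nonneg_right h3 hx0.le
    have e3 : 0 ≤ m * ‖u‖ ^ 2 * -ξ x := by positivity
    have e4 : 0 ≤ m * -ξ x := by positivity
    rw [hb]
    nlinarith [sq_nonneg (ξ x)]
  unfold preWeight
  rw [inner_gradient, inner_gradient, Real.sq_sqrt]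
  · refine ⟨hlow, ?_⟩
    have e1 := mul_le_mul_of_nonneg_right h2 hx0.le
    have e2 := mul_le_mul_of_nonneg_right h4 hx0.le
    have e3 : (ξ x) ^ 2 ≤ A ^ 2 * (-ξ x) := by
      calc (ξ x) ^ 2 = (-ξ x) * (-ξ x) := by ring
        _ ≤ A ^ 2 * (-ξ x) := by
          gcongr
          nlinarith
    have e4 : A * ‖u‖ ^ 2 * (-ξ x) ≤ A ^ 2 * ‖u‖ ^ 2 * (-ξ x) := by
      have : A ≤ A ^ 2 := by nlinarith
      gcongr
    have e5 : 0 ≤ A ^ 2 * ‖u‖ ^ 2 * (-ξ x) := by positivity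
    have e6 : 0 ≤ A ^ 2 * (-ξ x) := by positivity
    rw [hb]
    nlinarith
  · refine le_trans ?_ hlow
    positivity

/-- Two-sided bounds of the weight by the kinetic distance. -/
theorem exists_weight_bounds (hξ : IsDefiningFunction ξ) {T A m : ℝ} {E : ℝ → R3 → R3}
    (hB : FieldBounds ξ T E A m) {ρ : ℝ} (hρ : 0 < ρ) {χ : ℝ → ℝ} {c : ℝ}
    (hδ : 0 < collarDepth ξ ρ) (hχ : IsCutoff (collarDepth ξ ρ) χ c) :
    0 < c ∧ ∃ a > (0 : ℝ), ∃ C > (0 : ℝ), ∀ s ∈ Icc 0 T, ∀ x ∈ domain ξ, ∀ u : R3,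
      a * min 1 (Real.sqrt ((fderiv ℝ ξ x u) ^ 2 + bracket u ^ 2 * (-ξ x))) ≤
        weight ξ ρ χ c E s x u ∧
      weight ξ ρ χ c E s x u ^ 2 ≤ C * ((fderiv ℝ ξ x u) ^ 2 + bracket u ^ 2 * (-ξ x)) ∧
      weight ξ ρ χ c E s x u ≤ c := by
  obtain ⟨hc4, hχ2⟩ := hχ.mem_Icc hδ
  have hA := hB.one_le
  have hm := hB.m_pos
  set δ := collarDepth ξ ρ
  have hc : 0 < c := by linarith
  obtain ⟨d, hd, hdl⟩ := exists_depth_lower hξ hρ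
  refine ⟨hc, min (Real.sqrt (min m 1)) (δ / 4), by positivity, 5 * A ^ 2 + c ^ 2 / d,
    by positivity, fun s hs x hx u => ?_⟩
  have hx0 : 0 < -ξ x := neg_pos.2 hx
  have hbp := bracket_pos u
  set Q := (fderiv ℝ ξ x u) ^ 2 + bracket u ^ 2 * (-ξ x) with hQ
  have hQ0 : 0 ≤ Q := by positivity
  have hmin0 : 0 ≤ min 1 (Real.sqrt Q) := by positivity
  obtain ⟨hp1, hp2⟩ := preWeight_sq hξ hB hs hx u
  have hpre0 : 0 ≤ preWeight ξ E s x u := Real.sqrt_nonneg _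
  have hsd : min (Real.sqrt (min m 1)) (δ / 4) * min 1 (Real.sqrt Q) ≤ δ / 4 := by
    calc _ ≤ δ / 4 * 1 := by gcongr <;> [exact min_le_right _ _; exact min_le_left _ _]
      _ = _ := mul_one _
  unfold weight
  split_ifs with hdist
  · obtain ⟨h1, h2⟩ := hχ2 _ hpre0
    refine ⟨le_trans (le_min ?_ hsd) h1, ?_, h2⟩
    · calc _ ≤ Real.sqrt (min m 1) * Real.sqrt Q := by
            gcongr <;> [exact min_le_left _ _; exact min_le_right _ _]
        _ = Real.sqrt (min m 1 * Q) := (Real.sqrt_mul (by positivity) _).symm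
        _ ≤ Real.sqrt (preWeight ξ E s x u ^ 2) := by
            apply Real.sqrt_le_sqrt
            refine le_trans ?_ hp1
            have e1 : min m 1 * (fderiv ℝ ξ x u) ^ 2 ≤ 1 * (fderiv ℝ ξ x u) ^ 2 := by
              gcongr; exact min_le_right _ _
            have e2 : min m 1 * (bracket u ^ 2 * (-ξ x)) ≤ m * (bracket u ^ 2 * (-ξ x)) := by
              gcongr; exact min_le_left _ _
            rw [hQ]; nlinarith
        _ = _ := Real.sqrt_sq hpre0
    · have h3 := hχ.le_id hδ hpre0
      have h4 : 0 ≤ χ (preWeight ξ E s x u) := le_trans (le_min hpre0 (by positivity)) h1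
      calc χ (preWeight ξ E s x u) ^ 2 ≤ preWeight ξ E s x u ^ 2 := by gcongr
        _ ≤ _ := hp2
        _ ≤ 5 * A ^ 2 * Q := by
            have e1 : (fderiv ℝ ξ x u) ^ 2 ≤ 5 * A ^ 2 * (fderiv ℝ ξ x u) ^ 2 :=
              le_mul_of_one_le_left (sq_nonneg _) (by nlinarith)
            rw [hQ]; nlinarith
        _ ≤ _ := by
            have : 0 ≤ c ^ 2 / d * Q := by positivity
            nlinarith
  -- Outside the collar the weight is the constant c, while the depth is at least d, so the kinetic
  -- quantity is at least d.
  · refine ⟨hsd.trans hc4, ?_, le_rfl⟩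
    have h1 := hdl x hx (not_lt.1 hdist)
    have h2 : 1 ≤ bracket u ^ 2 := one_le_pow₀ (one_le_bracket u)
    have h3 : d ≤ Q := by
      rw [hQ]; nlinarith [sq_nonneg (fderiv ℝ ξ x u)]
    calc c ^ 2 = c ^ 2 / d * d := by field_simp
      _ ≤ c ^ 2 / d * Q := by gcongr
      _ ≤ _ := by
        have : 0 ≤ 5 * A ^ 2 * Q := by positivity
        nlinarith

theorem inv_rpow_le_of_mul_min_le {a β w Q : ℝ} (ha : 0 < a) (hβ : 0 < β) (hQ : 0 < Q)
    (h : a * min 1 (Real.sqrt Q) ≤ w) : 1 / w ^ β ≤ a ^ (-β) * (1 + Q ^ (-(β / 2))) := by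
  have hs : 0 < Real.sqrt Q := Real.sqrt_pos.2 hQ
  have hm : 0 < min 1 (Real.sqrt Q) := by positivity
  have e : Real.sqrt Q ^ (-β) = Q ^ (-(β / 2)) := by
    rw [Real.sqrt_eq_rpow, ← Real.rpow_mul hQ.le]; congr 1; ring
  rw [one_div, ← Real.rpow_neg (le_trans (by positivity) h)]
  calc w ^ (-β) ≤ (a * min 1 (Real.sqrt Q)) ^ (-β) :=
        Real.rpow_le_rpow_of_nonpos (by positivity) h (by linarith)
    _ = a ^ (-β) * (min 1 (Real.sqrt Q)) ^ (-β) := Real.mul_rpow ha.le hm.le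
    _ ≤ a ^ (-β) * (1 + Q ^ (-(β / 2))) := by
        gcongr
        have : 0 ≤ Q ^ (-(β / 2)) := by positivity
        rcases min_choice 1 (Real.sqrt Q) with h1 | h1
        · rw [h1, Real.one_rpow]; linarith
        · rw [h1, e]; linarith

theorem measurable_bracket : Measurable bracket := by
  unfold bracket; fun_prop

/-- The collision kernel integrated against a negative power of the weight. -/
theorem exists_lintegral_kernel_inv_weight_le {T A m : ℝ} {E : ℝ → R3 → R3}
    (hB : FieldBounds ξ T E A m) {w : ℝ → R3 → R3 → ℝ} {a : ℝ} (ha : 0 < a)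
    (hw : ∀ s ∈ Icc 0 T, ∀ x ∈ domain ξ, ∀ u : R3,
      a * min 1 (Real.sqrt ((fderiv ℝ ξ x u) ^ 2 + bracket u ^ 2 * (-ξ x))) ≤ w s x u)
    {θ κ β r : ℝ} (hθ : 0 < θ) (hκ : 0 < κ) (hκ1 : κ ≤ 1) (hβ : 1 < β) (hr : 0 ≤ r) :
    ∃ K > (0 : ℝ), ∀ s ∈ Icc 0 T, ∀ x ∈ domain ξ, ∀ V : R3,
      ∫⁻ u : R3, ENNReal.ofReal (Real.exp (-θ * ‖V - u‖ ^ 2) / ‖V - u‖ ^ (2 - κ) *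
        bracket u ^ r * (1 / w s x u ^ β)) ≤
        ENNReal.ofReal (K * bracket V ^ r * (1 + (bracket V ^ 2 * (-ξ x)) ^ (-((β - 1) / 2)))) := by
  obtain ⟨K1, hK1, h1⟩ := lintegral_kernel_moment_le hθ hκ hκ1 hr
  obtain ⟨K2, hK2, h2⟩ := lintegral_kernel_weight_le hθ hκ hκ1 hβ hr hB.m_pos
  have hm := hB.m_pos
  set K3 := a ^ (-β) * (1 + m ^ (-(β / 2))) with hK3
  have hK3p : 0 < K3 := by positivity
  refine ⟨a ^ (-β) * (K1 + K2) + K3 * K1, by positivity, fun s hs x hx V => ?_⟩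
  have hx0 : 0 < -ξ x := neg_pos.2 hx
  have hV := bracket_pos V
  set P := (bracket V ^ 2 * (-ξ x)) ^ (-((β - 1) / 2)) with hP
  have hP0 : 0 ≤ P := by positivity
  have hVr : 0 < bracket V ^ r := by positivity
  have hQ : ∀ u, 0 < (fderiv ℝ ξ x u) ^ 2 + bracket u ^ 2 * (-ξ x) := fun u => by
    have := bracket_pos u; positivity
  have hker : ∀ u, 0 ≤ Real.exp (-θ * ‖V - u‖ ^ 2) / ‖V - u‖ ^ (2 - κ) * bracket u ^ r := fun u => by
    have := bracket_pos u; positivity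
  -- Either the gradient is bounded below and the line integral applies, or the point is deep, the
  -- weight has a positive lower bound, and a moment bound suffices.
  rcases le_max_iff.1 (hB.gradient_ge x (subset_closure hx)) with h | h
  · calc _ ≤ ∫⁻ u : R3, ENNReal.ofReal (a ^ (-β)) *
          (ENNReal.ofReal (Real.exp (-θ * ‖V - u‖ ^ 2) / ‖V - u‖ ^ (2 - κ) * bracket u ^ r) +
          ENNReal.ofReal (Real.exp (-θ * ‖V - u‖ ^ 2) / ‖V - u‖ ^ (2 - κ) * bracket u ^ r *
            (inner ℝ u (gradient ξ x) ^ 2 + bracket u ^ 2 * (-ξ x)) ^ (-(β / 2)))) := by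
          apply lintegral_mono
          intro u
          have hQu := hQ u
          have hk := hker u
          beta_reduce
          rw [inner_gradient, ← ENNReal.ofReal_add hk (mul_nonneg hk (by positivity)),
            ← ENNReal.ofReal_mul (by positivity)]
          apply ENNReal.ofReal_le_ofReal
          have h3 := mul_le_mul_of_nonneg_left
            (inv_rpow_le_of_mul_min_le ha (by linarith : 0 < β) hQu (hw s hs x hx u)) hk
          exact h3.trans_eq (by ring)
      _ = ENNReal.ofReal (a ^ (-β)) * (_ + _) := by
          have := measurable_bracket
          rw [lintegral_const_mul' _ _ ENNReal.ofReal_ne_top, lintegral_add_left (by fun_prop)]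
      _ ≤ ENNReal.ofReal (a ^ (-β)) * (ENNReal.ofReal (K1 * bracket V ^ r) +
          ENNReal.ofReal (K2 * bracket V ^ r * P)) := by
          gcongr
          · exact h1 V
          · exact h2 V _ _ h hx0
      _ ≤ _ := by
          rw [← ENNReal.ofReal_add (by positivity) (by positivity),
            ← ENNReal.ofReal_mul (by positivity)]
          apply ENNReal.ofReal_le_ofReal
          have e1 : 0 ≤ a ^ (-β) * (K2 + K1 * P) * bracket V ^ r := by positivity
          have e2 : 0 ≤ K3 * K1 * bracket V ^ r * (1 + P) := by positivity
          nlinarith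
  · calc _ ≤ ∫⁻ u : R3, ENNReal.ofReal K3 *
          ENNReal.ofReal (Real.exp (-θ * ‖V - u‖ ^ 2) / ‖V - u‖ ^ (2 - κ) * bracket u ^ r) := by
          apply lintegral_mono
          intro u
          have hQu := hQ u
          have hk := hker u
          beta_reduce
          rw [← ENNReal.ofReal_mul hK3p.le]
          apply ENNReal.ofReal_le_ofReal
          have h3 := inv_rpow_le_of_mul_min_le ha (by linarith : 0 < β) hQu (hw s hs x hx u)
          have h4 : m ≤ (fderiv ℝ ξ x u) ^ 2 + bracket u ^ 2 * (-ξ x) := by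
            have : 1 ≤ bracket u ^ 2 := one_le_pow₀ (one_le_bracket u)
            nlinarith [sq_nonneg (fderiv ℝ ξ x u)]
          have h5 : ((fderiv ℝ ξ x u) ^ 2 + bracket u ^ 2 * (-ξ x)) ^ (-(β / 2)) ≤ m ^ (-(β / 2)) :=
            Real.rpow_le_rpow_of_nonpos hm h4 (by linarith)
          rw [mul_comm]
          gcongr
          exact h3.trans (by rw [hK3]; gcongr)
      _ = ENNReal.ofReal K3 * _ := lintegral_const_mul' _ _ ENNReal.ofReal_ne_top
      _ ≤ ENNReal.ofReal K3 * ENNReal.ofReal (K1 * bracket V ^ r) := by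
          gcongr; exact h1 V
      _ ≤ _ := by
          rw [← ENNReal.ofReal_mul hK3p.le]
          apply ENNReal.ofReal_le_ofReal
          have e1 : 0 ≤ a ^ (-β) * (K1 + K2) * bracket V ^ r * (1 + P) := by positivity
          have e2 : 0 ≤ K3 * K1 * bracket V ^ r * P := by positivity
          nlinarith

end Weight

end SpecularBoltzmann

namespace SpecularBoltzmann

/-! ### Existence, uniqueness and exit of characteristics -/

/-- Coordinatewise truncation at height `R`. -/
noncomputable def clampMap (R : ℝ) (v : R3) : R3 := WithLp.toLp 2 fun i => max (-R) (min R (v i))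

theorem clampMap_of_norm_le {R : ℝ} {v : R3} (h : ‖v‖ ≤ R) : clampMap R v = v := by
  ext i
  have h1 := abs_le.1 ((PiLp.norm_apply_le v i).trans h)
  simp only [clampMap]
  rw [min_eq_right h1.2, max_eq_right h1.1]

theorem norm_clampMap_le {R : ℝ} (hR : 0 ≤ R) (v : R3) : ‖clampMap R v‖ ≤ 2 * R := by
  have h : ∀ i, (clampMap R v i) ^ 2 ≤ R ^ 2 := fun i => by
    apply sq_le_sq'
    · exact le_max_left _ _
    · exact max_le (by linarith) (min_le_left _ _)
  refine (abs_le_of_sq_le_sq' ?_ (by positivity)).2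
  rw [EuclideanSpace.norm_sq_eq]
  simp only [Fin.sum_univ_three, Real.norm_eq_abs, sq_abs]
  nlinarith [h 0, h 1, h 2]

theorem lipschitzWith_clampMap (R : ℝ) : ∃ K, LipschitzWith K (clampMap R) := by
  have h1 : LipschitzWith 1 (fun f : Fin 3 → ℝ => fun i => max (-R) (min R (f i))) := by
    refine LipschitzWith.of_dist_le_mul fun f g => ?_
    rw [NNReal.coe_one, one_mul, dist_pi_le_iff dist_nonneg]
    intro i
    have h2 : LipschitzWith 1 (fun y : ℝ => max (-R) (min R y)) :=
      (LipschitzWith.id.const_min R).const_max (-R)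
    have h3 := h2.dist_le_mul (f i) (g i)
    rw [NNReal.coe_one, one_mul] at h3
    exact h3.trans (dist_le_pi_dist f g i)
  exact ⟨_, (PiLp.lipschitzWith_toLp 2 _).comp (h1.comp (PiLp.lipschitzWith_ofLp 2 _))⟩

/-- Global solvability of `X' = V`, `V' = F(s, X)` for a bounded Lipschitz field. -/
theorem exists_solution {F : ℝ × R3 → R3} {K : NNReal} (hF : LipschitzWith K F) {B : ℝ}
    (hB0 : 0 ≤ B) (hB : ∀ p, ‖F p‖ ≤ B) {t : ℝ} (ht : 0 ≤ t) (x v : R3) :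
    ∃ X V : ℝ → R3, X t = x ∧ V t = v ∧ ∀ s ∈ Icc 0 t,
      HasDerivWithinAt X (V s) (Icc 0 t) s ∧ HasDerivWithinAt V (F (s, X s)) (Icc 0 t) s := by
  -- This bounds the speed of any solution on [0,t]. Truncating velocities at R makes the vector
  -- field bounded, so one Picard–Lindelöf step covers the whole interval, and the truncation turns
  -- out to be inactive.
  set R := ‖v‖ + B * t with hR
  have hR0 : 0 ≤ R := by positivity
  obtain ⟨Kc, hKc⟩ := lipschitzWith_clampMap R
  set G : ℝ → R3 × R3 → R3 × R3 := fun s z => (clampMap R z.2, F (s, z.1)) with hG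
  obtain ⟨L, hL⟩ : ∃ L : NNReal, (L : ℝ) = 2 * R + B := ⟨⟨2 * R + B, by positivity⟩, rfl⟩
  obtain ⟨t', ht'⟩ : ∃ t' : NNReal, (t' : ℝ) = t := ⟨⟨t, ht⟩, rfl⟩
  have hlip : ∀ s, LipschitzWith (max (Kc * 1) (K * max 0 1)) (G s) := fun s =>
    (hKc.comp LipschitzWith.prod_snd).prodMk
      (hF.comp ((LipschitzWith.const s).prodMk LipschitzWith.prod_fst))
  have hPL : IsPicardLindelof G (tmin := 0) (tmax := t) ⟨t, right_mem_Icc.2 ht⟩ (x, v)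
      (L * t') 0 L (max (Kc * 1) (K * max 0 1)) := by
    refine ⟨fun s _ => (hlip s).lipschitzOnWith, fun z _ => ?_, fun s _ z _ => ?_, ?_⟩
    · have := hF.continuous
      exact (by fun_prop : Continuous fun s => G s z).continuousOn
    · simp only [hG, Prod.norm_def]
      have h1 := norm_clampMap_le hR0 z.2
      have h2 := hB (s, z.1)
      exact max_le (h1.trans (by rw [hL]; linarith))
        (h2.trans (by rw [hL]; linarith))
    · rw [NNReal.coe_mul, NNReal.coe_zero, ht', sub_zero, sub_self, sub_zero, max_eq_right ht]
  obtain ⟨α, hα0, hα⟩ := hPL.exists_eq_forall_mem_Icc_hasDerivWithinAt (x := (x, v)) (by simp)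
  have hX : ∀ s ∈ Icc 0 t, HasDerivWithinAt (fun s => (α s).1) (clampMap R (α s).2) (Icc 0 t) s :=
    fun s hs => (hasFDerivAt_fst (𝕜 := ℝ) (p := α s)).comp_hasDerivWithinAt s (hα s hs)
  have hV : ∀ s ∈ Icc 0 t, HasDerivWithinAt (fun s => (α s).2) (F (s, (α s).1)) (Icc 0 t) s :=
    fun s hs => (hasFDerivAt_snd (𝕜 := ℝ) (p := α s)).comp_hasDerivWithinAt s (hα s hs)
  simp only at hα0
  have hVb : ∀ s ∈ Icc 0 t, ‖(α s).2‖ ≤ R := by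
    intro s hs
    have h1 := (convex_Icc 0 t).norm_image_sub_le_of_norm_hasDerivWithin_le hV
      (fun s _ => hB _) (right_mem_Icc.2 ht) hs
    rw [hα0] at h1
    simp only at h1
    rw [Real.norm_eq_abs, abs_of_nonpos (by linarith [hs.2])] at h1
    have h2 := norm_le_norm_add_norm_sub' (α s).2 v
    rw [hR]; nlinarith [hs.1]
  refine ⟨fun s => (α s).1, fun s => (α s).2, by simp [hα0], by simp [hα0], fun s hs =>
    ⟨?_, hV s hs⟩⟩
  have := hX s hs
  rwa [clampMap_of_norm_le (hVb s hs)] at this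

theorem solution_unique {F : ℝ × R3 → R3} {K : NNReal} (hF : LipschitzWith K F) {a t : ℝ}
    {X V X' V' : ℝ → R3} (hX : ∀ s ∈ Icc a t,
      HasDerivWithinAt X (V s) (Icc a t) s ∧ HasDerivWithinAt V (F (s, X s)) (Icc a t) s)
    (hX' : ∀ s ∈ Icc a t,
      HasDerivWithinAt X' (V' s) (Icc a t) s ∧ HasDerivWithinAt V' (F (s, X' s)) (Icc a t) s)
    (h1 : X t = X' t) (h2 : V t = V' t) : ∀ s ∈ Icc a t, X s = X' s ∧ V s = V' s := by
  set G : ℝ → R3 × R3 → R3 × R3 := fun s z => (z.2, F (s, z.1)) with hG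
  have hlip : ∀ s, LipschitzWith (max 1 (K * max 0 1)) (G s) := fun s =>
    LipschitzWith.prod_snd.prodMk
      (hF.comp ((LipschitzWith.const s).prodMk LipschitzWith.prod_fst))
  have key : ∀ {X V : ℝ → R3}, (∀ s ∈ Icc a t,
      HasDerivWithinAt X (V s) (Icc a t) s ∧ HasDerivWithinAt V (F (s, X s)) (Icc a t) s) →
      ContinuousOn (fun s => (X s, V s)) (Icc a t) ∧ ∀ s ∈ Ioc a t,
        HasDerivWithinAt (fun s => (X s, V s)) (G s (X s, V s)) (Iic s) s := by
    intro X V h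
    refine ⟨fun s hs => ((h s hs).1.continuousWithinAt).prodMk (h s hs).2.continuousWithinAt,
      fun s hs => ?_⟩
    have h3 := (h s (Ioc_subset_Icc_self hs)).1.prodMk (h s (Ioc_subset_Icc_self hs)).2
    refine h3.mono_of_mem_nhdsWithin ?_
    exact Filter.mem_of_superset (Icc_mem_nhdsLE hs.1) (Icc_subset_Icc_right hs.2)
  have heq := ODE_solution_unique_of_mem_Icc_left (v := G) (s := fun _ => univ)
    (fun s _ => (hlip s).lipschitzOnWith) (key hX).1 (key hX).2 (fun _ _ => mem_univ _)
    (key hX').1 (key hX').2 (fun _ _ => mem_univ _) (by simp [h1, h2])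
  intro s hs
  exact Prod.ext_iff.1 (heq hs)

section Characteristics

variable {ξ : R3 → ℝ} {T A m : ℝ} {E : ℝ → R3 → R3}

/-- The flow theory needs a field on all of space-time. A Lipschitz extension may be unbounded;
truncation restores a bound and does not change the values that were prescribed. -/
theorem FieldBounds.exists_extension (hB : FieldBounds ξ T E A m) :
    ∃ (F : ℝ × R3 → R3) (K : NNReal) (B : ℝ), LipschitzWith K F ∧ 0 ≤ B ∧ (∀ p, ‖F p‖ ≤ B) ∧
      ∀ t ∈ Icc 0 T, ∀ x ∈ closure (domain ξ), F (t, x) = E t x := by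
  obtain ⟨g, hg, hge⟩ := hB.field_lip.extend_finite_dimension
  obtain ⟨Kc, hKc⟩ := lipschitzWith_clampMap A
  refine ⟨clampMap A ∘ g, _, 2 * A, hKc.comp hg, by linarith [hB.one_le],
    fun p => norm_clampMap_le (by linarith [hB.one_le]) _, fun t ht x hx => ?_⟩
  have h1 : g (t, x) = E t x := (hge (show (t, x) ∈ Icc 0 T ×ˢ closure (domain ξ) from ⟨ht, hx⟩)).symm
  simp only [Function.comp, h1]
  exact clampMap_of_norm_le (hB.field_le t ht x hx)

theorem IsCharacteristic.continuousOn {t a : ℝ} {x v : R3} {X V : ℝ → R3}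
    (h : IsCharacteristic ξ E t x v a X V) : ContinuousOn X (Icc a t) ∧ ContinuousOn V (Icc a t) :=
  ⟨fun s hs => (h.2.2.1 s hs).1.continuousWithinAt, fun s hs => (h.2.2.1 s hs).2.continuousWithinAt⟩

theorem mem_closure_of_mem_Ioo {a t : ℝ} {X : ℝ → R3} (hc : ContinuousOn X (Icc a t))
    (ho : ∀ τ ∈ Ioo a t, X τ ∈ domain ξ) (ht : X t ∈ closure (domain ξ)) :
    ∀ s ∈ Icc a t, X s ∈ closure (domain ξ) := by
  intro s hs
  rcases (hs.1.trans hs.2).eq_or_lt with h | h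
  · have : s = t := le_antisymm hs.2 (h ▸ hs.1)
    rwa [this]
  · have h1 : X '' closure (Ioo a t) ⊆ closure (domain ξ) := by
      rw [closure_Ioo h.ne]
      rintro _ ⟨s, hs, rfl⟩
      have h2 : s ∈ closure (Ioo a t) := by rwa [closure_Ioo h.ne]
      have h3 : ContinuousWithinAt X (Ioo a t) s := (hc s hs).mono Ioo_subset_Icc_self
      exact h3.mem_closure h2 ho
    rw [closure_Ioo h.ne] at h1
    exact h1 ⟨s, hs, rfl⟩

theorem IsCharacteristic.mem_closure {t a : ℝ} {x v : R3} {X V : ℝ → R3}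
    (h : IsCharacteristic ξ E t x v a X V) (hx : x ∈ closure (domain ξ)) :
    ∀ s ∈ Icc a t, X s ∈ closure (domain ξ) :=
  mem_closure_of_mem_Ioo h.continuousOn.1 h.2.2.2 (by rwa [h.1])

/-- The characteristic up to its exit, and what happens there. -/
theorem charPair_spec (hξ : IsDefiningFunction ξ) (hB : FieldBounds ξ T E A m) {t : ℝ}
    (ht : t ∈ Icc 0 T) {x : R3} (hx : x ∈ closure (domain ξ)) (v : R3) :
    exitTime ξ E t x v ∈ Icc 0 t ∧
    IsCharacteristic ξ E t x v (t - exitTime ξ E t x v) (charX ξ E t x v) (charV ξ E t x v) ∧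
    (t - exitTime ξ E t x v = 0 ∨ ξ (charX ξ E t x v (t - exitTime ξ E t x v)) = 0) ∧
    (0 < t → ξ x = 0 → 0 < fderiv ℝ ξ x v → 0 < exitTime ξ E t x v) := by
  obtain ⟨F, K, B, hF, hB0, hFB, hFE⟩ := hB.exists_extension
  obtain ⟨X, V, hXt, hVt, hXV⟩ := exists_solution hF hB0 hFB ht.1 x v
  have hXc : ContinuousOn X (Icc 0 t) := fun s hs => (hXV s hs).1.continuousWithinAt
  have hsub : ∀ {s}, s ≤ t → Icc (t - s) t ⊆ Icc 0 t := fun hs =>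
    Icc_subset_Icc_left (by linarith)
  -- A characteristic stays in the closure, where the extended field equals E, so it coincides with
  -- the global solution of the extended system.
  have huniq : ∀ s, 0 ≤ s → s ≤ t → ∀ X' V', IsCharacteristic ξ E t x v (t - s) X' V' →
      ∀ τ ∈ Icc (t - s) t, X' τ = X τ ∧ V' τ = V τ := by
    intro s hs0 hst X' V' h
    have hcl := h.mem_closure hx
    refine solution_unique hF (fun τ hτ => ?_) (fun τ hτ => ?_) (by rw [h.1, hXt])
      (by rw [h.2.1, hVt])
    · have h1 := h.2.2.1 τ hτ
      have h2 := hsub hst hτ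
      rw [hFE τ ⟨h2.1, h2.2.trans ht.2⟩ _ (hcl τ hτ)]
      exact h1
    · have h1 := hXV τ (hsub hst hτ)
      exact ⟨h1.1.mono (hsub hst), h1.2.mono (hsub hst)⟩
  have hmk : ∀ s, 0 ≤ s → s ≤ t → (∀ τ ∈ Ioo (t - s) t, X τ ∈ domain ξ) →
      IsCharacteristic ξ E t x v (t - s) X V := by
    intro s hs0 hst h
    refine ⟨hXt, hVt, fun τ hτ => ?_, h⟩
    have hcl := mem_closure_of_mem_Ioo (hXc.mono (hsub hst)) h (by rwa [hXt]) τ hτ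
    have h1 := hXV τ (hsub hst hτ)
    rw [hFE τ ⟨(hsub hst hτ).1, hτ.2.trans ht.2⟩ _ hcl] at h1
    exact ⟨h1.1.mono (hsub hst), h1.2.mono (hsub hst)⟩
  set S := {s | 0 ≤ s ∧ s ≤ t ∧ ∃ X V, IsCharacteristic ξ E t x v (t - s) X V} with hS
  have hbdd : BddAbove S := ⟨t, fun s hs => hs.2.1⟩
  have h0S : (0 : ℝ) ∈ S := ⟨le_rfl, ht.1, X, V, hmk 0 le_rfl ht.1 (by simp)⟩
  have hSdom : ∀ s ∈ S, ∀ τ ∈ Ioo (t - s) t, X τ ∈ domain ξ := by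
    rintro s ⟨hs0, hst, X', V', h⟩ τ hτ
    rw [← (huniq s hs0 hst X' V' h τ (Ioo_subset_Icc_self hτ)).1]
    exact h.2.2.2 τ hτ
  set e := exitTime ξ E t x v with he
  have hee : e = sSup S := rfl
  have he0 : 0 ≤ e := le_csSup hbdd h0S
  have het : e ≤ t := csSup_le ⟨0, h0S⟩ fun s hs => hs.2.1
  have hedom : ∀ τ ∈ Ioo (t - e) t, X τ ∈ domain ξ := by
    intro τ hτ
    obtain ⟨s, hs, hs'⟩ := exists_lt_of_lt_csSup ⟨0, h0S⟩ (show t - τ < sSup S by linarith [hτ.1])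
    exact hSdom s hs τ ⟨by linarith, hτ.2⟩
  -- The supremum defining the exit time is attained, hence the choice in `charPair` really picks a
  -- characteristic.
  have hchar : IsCharacteristic ξ E t x v (t - e) (charX ξ E t x v) (charV ξ E t x v) :=
    Classical.epsilon_spec (p := fun p : (ℝ → R3) × (ℝ → R3) =>
      IsCharacteristic ξ E t x v (t - e) p.1 p.2) ⟨(X, V), hmk e he0 het hedom⟩
  have hext : ∀ s, e < s → s ≤ t → ¬ ∀ τ ∈ Ioo (t - s) t, X τ ∈ domain ξ := by
    intro s hes hst h
    exact not_le.2 hes (le_csSup hbdd ⟨he0.trans hes.le, hst, X, V, hmk s (he0.trans hes.le) hst h⟩)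
  refine ⟨⟨he0, het⟩, hchar, ?_, fun ht0 hx0 hxv => ?_⟩
  -- A stop at a positive time inside the open domain could be prolonged backward by continuity,
  -- against maximality.
  · by_contra! hcon
    have hb0 : 0 < t - e := lt_of_le_of_ne (by linarith) hcon.1.symm
    have hbt : t - e ∈ Icc (t - e) t := ⟨le_rfl, by linarith⟩
    have hXb : X (t - e) ∈ domain ξ := by
      have h1 := hξ.mem_closure_iff.1 (hchar.mem_closure hx _ hbt)
      rw [(huniq e he0 het _ _ hchar _ hbt).1] at h1 hcon
      exact lt_of_le_of_ne h1 hcon.2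
    have hnb := (hXc (t - e) (hsub het hbt)).preimage_mem_nhdsWithin
      (hξ.isOpen_domain.mem_nhds hXb)
    obtain ⟨ε, hε, hball⟩ := Metric.mem_nhdsWithin_iff.1 hnb
    have hη : 0 < min (ε / 2) (t - e) := by positivity
    refine hext (e + min (ε / 2) (t - e)) (by linarith)
      (by linarith [min_le_right (ε / 2) (t - e)]) (fun τ hτ => ?_)
    rcases le_or_gt τ (t - e) with h | h
    · apply hball
      have := hτ.1
      have h2 := min_le_left (ε / 2) (t - e)
      have h3 := min_le_right (ε / 2) (t - e)
      refine ⟨?_, by linarith, by linarith⟩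
      rw [Metric.mem_ball, Real.dist_eq, abs_lt]
      constructor <;> linarith
    · exact hedom τ ⟨h, hτ.2⟩
  -- Here ξ∘X vanishes at time t with positive derivative, so it is negative just before t and the
  -- flight has positive length.
  · by_contra! hcon
    have he00 : e = 0 := le_antisymm hcon he0
    have hd : HasDerivWithinAt (fun s => ξ (X s)) (fderiv ℝ ξ x v) (Icc 0 t) t := by
      have h1 := (hXV t (right_mem_Icc.2 ht.1)).1
      have h2 := ((hξ.contDiff.differentiable (by norm_num)) (X t)).hasFDerivAt
      rw [hXt] at h2
      rw [hVt] at h1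
      have h3 := HasFDerivAt.comp_hasDerivWithinAt_of_eq t h2 h1 hXt.symm
      exact h3
    rw [hasDerivWithinAt_iff_tendsto_slope] at hd
    have hev := hd.eventually (lt_mem_nhds hxv)
    rw [eventually_nhdsWithin_iff, Metric.eventually_nhds_iff] at hev
    obtain ⟨ε, hε, hball⟩ := hev
    have hη : 0 < min (ε / 2) t := by positivity
    refine hext (min (ε / 2) t) (by rw [he00]; exact hη) (min_le_right _ _) (fun τ hτ => ?_)
    have h2 := min_le_left (ε / 2) t
    have h3 := min_le_right (ε / 2) t
    have h4 := hball (y := τ) (by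
      rw [Real.dist_eq, abs_lt]; constructor <;> linarith [hτ.1, hτ.2])
      ⟨⟨by linarith [hτ.1], hτ.2.le⟩, hτ.2.ne⟩
    rw [slope_def_field, hXt, hx0] at h4
    have h5 : t - τ > 0 := by linarith [hτ.2]
    show ξ (X τ) < 0
    by_contra! h6
    have : (0 - ξ (X τ)) / (t - τ) ≤ 0 := div_nonpos_of_nonpos_of_nonneg (by linarith) h5.le
    have e1 : (ξ (X τ) - 0) / (τ - t) = (0 - ξ (X τ)) / (t - τ) := by
      rw [← neg_div_neg_eq]; congr 1 <;> ring
    linarith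

end Characteristics

end SpecularBoltzmann

namespace SpecularBoltzmann

/-! ### The velocity lemma -/

section Velocity

variable {ξ : R3 → ℝ} {T A m : ℝ} {E : ℝ → R3 → R3}

/-- The second derivative of `ξ` along characteristics. -/
noncomputable def normalAccel (ξ : R3 → ℝ) (E : ℝ → R3 → R3) (s : ℝ) (x v : R3) : ℝ :=
  hessForm ξ x v + fderiv ℝ ξ x (E s x)

/-- The kinetic functional, almost invariant along characteristics. -/
noncomputable def kinetic (ξ : R3 → ℝ) (E : ℝ → R3 → R3) (A s : ℝ) (x v : R3) : ℝ :=
  (fderiv ℝ ξ x v) ^ 2 - 2 * ξ x * normalAccel ξ E s x v + 2 * A * (bracket v ^ 2 * (ξ x) ^ 2)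

theorem abs_normalAccel_le (hB : FieldBounds ξ T E A m) {s : ℝ} (hs : s ∈ Icc 0 T) {x : R3}
    (hx : x ∈ closure (domain ξ)) (v : R3) :
    |normalAccel ξ E s x v| ≤ A ^ 2 * bracket v ^ 2 := by
  have hA := hB.one_le
  have h1 := hessForm_le hB hx v
  have h2 : |fderiv ℝ ξ x (E s x)| ≤ A * A := by
    rw [← Real.norm_eq_abs]
    exact (ContinuousLinearMap.le_opNorm _ _).trans
      (mul_le_mul (hB.fderiv_le x hx) (hB.field_le s hs x hx) (norm_nonneg _) (by linarith))
  have h3 : A * ‖v‖ ^ 2 ≤ A ^ 2 * ‖v‖ ^ 2 := by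
    have : A ≤ A ^ 2 := by nlinarith
    gcongr
  rw [bracket_sq]
  unfold normalAccel
  calc _ ≤ |hessForm ξ x v| + |fderiv ℝ ξ x (E s x)| := abs_add_le _ _
    _ ≤ _ := by nlinarith

/-- With depth h, the functional is n² + 2h(n' + A⟨v⟩²h), and coercivity bounds the parenthesis
below by m⟨v⟩²; its quadratic term is there for this purpose. Unlike in α, the field is taken at x
and not at its boundary projection, so no derivative of the projection arises along the flow. -/
theorem kinetic_ge (hB : FieldBounds ξ T E A m) (hξ : IsDefiningFunction ξ) {s : ℝ}
    (hs : s ∈ Icc 0 T) {x : R3} (hx : x ∈ closure (domain ξ)) (v : R3) :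
    (fderiv ℝ ξ x v) ^ 2 + 2 * m * bracket v ^ 2 * (-ξ x) ≤ kinetic ξ E A s x v := by
  have h1 := hB.coercive s hs x hx v
  have h2 := hξ.mem_closure_iff.1 hx
  have h3 := mul_le_mul_of_nonneg_right h1 (by linarith : 0 ≤ -ξ x)
  unfold kinetic normalAccel
  nlinarith

/-- Used to turn a lower bound of the functional into n² + Kh ≥ c·w², the non-degeneracy required by
the arch estimate. -/
theorem kinetic_le (hB : FieldBounds ξ T E A m) (hξ : IsDefiningFunction ξ) {s : ℝ}
    (hs : s ∈ Icc 0 T) {x : R3} (hx : x ∈ closure (domain ξ)) (v : R3) :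
    kinetic ξ E A s x v ≤ (fderiv ℝ ξ x v) ^ 2 + 4 * A ^ 2 * bracket v ^ 2 * (-ξ x) := by
  have hA := hB.one_le
  have h1 := (abs_le.1 (abs_normalAccel_le hB hs hx v)).2
  have h2 := hξ.mem_closure_iff.1 hx
  have h3 := mul_le_mul_of_nonneg_right h1 (by linarith : 0 ≤ -ξ x)
  have h4 := (abs_le.1 (hB.abs_le x hx)).1
  have h5 : ξ x ^ 2 ≤ A * (-ξ x) := by nlinarith
  have h6 : A * (bracket v ^ 2 * (ξ x) ^ 2) ≤ A * (bracket v ^ 2 * (A * (-ξ x))) := by gcongr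
  unfold kinetic
  nlinarith

/-! ### Derivatives and growth of the kinetic functional along one characteristic. -/

section Along

variable {t a s : ℝ} {x v : R3} {X V : ℝ → R3}

theorem IsCharacteristic.hasDerivAt (h : IsCharacteristic ξ E t x v a X V) (hs : s ∈ Ioo a t) :
    HasDerivAt X (V s) s ∧ HasDerivAt V (E s (X s)) s :=
  ⟨(h.2.2.1 s (Ioo_subset_Icc_self hs)).1.hasDerivAt (Icc_mem_nhds hs.1 hs.2),
    (h.2.2.1 s (Ioo_subset_Icc_self hs)).2.hasDerivAt (Icc_mem_nhds hs.1 hs.2)⟩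

theorem IsCharacteristic.hasDerivAt_depth (hξ : IsDefiningFunction ξ)
    (h : IsCharacteristic ξ E t x v a X V) (hs : s ∈ Ioo a t) :
    HasDerivAt (fun s => ξ (X s)) (fderiv ℝ ξ (X s) (V s)) s :=
  ((hξ.contDiff.differentiable (by norm_num)) (X s)).hasFDerivAt.comp_hasDerivAt s
    (h.hasDerivAt hs).1

theorem IsCharacteristic.hasDerivAt_normal (hξ : IsDefiningFunction ξ)
    (h : IsCharacteristic ξ E t x v a X V) (hs : s ∈ Ioo a t) :
    HasDerivAt (fun s => fderiv ℝ ξ (X s) (V s)) (normalAccel ξ E s (X s) (V s)) s :=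
  (((hξ.contDiff_fderiv.differentiable (by norm_num)) (X s)).hasFDerivAt.comp_hasDerivAt s
    (h.hasDerivAt hs).1).clm_apply (h.hasDerivAt hs).2

-- The derivative has five terms: the third derivative of ξ, three Hessian terms pairing V with E,
-- and ∇ξ applied to the total derivative of E. The Lipschitz constant bounds the last, time
-- derivative included.
set_option maxSynthPendingDepth 5 in
theorem IsCharacteristic.hasDerivAt_normalAccel (hξ : IsDefiningFunction ξ)
    (hB : FieldBounds ξ T E A m) (ha : 0 ≤ a) (ht : t ≤ T)
    (h : IsCharacteristic ξ E t x v a X V) (hs : s ∈ Ioo a t) :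
    ∃ D, HasDerivAt (fun s => normalAccel ξ E s (X s) (V s)) D s ∧
      |D| ≤ 5 * A ^ 2 * bracket (V s) ^ 3 := by
  obtain ⟨hX, hV⟩ := h.hasDerivAt hs
  have hsT : s ∈ Ioo 0 T := ⟨ha.trans_lt hs.1, hs.2.trans_le ht⟩
  have hXs := h.2.2.2 s hs
  have hXc := subset_closure hXs
  have hE0 := (hB.field_diff s hsT _ hXs).hasFDerivAt
  have hnb : Icc 0 T ×ˢ closure (domain ξ) ∈ nhds (s, X s) :=
    prod_mem_nhds (Icc_mem_nhds hsT.1 hsT.2)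
      (Filter.mem_of_superset (hξ.isOpen_domain.mem_nhds hXs) subset_closure)
  have hEn := hE0.le_of_lipschitzOn hnb hB.field_lip
  rw [Real.coe_toNNReal _ (by linarith [hB.one_le])] at hEn
  set L := fderiv ℝ (fun p : ℝ × R3 => E p.1 p.2) (s, X s)
  have hE1 : HasDerivAt (fun s => E s (X s)) (L (1, V s)) s :=
    hE0.comp_hasDerivAt (f := fun s => (s, X s)) s ((hasDerivAt_id s).prodMk hX)
  have hf1 : HasDerivAt (fun s => fderiv ℝ ξ (X s)) (fderiv ℝ (fderiv ℝ ξ) (X s) (V s)) s :=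
    ((hξ.contDiff_fderiv.differentiable (by norm_num)) (X s)).hasFDerivAt.comp_hasDerivAt s hX
  have hf2 : HasDerivAt (fun s => fderiv ℝ (fderiv ℝ ξ) (X s))
      (fderiv ℝ (fderiv ℝ (fderiv ℝ ξ)) (X s) (V s)) s :=
    ((hξ.contDiff_fderiv2.differentiable (by norm_num)) (X s)).hasFDerivAt.comp_hasDerivAt s hX
  have hd := ((hf2.clm_apply hV).clm_apply hV).add (hf1.clm_apply hE1)
  refine ⟨_, hd, ?_⟩
  have hA := hB.one_le
  have hb1 := one_le_bracket (V s)
  have hVb := norm_le_bracket (V s)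
  have hEs := hB.field_le s (Ioo_subset_Icc_self hsT) _ hXc
  have hL : ‖L (1, V s)‖ ≤ A * bracket (V s) := by
    refine (ContinuousLinearMap.le_opNorm _ _).trans (mul_le_mul hEn ?_ (norm_nonneg _) (by linarith))
    rw [Prod.norm_def]
    exact max_le (by simpa using hb1) hVb
  set b := bracket (V s)
  have e1 : ‖fderiv ℝ (fderiv ℝ (fderiv ℝ ξ)) (X s) (V s) (V s) (V s)‖ ≤ A * b * b * b := by
    refine (ContinuousLinearMap.le_opNorm₂ _ _ _).trans ?_
    have := ContinuousLinearMap.le_opNorm (fderiv ℝ (fderiv ℝ (fderiv ℝ ξ)) (X s)) (V s)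
    have h3 := hB.fderiv3_le _ hXc
    have h4 : ‖fderiv ℝ (fderiv ℝ (fderiv ℝ ξ)) (X s) (V s)‖ ≤ A * b :=
      this.trans (by gcongr)
    gcongr
  have e2 : ∀ y z : R3, ‖fderiv ℝ (fderiv ℝ ξ) (X s) y z‖ ≤ A * ‖y‖ * ‖z‖ := fun y z =>
    (ContinuousLinearMap.le_opNorm₂ _ _ _).trans (by gcongr; exact hB.fderiv2_le _ hXc)
  have e3 : ‖fderiv ℝ ξ (X s) (L (1, V s))‖ ≤ A * (A * b) :=
    (ContinuousLinearMap.le_opNorm _ _).trans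
      (mul_le_mul (hB.fderiv_le _ hXc) hL (norm_nonneg _) (by linarith))
  have e4 : ‖fderiv ℝ (fderiv ℝ ξ) (X s) (V s) (E s (X s))‖ ≤ A * b * A :=
    (e2 _ _).trans (by gcongr)
  have e5 : ‖fderiv ℝ (fderiv ℝ ξ) (X s) (E s (X s)) (V s)‖ ≤ A * A * b :=
    (e2 _ _).trans (by gcongr)
  rw [← Real.norm_eq_abs]
  have hb3 : b ≤ b ^ 3 := le_self_pow₀ hb1 (by norm_num)
  have f1 : A * b * b * b ≤ A ^ 2 * b ^ 3 := by
    have : A ≤ A ^ 2 := le_self_pow₀ hA (by norm_num)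
    calc A * b * b * b = A * b ^ 3 := by ring
      _ ≤ _ := by gcongr
  have f2 : A * A * b ≤ A ^ 2 * b ^ 3 := by
    rw [← sq]; gcongr
  simp only [add_apply]
  refine (norm_add_le _ _).trans ((add_le_add ((norm_add_le _ _).trans
    (add_le_add_left (norm_add_le _ _) _)) (norm_add_le _ _)).trans ?_)
  linarith

theorem IsCharacteristic.hasDerivAt_bracket_sq (h : IsCharacteristic ξ E t x v a X V)
    (hs : s ∈ Ioo a t) :
    HasDerivAt (fun s => bracket (V s) ^ 2) (2 * inner ℝ (V s) (E s (X s))) s := by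
  simp only [bracket_sq]
  exact (h.hasDerivAt hs).2.norm_sq.const_add 1

/-- The contributions 2nn' of n² and of -2ξn' cancel, so every remaining term carries a factor ξ and
is at most a constant times ⟨V⟩³|ξ|, which `kinetic_ge` bounds by ⟨V⟩ times the functional. A
one-sided bound suffices, as the functional is only followed backward. -/
theorem IsCharacteristic.hasDerivAt_kinetic (hξ : IsDefiningFunction ξ)
    (hB : FieldBounds ξ T E A m) (ha : 0 ≤ a) (ht : t ≤ T)
    (h : IsCharacteristic ξ E t x v a X V) (hs : s ∈ Ioo a t) :
    ∃ D, HasDerivAt (fun s => kinetic ξ E A s (X s) (V s)) D s ∧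
      D ≤ 9 * A ^ 3 / m * bracket (V s) * kinetic ξ E A s (X s) (V s) := by
  obtain ⟨D, hD, hDb⟩ := h.hasDerivAt_normalAccel hξ hB ha ht hs
  have h1 := h.hasDerivAt_depth hξ hs
  have h2 := h.hasDerivAt_normal hξ hs
  have h3 := h.hasDerivAt_bracket_sq hs
  have hsT : s ∈ Icc 0 T := ⟨ha.trans hs.1.le, hs.2.le.trans ht⟩
  have hXs := h.2.2.2 s hs
  have hXc := subset_closure hXs
  have hW := kinetic_ge hB hξ hsT hXc (V s)
  have hA := hB.one_le
  have hm := hB.m_pos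
  have hd := ((h2.pow 2).sub ((h1.const_mul 2).mul hD)).add ((h3.mul (h1.pow 2)).const_mul (2 * A))
  refine ⟨_, hd, ?_⟩
  have hE : |(inner ℝ (V s) (E s (X s)) : ℝ)| ≤ bracket (V s) * A :=
    (abs_real_inner_le_norm _ _).trans (mul_le_mul (norm_le_bracket _) (hB.field_le s hsT _ hXc)
      (norm_nonneg _) (bracket_pos _).le)
  have hn : |fderiv ℝ ξ (X s) (V s)| ≤ A * bracket (V s) := by
    rw [← Real.norm_eq_abs]
    exact (ContinuousLinearMap.le_opNorm _ _).trans
      (mul_le_mul (hB.fderiv_le _ hXc) (norm_le_bracket _) (norm_nonneg _) (by linarith))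
  have hxA := (abs_le.1 (hB.abs_le _ hXc)).1
  have hb1 := one_le_bracket (V s)
  have hh : 0 < -ξ (X s) := neg_pos.2 hXs
  obtain ⟨b, hb⟩ : ∃ b, b = bracket (V s) := ⟨_, rfl⟩
  obtain ⟨y, hy⟩ : ∃ y, y = -ξ (X s) := ⟨_, rfl⟩
  obtain ⟨n, hn'⟩ : ∃ n, n = fderiv ℝ ξ (X s) (V s) := ⟨_, rfl⟩
  obtain ⟨i, hi⟩ : ∃ i : ℝ, i = inner ℝ (V s) (E s (X s)) := ⟨_, rfl⟩
  have hxy : ξ (X s) = -y := by rw [hy, neg_neg]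
  rw [← hb, ← hn', ← hy] at hW
  rw [← hb] at hDb hE hn hb1 ⊢
  rw [← hi] at hE ⊢
  rw [← hn'] at hn ⊢
  rw [← hy] at hh
  rw [hxy] at hxA ⊢
  have g1 : D * y ≤ 5 * A ^ 2 * b ^ 3 * y :=
    mul_le_mul_of_nonneg_right ((le_abs_self D).trans hDb) hh.le
  have g2 : i * y ^ 2 ≤ b ^ 3 * A ^ 2 * y := by
    have p1 : i ≤ b * A := (le_abs_self i).trans hE
    have p2 : b ≤ b ^ 3 := le_self_pow₀ hb1 (by norm_num)
    calc i * y ^ 2 ≤ (b * A) * (A * y) := by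
          have : y ^ 2 ≤ A * y := by nlinarith
          exact mul_le_mul p1 this (by positivity) (by positivity)
      _ = b * (A ^ 2 * y) := by ring
      _ ≤ b ^ 3 * (A ^ 2 * y) := by gcongr
      _ = _ := by ring
  have g3 : -(b ^ 2 * y * n) ≤ A * b ^ 3 * y := by
    have p1 : -n ≤ A * b := (neg_le_abs n).trans hn
    calc -(b ^ 2 * y * n) = b ^ 2 * y * (-n) := by ring
      _ ≤ b ^ 2 * y * (A * b) := by gcongr
      _ = _ := by ring
  have g4 : A ^ 2 * b ^ 3 * y ≤ A ^ 3 * b ^ 3 * y := by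
    have : A ^ 2 ≤ A ^ 3 := pow_le_pow_right₀ hA (by norm_num)
    gcongr
  -- 18 = 10 + 4 + 4: twice the constant 5 of the third-order term, and two terms from
  -- differentiating the quadratic correction.
  have g5 : 18 * A ^ 3 * b ^ 3 * y ≤
      9 * A ^ 3 / m * b * kinetic ξ E A s (X s) (V s) := by
    calc 18 * A ^ 3 * b ^ 3 * y = 9 * A ^ 3 / m * b * (2 * m * b ^ 2 * y) := by
          field_simp; ring
      _ ≤ _ := by
          apply mul_le_mul_of_nonneg_left _ (by positivity)
          nlinarith [sq_nonneg n]
  refine le_trans (le_of_eq ?_) (le_trans (show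
    2 * (D * y) + 4 * A * (i * y ^ 2) + 4 * A * (-(b ^ 2 * y * n)) ≤ 18 * A ^ 3 * b ^ 3 * y from ?_) g5)
  · simp only [Nat.cast_ofNat, Pi.pow_apply, hxy]
    ring
  · have q1 : 4 * A * (i * y ^ 2) ≤ 4 * A * (b ^ 3 * A ^ 2 * y) := by gcongr
    have q2 : 4 * A * (-(b ^ 2 * y * n)) ≤ 4 * A * (A * b ^ 3 * y) := by gcongr
    nlinarith

theorem IsCharacteristic.continuousOn_field (hB : FieldBounds ξ T E A m) (ha : 0 ≤ a) (ht : t ≤ T)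
    (hx : x ∈ closure (domain ξ)) (h : IsCharacteristic ξ E t x v a X V) :
    ContinuousOn (fun s => E s (X s)) (Icc a t) :=
  hB.field_lip.continuousOn.comp (f := fun s => (s, X s))
    (continuousOn_id.prodMk h.continuousOn.1)
    fun s hs => ⟨⟨ha.trans hs.1, hs.2.trans ht⟩, h.mem_closure hx s hs⟩

theorem IsCharacteristic.continuousOn_normal (hξ : IsDefiningFunction ξ)
    (h : IsCharacteristic ξ E t x v a X V) :
    ContinuousOn (fun s => fderiv ℝ ξ (X s) (V s)) (Icc a t) :=
  (hξ.contDiff_fderiv.continuous.comp_continuousOn h.continuousOn.1).clm_apply h.continuousOn.2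

theorem continuous_bracket : Continuous bracket := by
  unfold bracket; fun_prop

theorem IsCharacteristic.continuousOn_kinetic (hξ : IsDefiningFunction ξ)
    (hB : FieldBounds ξ T E A m) (ha : 0 ≤ a) (ht : t ≤ T)
    (hx : x ∈ closure (domain ξ)) (h : IsCharacteristic ξ E t x v a X V) :
    ContinuousOn (fun s => kinetic ξ E A s (X s) (V s)) (Icc a t) := by
  have h1 := h.continuousOn_normal hξ
  have h2 := h.continuousOn_field hB ha ht hx
  have h3 : ContinuousOn (fun s => fderiv ℝ ξ (X s) (E s (X s))) (Icc a t) :=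
    (hξ.contDiff_fderiv.continuous.comp_continuousOn h.continuousOn.1).clm_apply h2
  have h4 : ContinuousOn (fun s => hessForm ξ (X s) (V s)) (Icc a t) :=
    ((hξ.contDiff_fderiv2.continuous.comp_continuousOn h.continuousOn.1).clm_apply
      h.continuousOn.2).clm_apply h.continuousOn.2
  have h5 : ContinuousOn (fun s => ξ (X s)) (Icc a t) :=
    hξ.contDiff.continuous.comp_continuousOn h.continuousOn.1
  have h6 : ContinuousOn (fun s => bracket (V s)) (Icc a t) :=
    continuous_bracket.comp_continuousOn h.continuousOn.2
  exact ((h1.pow 2).sub ((continuousOn_const.mul h5).mul (h4.add h3))).add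
    (continuousOn_const.mul ((h6.pow 2).mul (h5.pow 2)))

/-- The velocity lemma on one arch. -/
theorem IsCharacteristic.kinetic_le_exp (hξ : IsDefiningFunction ξ)
    (hB : FieldBounds ξ T E A m) (ha : 0 ≤ a) (ht : t ≤ T)
    (hx : x ∈ closure (domain ξ)) (h : IsCharacteristic ξ E t x v a X V) {b : ℝ}
    (hb : ∀ s ∈ Icc a t, bracket (V s) ≤ b) (hs : s ∈ Icc a t) :
    Real.exp (-(9 * A ^ 3 / m * b * (t - s))) * kinetic ξ E A t x v ≤
      kinetic ξ E A s (X s) (V s) := by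
  set Λ := 9 * A ^ 3 / m * b with hΛ
  have hanti : AntitoneOn (fun s => Real.exp (-(Λ * s)) * kinetic ξ E A s (X s) (V s))
      (Icc a t) := by
    have hder : ∀ s ∈ Ioo a t, ∃ D, HasDerivAt
        (fun s => Real.exp (-(Λ * s)) * kinetic ξ E A s (X s) (V s)) D s ∧ D ≤ 0 := by
      intro s hs
      obtain ⟨D, hD, hDb⟩ := h.hasDerivAt_kinetic hξ hB ha ht hs
      have he : HasDerivAt (fun s => Real.exp (-(Λ * s))) (Real.exp (-(Λ * s)) * (-(Λ * 1))) s :=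
        (((hasDerivAt_id s).const_mul Λ).neg).exp
      refine ⟨_, he.mul hD, ?_⟩
      have hsT : s ∈ Icc 0 T := ⟨ha.trans hs.1.le, hs.2.le.trans ht⟩
      have hXs := h.2.2.2 s hs
      have hK0 : 0 ≤ kinetic ξ E A s (X s) (V s) := by
        refine le_trans ?_ (kinetic_ge hB hξ hsT (subset_closure hXs) (V s))
        have h1 : 0 < -ξ (X s) := neg_pos.2 hXs
        have := hB.m_pos
        positivity
      have h3 : D ≤ Λ * kinetic ξ E A s (X s) (V s) := by
        refine hDb.trans (mul_le_mul_of_nonneg_right ?_ hK0)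
        have := hB.m_pos
        have := hB.one_le
        rw [hΛ]
        exact mul_le_mul_of_nonneg_left (hb s (Ioo_subset_Icc_self hs)) (by positivity)
      have h4 := Real.exp_pos (-(Λ * s))
      nlinarith
    apply antitoneOn_of_deriv_nonpos (convex_Icc a t)
    · exact (by fun_prop : Continuous fun s => Real.exp (-(Λ * s))).continuousOn.mul
        (h.continuousOn_kinetic hξ hB ha ht hx)
    · rw [interior_Icc]
      intro s hs
      obtain ⟨D, hD, -⟩ := hder s hs
      exact hD.differentiableAt.differentiableWithinAt
    · rw [interior_Icc]
      intro s hs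
      obtain ⟨D, hD, h0⟩ := hder s hs
      rw [hD.deriv]; exact h0
  have h1 := hanti hs (right_mem_Icc.2 (hs.1.trans hs.2)) hs.2
  simp only [h.1, h.2.1] at h1
  have h2 : Real.exp (-(Λ * (t - s))) = Real.exp (-(Λ * t)) * Real.exp (Λ * s) := by
    rw [← Real.exp_add]; congr 1; ring
  have h3 : Real.exp (Λ * s) * Real.exp (-(Λ * s)) = 1 := by
    rw [← Real.exp_add]; simp
  calc _ = Real.exp (Λ * s) * (Real.exp (-(Λ * t)) * kinetic ξ E A t x v) := by rw [h2]; ring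
    _ ≤ Real.exp (Λ * s) * (Real.exp (-(Λ * s)) * kinetic ξ E A s (X s) (V s)) := by gcongr
    _ = _ := by rw [← mul_assoc, h3, one_mul]

theorem IsCharacteristic.norm_sub_le (hB : FieldBounds ξ T E A m) (ha : 0 ≤ a) (ht : t ≤ T)
    (hx : x ∈ closure (domain ξ)) (h : IsCharacteristic ξ E t x v a X V) (hs : s ∈ Icc a t) :
    ‖V s - v‖ ≤ A * (t - s) := by
  have h1 := (convex_Icc a t).norm_image_sub_le_of_norm_hasDerivWithin_le
    (fun s hs => (h.2.2.1 s hs).2)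
    (fun s hs => hB.field_le s ⟨ha.trans hs.1, hs.2.trans ht⟩ _ (h.mem_closure hx s hs))
    (right_mem_Icc.2 (hs.1.trans hs.2)) hs
  rwa [h.2.1, Real.norm_eq_abs, abs_sub_comm, abs_of_nonneg (by linarith [hs.2])] at h1

end Along

end Velocity

end SpecularBoltzmann

namespace SpecularBoltzmann

/-! ### The singular integral along one arch -/

/-- A bounded regularization of `y ^ (1 - p)`. -/
noncomputable def cutPow (p M y : ℝ) : ℝ := (M * y / (M + y)) ^ (1 - p)

/-- A bounded regularization of the sign. -/
noncomputable def smoothSign (w y : ℝ) : ℝ := y / Real.sqrt (w ^ 2 + y ^ 2)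

/-- The additive constant of the arch potential. -/
noncomputable def archConst (p c K M w l : ℝ) : ℝ :=
  M ^ (1 - p) + (2 * K * M ^ (1 - p) / w + (1 - p) * c / 16 * w * M ^ (-p)) / l

/-- A quantity increasing along an arch, faster than the singular integrand. -/
noncomputable def archPotential (p c K M w l τ h n : ℝ) : ℝ :=
  Real.exp (-(l * τ)) * (archConst p c K M w l - cutPow p M h * smoothSign w n)

/-! ### Elementary bounds for the regularized power and sign. -/

theorem cutPow_nonneg {p M y : ℝ} (hM : 0 < M) (hy : 0 ≤ y) : 0 ≤ cutPow p M y := by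
  unfold cutPow; positivity

theorem cutPow_le {p M y : ℝ} (hp : p < 1) (hM : 0 < M) (hy : 0 ≤ y) :
    cutPow p M y ≤ M ^ (1 - p) := by
  apply Real.rpow_le_rpow (by positivity) _ (by linarith)
  rw [div_le_iff₀ (by positivity)]
  nlinarith

theorem cutPow_zero {p M : ℝ} (hp : p < 1) : cutPow p M 0 = 0 := by
  unfold cutPow
  rw [mul_zero, zero_div, Real.zero_rpow (by linarith)]

theorem hasDerivAt_cutPow {p M y : ℝ} (hM : 0 < M) (hy : 0 < y) :
    HasDerivAt (cutPow p M) ((1 - p) * (M * y / (M + y)) ^ (-p) * (M ^ 2 / (M + y) ^ 2)) y := by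
  have h1 : HasDerivAt (fun y => M * y / (M + y)) (M ^ 2 / (M + y) ^ 2) y := by
    have := ((hasDerivAt_id y).const_mul M).div ((hasDerivAt_id y).const_add M) (by positivity)
    refine this.congr_deriv ?_
    simp only [id]; ring
  have h2 := h1.rpow_const (p := 1 - p) (Or.inl (by positivity))
  refine h2.congr_deriv ?_
  rw [show 1 - p - 1 = -p by ring]; ring

theorem abs_smoothSign_le {w : ℝ} (hw : 0 < w) (y : ℝ) : |smoothSign w y| ≤ 1 := by
  unfold smoothSign
  have hr : 0 < Real.sqrt (w ^ 2 + y ^ 2) := by positivity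
  rw [abs_div, abs_of_pos hr, div_le_one hr]
  apply Real.abs_le_sqrt
  nlinarith [sq_nonneg w]

theorem hasDerivAt_smoothSign {w : ℝ} (hw : 0 < w) (y : ℝ) :
    HasDerivAt (smoothSign w) (w ^ 2 / Real.sqrt (w ^ 2 + y ^ 2) ^ 3) y := by
  have hpos : 0 < w ^ 2 + y ^ 2 := by positivity
  have hr : 0 < Real.sqrt (w ^ 2 + y ^ 2) := Real.sqrt_pos.2 hpos
  have h1 : HasDerivAt (fun y => w ^ 2 + y ^ 2) (2 * y) y := by
    simpa using (hasDerivAt_pow 2 y).const_add (w ^ 2)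
  have h2 := (hasDerivAt_id y).div (h1.sqrt hpos.ne') hr.ne'
  refine h2.congr_deriv ?_
  have hs := Real.sq_sqrt hpos.le
  simp only [id]
  field_simp
  rw [hs]; ring

theorem smoothSign_deriv_le {w : ℝ} (hw : 0 < w) (y : ℝ) :
    w ^ 2 / Real.sqrt (w ^ 2 + y ^ 2) ^ 3 ≤ 1 / w := by
  have hr : w ≤ Real.sqrt (w ^ 2 + y ^ 2) :=
    Real.le_sqrt_of_sq_le (by nlinarith [sq_nonneg y])
  rw [div_le_div_iff₀ (by positivity) hw]
  calc w ^ 2 * w = w ^ 3 := by ring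
    _ ≤ Real.sqrt (w ^ 2 + y ^ 2) ^ 3 := by gcongr
    _ = _ := by ring

/-- Applies where n² carries at least half of the available kinetic energy. The bound is linear in
k, so the velocity-lemma decay enters the arch estimate as a plain exponential factor. -/
theorem mul_smoothSign_ge {w y k : ℝ} (hw : 0 < w) (hk : 0 ≤ k) (hk1 : k ≤ 1)
    (h : k * w ^ 2 / 2 ≤ y ^ 2) : k * w / 4 ≤ y * smoothSign w y := by
  unfold smoothSign
  have hr : 0 < Real.sqrt (w ^ 2 + y ^ 2) := by positivity
  rw [mul_div_assoc', le_div_iff₀ hr]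
  rcases le_total (w ^ 2) (y ^ 2) with h1 | h1
  · have h2 : w ≤ |y| := by rw [← abs_of_pos hw]; exact sq_le_sq.1 h1
    have h3 : Real.sqrt (w ^ 2 + y ^ 2) ≤ 2 * |y| := by
      rw [Real.sqrt_le_left (by positivity), mul_pow, sq_abs]
      linarith [sq_nonneg y]
    calc k * w / 4 * Real.sqrt (w ^ 2 + y ^ 2) ≤ 1 * |y| / 4 * (2 * |y|) := by gcongr
      _ = y ^ 2 / 2 := by rw [← sq_abs y]; ring
      _ ≤ y * y := by nlinarith [sq_nonneg y]
  · have h3 : Real.sqrt (w ^ 2 + y ^ 2) ≤ 2 * w := by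
      rw [Real.sqrt_le_left (by positivity)]
      nlinarith [sq_nonneg w]
    calc k * w / 4 * Real.sqrt (w ^ 2 + y ^ 2) ≤ k * w / 4 * (2 * w) := by gcongr
      _ = k * w ^ 2 / 2 := by ring
      _ ≤ y * y := by linarith

section Arch

variable {p c K M w l : ℝ}

/-- The pointwise inequality behind the arch estimate. -/
theorem arch_pointwise (hp0 : 0 ≤ p) (hp : p < 1) (hc : 0 < c) (hc1 : c ≤ 1) (hK : 0 ≤ K)
    (hM : 0 < M) (hw : 0 < w) (hl : 0 < l) {h n D k : ℝ} (hh : 0 < h) (hD : |D| ≤ K)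
    (hk0 : 0 ≤ k) (hk1 : k ≤ 1) (hlow : c * k * w ^ 2 ≤ n ^ 2 + K * h) :
    (1 - p) * c / 16 * w * k * h ^ (-p) ≤
      l * (archConst p c K M w l - cutPow p M h * smoothSign w n) +
      ((1 - p) * (M * h / (M + h)) ^ (-p) * (M ^ 2 / (M + h) ^ 2)) * (n * smoothSign w n) -
      cutPow p M h * (w ^ 2 / Real.sqrt (w ^ 2 + n ^ 2) ^ 3 * D) := by
  obtain ⟨B, hB⟩ : ∃ B, B = M ^ (1 - p) := ⟨_, rfl⟩
  have hBp : 0 < B := by rw [hB]; positivity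
  have hg0 := cutPow_nonneg (p := p) hM hh.le
  have hg1 : cutPow p M h ≤ B := hB ▸ cutPow_le hp hM hh.le
  have hs := abs_le.1 (abs_smoothSign_le hw n)
  have hd0 : 0 ≤ w ^ 2 / Real.sqrt (w ^ 2 + n ^ 2) ^ 3 := by positivity
  have hd1 := smoothSign_deriv_le hw n
  have hq : 0 < 1 - p := by linarith
  -- The budget: lB offsets the derivative of the exponential, one copy of KB/w pays for the
  -- derivative of the smoothed sign, the other for the slow region n² small, and the last term for
  -- depths beyond M.
  have hR : l * archConst p c K M w l =
      l * B + 2 * (K * B / w) + (1 - p) * c / 16 * w * M ^ (-p) := by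
    unfold archConst; rw [← hB]; field_simp; ring
  have e1 : l * (cutPow p M h * smoothSign w n) ≤ l * B := by
    have : cutPow p M h * smoothSign w n ≤ B * 1 :=
      (mul_le_mul_of_nonneg_left hs.2 hg0).trans (mul_le_mul_of_nonneg_right hg1 zero_le_one)
    rw [mul_one] at this
    gcongr
  have e2 : cutPow p M h * (w ^ 2 / Real.sqrt (w ^ 2 + n ^ 2) ^ 3 * D) ≤ K * B / w := by
    calc _ ≤ cutPow p M h * (w ^ 2 / Real.sqrt (w ^ 2 + n ^ 2) ^ 3 * K) := by
          gcongr; exact (le_abs_self D).trans hD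
      _ ≤ B * (1 / w * K) := by gcongr
      _ = _ := by ring
  have hns : 0 ≤ n * smoothSign w n := by
    unfold smoothSign
    rw [mul_div_assoc', ← sq]; positivity
  set G := (1 - p) * (M * h / (M + h)) ^ (-p) * (M ^ 2 / (M + h) ^ 2) with hG
  have hG0 : 0 ≤ G := by rw [hG]; positivity
  have e3 : 0 ≤ G * (n * smoothSign w n) := mul_nonneg hG0 hns
  have e4 : 0 ≤ (1 - p) * c / 16 * w * M ^ (-p) := by positivity
  have e5 : 0 ≤ K * B / w := by positivity
  rw [mul_sub, hR]
  suffices hsuff : (1 - p) * c / 16 * w * k * h ^ (-p) ≤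
      K * B / w + (1 - p) * c / 16 * w * M ^ (-p) + G * (n * smoothSign w n) by linarith
  rcases le_or_gt M h with h1 | h1
  · have h2 : h ^ (-p) ≤ M ^ (-p) := Real.rpow_le_rpow_of_nonpos hM h1 (by linarith)
    have h3 : (1 - p) * c / 16 * w * k * h ^ (-p) ≤ (1 - p) * c / 16 * w * 1 * M ^ (-p) := by
      gcongr
    linarith
  -- Below depth M the power function has derivative at least (1-p)h^{-p}/4; multiplied by nσ(n) ≥
  -- ckw/4 this produces the factor 1/16.
  · rcases le_or_gt (c * k * w ^ 2 / 2) (n ^ 2) with h2 | h2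
    · have h3 := mul_smoothSign_ge hw (by positivity : 0 ≤ c * k) (by nlinarith) h2
      have h4 : (1 - p) * h ^ (-p) / 4 ≤ G := by
        have p1 : h ^ (-p) ≤ (M * h / (M + h)) ^ (-p) := by
          apply Real.rpow_le_rpow_of_nonpos (by positivity) _ (by linarith)
          rw [div_le_iff₀ (by positivity)]; nlinarith
        have p2 : 1 / 4 ≤ M ^ 2 / (M + h) ^ 2 := by
          rw [div_le_div_iff₀ (by norm_num) (by positivity)]; nlinarith
        calc (1 - p) * h ^ (-p) / 4 = (1 - p) * h ^ (-p) * (1 / 4) := by ring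
          _ ≤ G := by rw [hG]; gcongr
      have h5 := mul_le_mul h4 h3 (by positivity) hG0
      have h6 : (1 - p) * c / 16 * w * k * h ^ (-p) =
        (1 - p) * h ^ (-p) / 4 * (c * k * w / 4) := by ring
      linarith
    -- Near the turning point of an arch the depth carries the energy, so w·h^{-p} is at most a
    -- multiple of K·h^{1-p}/w, which is no longer singular.
    · have h3 : c * k * w ^ 2 / 2 ≤ K * h := by linarith
      have h4 : h ^ (-p) * h = h ^ (1 - p) := by
        rw [← Real.rpow_add_one hh.ne']; congr 1; ring
      have h5 : h ^ (1 - p) ≤ B := by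
        rw [hB]; exact Real.rpow_le_rpow hh.le h1.le hq.le
      have hhp : 0 ≤ h ^ (-p) := by positivity
      have h6 : (1 - p) * c / 16 * w * k * h ^ (-p) ≤ K * B / w := by
        rw [le_div_iff₀ hw]
        calc (1 - p) * c / 16 * w * k * h ^ (-p) * w
            = (1 - p) / 8 * ((c * k * w ^ 2 / 2) * h ^ (-p)) := by ring
          _ ≤ (1 - p) / 8 * ((K * h) * h ^ (-p)) := by gcongr
          _ = (1 - p) / 8 * (K * h ^ (1 - p)) := by rw [← h4]; ring
          _ ≤ 1 * (K * B) := by gcongr; linarith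
          _ = _ := by ring
      linarith

theorem archPotential_nonneg (hp : p < 1) (hc : 0 < c) (hK : 0 ≤ K)
    (hM : 0 < M) (hw : 0 < w) (hl : 0 < l) {τ h n : ℝ} (hh : 0 ≤ h) :
    0 ≤ archPotential p c K M w l τ h n := by
  have hs := abs_le.1 (abs_smoothSign_le hw n)
  have hq : 0 < 1 - p := by linarith
  have h1 : cutPow p M h * smoothSign w n ≤ M ^ (1 - p) * 1 :=
    (mul_le_mul_of_nonneg_left hs.2 (cutPow_nonneg hM hh)).trans
      (mul_le_mul_of_nonneg_right (cutPow_le hp hM hh) zero_le_one)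
  have h2 : 0 ≤ (2 * K * M ^ (1 - p) / w + (1 - p) * c / 16 * w * M ^ (-p)) / l := by positivity
  unfold archPotential archConst
  apply mul_nonneg (Real.exp_pos _).le
  linarith

theorem archPotential_le (hp : p < 1) (hc : 0 < c) (hK : 0 ≤ K)
    (hM : 0 < M) (hw : 0 < w) (hl : 0 < l) {τ h n : ℝ} (hτ : 0 ≤ τ) (hh : 0 ≤ h) :
    archPotential p c K M w l τ h n ≤ 2 * archConst p c K M w l := by
  have hs := abs_le.1 (abs_smoothSign_le hw n)
  have hq : 0 < 1 - p := by linarith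
  have h1 : -(cutPow p M h * smoothSign w n) ≤ M ^ (1 - p) * 1 := by
    rw [← mul_neg]
    exact (mul_le_mul_of_nonneg_left (by linarith) (cutPow_nonneg hM hh)).trans
      (mul_le_mul_of_nonneg_right (cutPow_le hp hM hh) zero_le_one)
  have h2 : 0 ≤ (2 * K * M ^ (1 - p) / w + (1 - p) * c / 16 * w * M ^ (-p)) / l := by positivity
  have h3 : M ^ (1 - p) ≤ archConst p c K M w l := by unfold archConst; linarith
  have h4 : 0 < M ^ (1 - p) := by positivity
  unfold archPotential
  have h5 : Real.exp (-(l * τ)) ≤ 1 := Real.exp_le_one_iff.2 (by nlinarith)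
  calc _ ≤ Real.exp (-(l * τ)) * (2 * archConst p c K M w l) := by gcongr; linarith
    _ ≤ 1 * (2 * archConst p c K M w l) := by gcongr; linarith
    _ = _ := one_mul _

/-- The singular integral along one arch is controlled by the increment of the potential. -/
theorem lintegral_arch_le (hp0 : 0 ≤ p) (hp : p < 1) (hc : 0 < c) (hc1 : c ≤ 1) (hK : 0 ≤ K)
    (hM : 0 < M) (hw : 0 < w) (hl : 0 < l) {Λ t a b : ℝ} (hΛ : 0 ≤ Λ) (hab : a ≤ b) (hbt : b ≤ t)
    {h n D : ℝ → ℝ} (hhc : ContinuousOn h (Icc a b)) (hnc : ContinuousOn n (Icc a b))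
    (hh0 : ∀ s ∈ Icc a b, 0 ≤ h s) (hh : ∀ s ∈ Ioo a b, 0 < h s)
    (hhd : ∀ s ∈ Ioo a b, HasDerivAt h (-n s) s) (hnd : ∀ s ∈ Ioo a b, HasDerivAt n (D s) s)
    (hD : ∀ s ∈ Ioo a b, |D s| ≤ K)
    (hlow : ∀ s ∈ Ioo a b, c * Real.exp (-(Λ * (t - s))) * w ^ 2 ≤ n s ^ 2 + K * h s) :
    ∫⁻ s in Ioo a b, ENNReal.ofReal
      ((1 - p) * c / 16 * w * Real.exp (-((l + Λ) * (t - s))) * h s ^ (-p)) ≤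
      ENNReal.ofReal (archPotential p c K M w l (t - b) (h b) (n b) -
        archPotential p c K M w l (t - a) (h a) (n a)) ∧
    archPotential p c K M w l (t - a) (h a) (n a) ≤
      archPotential p c K M w l (t - b) (h b) (n b) := by
  set ψ : ℝ → ℝ := fun s => archPotential p c K M w l (t - s) (h s) (n s) with hψ
  set ψ' : ℝ → ℝ := fun s => Real.exp (-(l * (t - s))) *
    (l * (archConst p c K M w l - cutPow p M (h s) * smoothSign w (n s)) +
      ((1 - p) * (M * h s / (M + h s)) ^ (-p) * (M ^ 2 / (M + h s) ^ 2)) *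
        (n s * smoothSign w (n s)) -
      cutPow p M (h s) * (w ^ 2 / Real.sqrt (w ^ 2 + n s ^ 2) ^ 3 * D s)) with hψ'
  have hψc : ContinuousOn ψ (Icc a b) := by
    have h1 : ContinuousOn (fun s => cutPow p M (h s)) (Icc a b) := by
      unfold cutPow
      refine ((continuousOn_const.mul hhc).div (continuousOn_const.add hhc) fun s hs => ?_).rpow_const
        fun s hs => Or.inr (by linarith)
      have := hh0 s hs
      exact (by positivity : 0 < M + h s).ne'
    have h2 : ContinuousOn (fun s => smoothSign w (n s)) (Icc a b) := by
      unfold smoothSign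
      refine hnc.div ((continuousOn_const.add (hnc.pow 2)).sqrt) fun s _ => ?_
      positivity
    have h3 : Continuous fun s : ℝ => Real.exp (-(l * (t - s))) := by fun_prop
    exact h3.continuousOn.mul (continuousOn_const.sub (h1.mul h2))
  have hψd : ∀ s ∈ Ioo a b, HasDerivAt ψ (ψ' s) s := by
    intro s hs
    have h1 : HasDerivAt (fun s => cutPow p M (h s)) _ s :=
      (hasDerivAt_cutPow (p := p) hM (hh s hs)).comp s (hhd s hs)
    have h2 : HasDerivAt (fun s => smoothSign w (n s)) _ s :=
      (hasDerivAt_smoothSign hw (n s)).comp s (hnd s hs)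
    have h3 : HasDerivAt (fun s : ℝ => Real.exp (-(l * (t - s))))
        (Real.exp (-(l * (t - s))) * -(l * -1)) s :=
      ((((hasDerivAt_id s).const_sub t).const_mul l).neg).exp
    have h4 := h3.mul ((h1.mul h2).const_sub (archConst p c K M w l))
    refine h4.congr_deriv ?_
    simp only [hψ', Pi.mul_apply]
    ring
  have hF : ∀ s ∈ Ioo a b,
      (1 - p) * c / 16 * w * Real.exp (-((l + Λ) * (t - s))) * h s ^ (-p) ≤ ψ' s := by
    intro s hs
    have hts : 0 ≤ t - s := by linarith [hs.2]
    have h1 := arch_pointwise hp0 hp hc hc1 hK hM hw hl (hh s hs) (hD s hs)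
      (Real.exp_pos (-(Λ * (t - s)))).le (Real.exp_le_one_iff.2 (by nlinarith)) (hlow s hs)
    have h2 : Real.exp (-((l + Λ) * (t - s))) =
        Real.exp (-(l * (t - s))) * Real.exp (-(Λ * (t - s))) := by
      rw [← Real.exp_add]; congr 1; ring
    rw [h2]
    calc _ = Real.exp (-(l * (t - s))) *
          ((1 - p) * c / 16 * w * Real.exp (-(Λ * (t - s))) * h s ^ (-p)) := by ring
      _ ≤ _ := by
          simp only [hψ']
          exact mul_le_mul_of_nonneg_left h1 (Real.exp_pos _).le
  have hψ0 : ∀ s ∈ Ioo a b, 0 ≤ ψ' s := fun s hs => by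
    refine le_trans ?_ (hF s hs)
    have := hh s hs
    have : 0 < 1 - p := by linarith
    positivity
  -- The derivative may blow up where the arch touches the boundary; its sign and the continuity of
  -- the potential still give integrability.
  have hint := intervalIntegral.integrableOn_deriv_of_nonneg hψc hψd hψ0
  have hftc := intervalIntegral.integral_eq_sub_of_hasDerivAt_of_le hab hψc hψd
    ((intervalIntegrable_iff_integrableOn_Ioc_of_le hab).2 hint)
  rw [intervalIntegral.integral_of_le hab, integral_Ioc_eq_integral_Ioo] at hftc
  change _ ≤ ENNReal.ofReal (ψ b - ψ a) ∧ ψ a ≤ ψ b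
  refine ⟨?_, by linarith [setIntegral_nonneg (μ := volume) measurableSet_Ioo hψ0]⟩
  rw [← hftc, ofReal_integral_eq_lintegral_ofReal (hint.mono_set Ioo_subset_Ioc_self)
    ((ae_restrict_iff' measurableSet_Ioo).2 (Filter.Eventually.of_forall hψ0))]
  exact setLIntegral_mono' measurableSet_Ioo fun s hs => ENNReal.ofReal_le_ofReal (hF s hs)

end Arch

end SpecularBoltzmann

namespace SpecularBoltzmann

/-! ### Specular cycles -/

theorem bracket_le_of_norm_le {v w : R3} {d : ℝ} (hd : 0 ≤ d) (h : ‖w‖ ≤ ‖v‖ + d) :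
    bracket w ≤ (1 + d) * bracket v := by
  have hb := one_le_bracket v
  have hn := norm_le_bracket v
  have h1 : bracket w ≤ bracket v + d := by
    refine (abs_le_of_sq_le_sq' ?_ (by linarith)).2
    have h2 : ‖w‖ ^ 2 ≤ (‖v‖ + d) ^ 2 := by gcongr
    have h3 : ‖v‖ * d ≤ bracket v * d := by gcongr
    have h4 := bracket_sq v
    rw [bracket_sq]
    nlinarith
  nlinarith

theorem norm_reflect (ξ : R3 → ℝ) (x v : R3) : ‖reflect ξ x v‖ = ‖v‖ := by
  have hN : ‖normal ξ x‖ = 1 ∨ normal ξ x = 0 := by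
    unfold normal
    -- A vanishing gradient gives normal 0, and the reflection is then the identity.
    rcases eq_or_ne (gradient ξ x) 0 with h | h
    · right; rw [h, smul_zero]
    · left
      rw [norm_smul, norm_inv, norm_norm, inv_mul_cancel₀ (norm_ne_zero_iff.2 h)]
  have h2 : ‖reflect ξ x v‖ ^ 2 = ‖v‖ ^ 2 := by
    unfold reflect
    rw [norm_sub_sq_real, real_inner_smul_right, norm_smul, mul_pow, Real.norm_eq_abs, sq_abs,
      real_inner_comm (normal ξ x) v]
    rcases hN with h | h
    · rw [h]; ring
    · rw [h]; simp
  exact (sq_eq_sq₀ (norm_nonneg _) (norm_nonneg _)).1 h2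

theorem fderiv_reflect (ξ : R3 → ℝ) (x v : R3) :
    fderiv ℝ ξ x (reflect ξ x v) = -fderiv ℝ ξ x v := by
  rw [← inner_gradient, ← inner_gradient]
  unfold reflect normal
  rcases eq_or_ne (gradient ξ x) 0 with h | h
  · simp [h]
  · have hg : ‖gradient ξ x‖ ≠ 0 := norm_ne_zero_iff.2 h
    rw [inner_sub_left, real_inner_smul_left, real_inner_smul_left, real_inner_smul_left,
      real_inner_self_eq_norm_sq, real_inner_comm v]
    field_simp
    ring

section Cycles

variable {ξ : R3 → ℝ} {T A m : ℝ} {E : ℝ → R3 → R3}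

/-- Right after the time `a` the trajectory is in ξ < 0, so ξ∘X cannot increase from 0. -/
theorem IsCharacteristic.normal_nonpos (hξ : IsDefiningFunction ξ) {t a : ℝ} {x v : R3}
    {X V : ℝ → R3} (h : IsCharacteristic ξ E t x v a X V) (hat : a < t) (h0 : ξ (X a) = 0) :
    fderiv ℝ ξ (X a) (V a) ≤ 0 := by
  have h1 := (h.2.2.1 a (left_mem_Icc.2 hat.le)).1
  have h2 : HasDerivWithinAt (fun s => ξ (X s)) (fderiv ℝ ξ (X a) (V a)) (Icc a t) a :=
    ((hξ.contDiff.differentiable (by norm_num)) (X a)).hasFDerivAt.comp_hasDerivWithinAt a h1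
  have h3 : HasDerivWithinAt (fun s => ξ (X s)) (fderiv ℝ ξ (X a) (V a)) (Ioi a) a :=
    h2.mono_of_mem_nhdsWithin (Icc_mem_nhdsGT hat)
  rw [hasDerivWithinAt_iff_tendsto_slope' (by simp)] at h3
  refine le_of_tendsto h3 ?_
  filter_upwards [Ioo_mem_nhdsGT hat] with s hs
  have h4 : ξ (X s) < 0 := h.2.2.2 s hs
  rw [slope_def_field, h0]
  exact div_nonpos_of_nonpos_of_nonneg (by linarith) (by linarith [hs.1])

/-- The value of the arch potential at a phase point. -/
noncomputable def phasePotential (ξ : R3 → ℝ) (p c K M w l t : ℝ) (s : ℝ) (x v : R3) : ℝ :=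
  archPotential p c K M w l (t - s) (-ξ x) (fderiv ℝ ξ x v)

/-- The power of the depth vanishes on the boundary, so the potential there ignores the velocity.
This makes the arch increments telescope across reflections. -/
theorem phasePotential_congr {p c K M w l t s : ℝ} {x v v' : R3} (hp : p < 1) (hx : ξ x = 0) :
    phasePotential ξ p c K M w l t s x v = phasePotential ξ p c K M w l t s x v' := by
  unfold phasePotential archPotential
  rw [hx, neg_zero, cutPow_zero hp, zero_mul, zero_mul]

/-- The arch estimate along a characteristic. -/
theorem IsCharacteristic.lintegral_arch_le (hξ : IsDefiningFunction ξ)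
    (hB : FieldBounds ξ T E A m) {p c M w l b t t₁ a : ℝ} (hp0 : 0 ≤ p) (hp : p < 1) (hc : 0 < c)
    (hc1 : c ≤ 1) (hM : 0 < M) (hw : 0 < w) (hl : 0 < l) (ha : 0 ≤ a) (hat : a ≤ t₁) (h1t : t₁ ≤ t)
    (htT : t ≤ T) {x v : R3} (hx : x ∈ closure (domain ξ)) {X V : ℝ → R3}
    (h : IsCharacteristic ξ E t₁ x v a X V) (hb0 : 0 ≤ b) (hb : ∀ s ∈ Icc a t₁, bracket (V s) ≤ b)
    (hkin : c * w ^ 2 * Real.exp (-(9 * A ^ 3 / m * b * (t - t₁))) ≤ kinetic ξ E A t₁ x v) :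
    ∫⁻ s in Ioo a t₁, ENNReal.ofReal ((1 - p) * c / 16 * w *
      Real.exp (-((l + 9 * A ^ 3 / m * b) * (t - s))) * (-ξ (X s)) ^ (-p)) ≤
      ENNReal.ofReal (phasePotential ξ p c (4 * A ^ 2 * b ^ 2) M w l t t₁ x v -
        phasePotential ξ p c (4 * A ^ 2 * b ^ 2) M w l t a (X a) (V a)) ∧
    phasePotential ξ p c (4 * A ^ 2 * b ^ 2) M w l t a (X a) (V a) ≤
      phasePotential ξ p c (4 * A ^ 2 * b ^ 2) M w l t t₁ x v := by
  have hA := hB.one_le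
  have hm := hB.m_pos
  have h1 := SpecularBoltzmann.lintegral_arch_le (p := p) (c := c) (K := 4 * A ^ 2 * b ^ 2) (M := M)
    (w := w) (l := l) hp0 hp hc hc1 (by positivity) hM hw hl (Λ := 9 * A ^ 3 / m * b) (t := t)
    (a := a) (b := t₁) (by positivity) hat h1t (h := fun s => -ξ (X s))
    (n := fun s => fderiv ℝ ξ (X s) (V s)) (D := fun s => normalAccel ξ E s (X s) (V s))
    (hξ.contDiff.continuous.comp_continuousOn h.continuousOn.1).neg (h.continuousOn_normal hξ)
    (fun s hs => by linarith [hξ.mem_closure_iff.1 (h.mem_closure hx s hs)])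
    (fun s hs => neg_pos.2 (h.2.2.2 s hs)) (fun s hs => (h.hasDerivAt_depth hξ hs).neg)
    (fun s hs => h.hasDerivAt_normal hξ hs) (fun s hs => ?_) (fun s hs => ?_)
  · unfold phasePotential
    simp only [h.1, h.2.1] at h1
    exact h1
  · have hsT : s ∈ Icc 0 T := ⟨ha.trans hs.1.le, hs.2.le.trans (h1t.trans htT)⟩
    have h2 := abs_normalAccel_le hB hsT (subset_closure (h.2.2.2 s hs)) (V s)
    have h3 := bracket_pos (V s)
    have h4 := hb s (Ioo_subset_Icc_self hs)
    calc _ ≤ A ^ 2 * bracket (V s) ^ 2 := h2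
      _ ≤ A ^ 2 * b ^ 2 := by gcongr
      _ ≤ _ := by nlinarith [mul_nonneg (sq_nonneg A) (sq_nonneg b)]
  · have hsT : s ∈ Icc 0 T := ⟨ha.trans hs.1.le, hs.2.le.trans (h1t.trans htT)⟩
    have hXc := subset_closure (h.2.2.2 s hs)
    have h2 := h.kinetic_le_exp hξ hB ha (h1t.trans htT) hx hb (Ioo_subset_Icc_self hs)
    have h3 := kinetic_le hB hξ hsT hXc (V s)
    have h4 := hb s (Ioo_subset_Icc_self hs)
    have h5 : 0 < -ξ (X s) := neg_pos.2 (h.2.2.2 s hs)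
    have h6 : 4 * A ^ 2 * bracket (V s) ^ 2 * (-ξ (X s)) ≤ 4 * A ^ 2 * b ^ 2 * (-ξ (X s)) := by
      have := bracket_pos (V s)
      gcongr
    have h7 : Real.exp (-(9 * A ^ 3 / m * b * (t - s))) =
        Real.exp (-(9 * A ^ 3 / m * b * (t₁ - s))) * Real.exp (-(9 * A ^ 3 / m * b * (t - t₁))) := by
      rw [← Real.exp_add]; congr 1; ring
    calc _ = Real.exp (-(9 * A ^ 3 / m * b * (t₁ - s))) *
          (c * w ^ 2 * Real.exp (-(9 * A ^ 3 / m * b * (t - t₁)))) := by rw [h7]; ring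
      _ ≤ Real.exp (-(9 * A ^ 3 / m * b * (t₁ - s))) * kinetic ξ E A t₁ x v := by gcongr
      _ ≤ _ := by linarith

variable {t : ℝ} {x v : R3}

/-! ### Invariants of the cycles, finiteness of bounces and summation over arches. -/

theorem cycle_succ (ξ : R3 → ℝ) (E : ℝ → R3 → R3) (t : ℝ) (x v : R3) (ℓ : ℕ) :
    cycle ξ E t x v (ℓ + 1) =
      let z := cycle ξ E t x v ℓ
      let a := z.1 - exitTime ξ E z.1 z.2.1 z.2.2
      let y := charX ξ E z.1 z.2.1 z.2.2 a
      (a, y, reflect ξ y (charV ξ E z.1 z.2.1 z.2.2 a)) := rfl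

/-- What is preserved along the specular cycles issued from `(t, x, v)`. -/
structure CycleInvariant (ξ : R3 → ℝ) (E : ℝ → R3 → R3) (A m b t : ℝ) (x v : R3)
    (z : ℝ × R3 × R3) : Prop where
  mem : z.1 ∈ Icc 0 t
  mem_closure : z.2.1 ∈ closure (domain ξ)
  speed : |‖z.2.2‖ - ‖v‖| ≤ A * (t - z.1)
  kinetic_ge : 0 < z.1 → Real.exp (-(9 * A ^ 3 / m * b * (t - z.1))) * kinetic ξ E A t x v ≤
    kinetic ξ E A z.1 z.2.1 z.2.2
  position : 0 < z.1 → z.2.1 ∈ domain ξ ∨ (ξ z.2.1 = 0 ∧ 0 < fderiv ℝ ξ z.2.1 z.2.2)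

theorem CycleInvariant.exit_pos (hξ : IsDefiningFunction ξ) (hB : FieldBounds ξ T E A m)
    (htT : t ≤ T) {b : ℝ} {z : ℝ × R3 × R3} (hz : CycleInvariant ξ E A m b t x v z)
    (h0 : 0 < z.1) : 0 < exitTime ξ E z.1 z.2.1 z.2.2 := by
  obtain ⟨h1, h2, h3, h4⟩ := charPair_spec hξ hB ⟨hz.mem.1, hz.mem.2.trans htT⟩ hz.mem_closure z.2.2
  rcases hz.position h0 with h | h
  · refine lt_of_le_of_ne h1.1 fun he => ?_
    rw [← he, sub_zero] at h2 h3
    rcases h3 with h3 | h3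
    · linarith
    · rw [h2.1] at h3
      exact absurd h3 (ne_of_lt h)
  · exact h4 h0 h.1 h.2

theorem CycleInvariant.bracket_le (hB : FieldBounds ξ T E A m) (htT : t ≤ T) (hξ : IsDefiningFunction ξ)
    {b : ℝ} {z : ℝ × R3 × R3} (hz : CycleInvariant ξ E A m b t x v z) {s : ℝ}
    (hs : s ∈ Icc (z.1 - exitTime ξ E z.1 z.2.1 z.2.2) z.1) :
    |‖charV ξ E z.1 z.2.1 z.2.2 s‖ - ‖v‖| ≤ A * (t - s) ∧
    bracket (charV ξ E z.1 z.2.1 z.2.2 s) ≤ (1 + A * T) * bracket v ∧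
    bracket v ≤ (1 + A * T) * bracket (charV ξ E z.1 z.2.1 z.2.2 s) := by
  obtain ⟨h1, h2, h3, h4⟩ := charPair_spec hξ hB ⟨hz.mem.1, hz.mem.2.trans htT⟩ hz.mem_closure z.2.2
  have h5 := h2.norm_sub_le hB (by linarith [h1.2]) (hz.mem.2.trans htT) hz.mem_closure hs
  have h6 := (abs_norm_sub_norm_le (charV ξ E z.1 z.2.1 z.2.2 s) z.2.2).trans h5
  have h7 := hz.speed
  have hA := hB.one_le
  have h0s : 0 ≤ s := le_trans (by linarith [h1.2]) hs.1
  have h8 : |‖charV ξ E z.1 z.2.1 z.2.2 s‖ - ‖v‖| ≤ A * (t - s) := by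
    have := abs_sub_le ‖charV ξ E z.1 z.2.1 z.2.2 s‖ ‖z.2.2‖ ‖v‖
    linarith
  have h9 : A * (t - s) ≤ A * T := by gcongr; linarith
  have hT : 0 ≤ A * T := mul_nonneg (by linarith) (h0s.trans (hs.2.trans (hz.mem.2.trans htT)))
  obtain ⟨g1, g2⟩ := abs_le.1 h8
  exact ⟨h8, bracket_le_of_norm_le hT (by linarith), bracket_le_of_norm_le hT (by linarith)⟩

theorem kinetic_pos (hξ : IsDefiningFunction ξ) (hB : FieldBounds ξ T E A m) (ht : t ∈ Icc 0 T)
    (hx : x ∈ domain ξ) : 0 < kinetic ξ E A t x v := by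
  refine lt_of_lt_of_le ?_ (kinetic_ge hB hξ ht (subset_closure hx) v)
  have h1 : 0 < -ξ x := neg_pos.2 hx
  have := hB.m_pos
  have := bracket_pos v
  positivity

theorem kinetic_of_boundary {s : ℝ} {y u : R3} (h : ξ y = 0) :
    kinetic ξ E A s y u = (fderiv ℝ ξ y u) ^ 2 := by
  unfold kinetic; rw [h]; ring

variable (hξ : IsDefiningFunction ξ) (hB : FieldBounds ξ T E A m) (ht : t ∈ Icc 0 T)
  (hx : x ∈ domain ξ)

include hξ hB ht hx

/-- Grazing is impossible: on the boundary the functional equals n², and the velocity lemma keeps it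
positive. -/
theorem CycleInvariant.exit_spec {z : ℝ × R3 × R3}
    (hz : CycleInvariant ξ E A m ((1 + A * T) * bracket v) t x v z)
    (h0 : 0 < z.1 - exitTime ξ E z.1 z.2.1 z.2.2) :
    ξ (charX ξ E z.1 z.2.1 z.2.2 (z.1 - exitTime ξ E z.1 z.2.1 z.2.2)) = 0 ∧
    fderiv ℝ ξ (charX ξ E z.1 z.2.1 z.2.2 (z.1 - exitTime ξ E z.1 z.2.1 z.2.2))
      (charV ξ E z.1 z.2.1 z.2.2 (z.1 - exitTime ξ E z.1 z.2.1 z.2.2)) < 0 ∧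
    Real.exp (-(9 * A ^ 3 / m * ((1 + A * T) * bracket v) *
      (t - (z.1 - exitTime ξ E z.1 z.2.1 z.2.2)))) * kinetic ξ E A t x v ≤
    (fderiv ℝ ξ (charX ξ E z.1 z.2.1 z.2.2 (z.1 - exitTime ξ E z.1 z.2.1 z.2.2))
      (charV ξ E z.1 z.2.1 z.2.2 (z.1 - exitTime ξ E z.1 z.2.1 z.2.2))) ^ 2 := by
  have hz0 := (charPair_spec hξ hB ⟨hz.mem.1, hz.mem.2.trans ht.2⟩ hz.mem_closure z.2.2)
  obtain ⟨h1, h2, h3, h4⟩ := hz0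
  have hzp : 0 < z.1 := lt_of_lt_of_le h0 (by linarith [h1.1])
  have he := hz.exit_pos hξ hB ht.2 hzp
  have hbd := h3.resolve_left h0.ne'
  set a := z.1 - exitTime ξ E z.1 z.2.1 z.2.2 with ha
  have haz : a < z.1 := by linarith
  have h5 := h2.normal_nonpos hξ haz hbd
  have h6 := h2.kinetic_le_exp hξ hB h0.le (hz.mem.2.trans ht.2) hz.mem_closure
    (fun s hs => (hz.bracket_le hB ht.2 hξ hs).2.1) (left_mem_Icc.2 haz.le)
  rw [kinetic_of_boundary hbd] at h6
  have h7 := hz.kinetic_ge hzp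
  set Λ := 9 * A ^ 3 / m * ((1 + A * T) * bracket v) with hΛ
  have h8 : Real.exp (-(Λ * (t - a))) =
      Real.exp (-(Λ * (z.1 - a))) * Real.exp (-(Λ * (t - z.1))) := by
    rw [← Real.exp_add]; congr 1; ring
  have h9 : Real.exp (-(Λ * (t - a))) * kinetic ξ E A t x v ≤
      (fderiv ℝ ξ (charX ξ E z.1 z.2.1 z.2.2 a) (charV ξ E z.1 z.2.1 z.2.2 a)) ^ 2 := by
    rw [h8, mul_assoc]
    exact (mul_le_mul_of_nonneg_left h7 (Real.exp_pos _).le).trans h6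
  refine ⟨hbd, lt_of_le_of_ne h5 fun h => ?_, h9⟩
  rw [h] at h9
  have := mul_pos (Real.exp_pos (-(Λ * (t - a)))) (kinetic_pos (v := v) hξ hB ht hx)
  linarith

theorem cycleInvariant (ℓ : ℕ) :
    CycleInvariant ξ E A m ((1 + A * T) * bracket v) t x v (cycle ξ E t x v ℓ) := by
  induction ℓ with
  | zero =>
    refine ⟨⟨ht.1, le_rfl⟩, subset_closure hx, ?_, fun _ => ?_, fun _ => Or.inl hx⟩
    · simp [cycle]
    · simp [cycle]
  | succ ℓ ih =>
    rw [cycle_succ]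
    set z := cycle ξ E t x v ℓ
    obtain ⟨h1, h2, h3, h4⟩ := charPair_spec hξ hB ⟨ih.mem.1, ih.mem.2.trans ht.2⟩
      ih.mem_closure z.2.2
    have hmem : z.1 - exitTime ξ E z.1 z.2.1 z.2.2 ∈
        Icc (z.1 - exitTime ξ E z.1 z.2.1 z.2.2) z.1 := ⟨le_rfl, by linarith [h1.1]⟩
    refine ⟨⟨by linarith [h1.2], by linarith [h1.1, ih.mem.2]⟩,
      h2.mem_closure ih.mem_closure _ hmem, ?_, fun h0 => ?_, fun h0 => ?_⟩
    · simp only [norm_reflect]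
      exact (ih.bracket_le hB ht.2 hξ hmem).1
    · obtain ⟨g1, g2, g3⟩ := ih.exit_spec hξ hB ht hx h0
      simp only
      rw [kinetic_of_boundary g1, fderiv_reflect, neg_sq]
      exact g3
    · obtain ⟨g1, g2, g3⟩ := ih.exit_spec hξ hB ht hx h0
      right
      simp only
      rw [fderiv_reflect]
      exact ⟨g1, by linarith⟩

theorem cycle_succ_mem (ℓ : ℕ) : (cycle ξ E t x v (ℓ + 1)).1 ∈ Icc 0 (cycle ξ E t x v ℓ).1 := by
  have ih := cycleInvariant (v := v) hξ hB ht hx ℓ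
  obtain ⟨h1, -⟩ := charPair_spec hξ hB ⟨ih.mem.1, ih.mem.2.trans ht.2⟩
    ih.mem_closure (cycle ξ E t x v ℓ).2.2
  rw [cycle_succ]
  exact ⟨by linarith [h1.2], by linarith [h1.1]⟩

theorem cycle_antitone : Antitone fun ℓ => (cycle ξ E t x v ℓ).1 :=
  antitone_nat_of_succ_le fun ℓ => (cycle_succ_mem hξ hB ht hx ℓ).2

/-- The cycles reach time zero after finitely many bounces. -/
theorem exists_cycle_eq_zero : ∃ N, (cycle ξ E t x v N).1 = 0 := by
  by_contra! hne
  have hA := hB.one_le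
  have hm := hB.m_pos
  have hb := bracket_pos v
  have hT0 : 0 ≤ T := ht.1.trans ht.2
  have hpos : ∀ ℓ, 0 < (cycle ξ E t x v ℓ).1 := fun ℓ =>
    lt_of_le_of_ne (cycleInvariant (v := v) hξ hB ht hx ℓ).mem.1 (hne ℓ).symm
  set b := (1 + A * T) * bracket v with hbdef
  have hbp : 0 < b := by positivity
  have hW := kinetic_pos (v := v) hξ hB ht hx
  set W0 := Real.exp (-(9 * A ^ 3 / m * b * T)) * kinetic ξ E A t x v with hW0
  have hW0p : 0 < W0 := mul_pos (Real.exp_pos _) hW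
  -- A lower bound for the flight time between bounces. Over an arch n passes from a negative value
  -- to at least √W0, at rate at most A²b².
  set η := Real.sqrt W0 / (A ^ 2 * b ^ 2) with hη
  have hη0 : 0 < η := by positivity
  have key : ∀ ℓ, (cycle ξ E t x v (ℓ + 2)).1 ≤ (cycle ξ E t x v (ℓ + 1)).1 - η := by
    intro ℓ
    have hz := cycleInvariant (v := v) hξ hB ht hx (ℓ + 1)
    have hz0 := cycleInvariant (v := v) hξ hB ht hx ℓ
    have hp := hpos (ℓ + 2)
    have hp1 := hpos (ℓ + 1)
    have hn1 : Real.sqrt W0 ≤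
        fderiv ℝ ξ (cycle ξ E t x v (ℓ + 1)).2.1 (cycle ξ E t x v (ℓ + 1)).2.2 := by
      rw [cycle_succ] at hp1
      obtain ⟨g1, g2, g3⟩ := hz0.exit_spec hξ hB ht hx hp1
      have hk := hz.kinetic_ge (hpos (ℓ + 1))
      have hbd : ξ (cycle ξ E t x v (ℓ + 1)).2.1 = 0 := g1
      have hnp : 0 < fderiv ℝ ξ (cycle ξ E t x v (ℓ + 1)).2.1 (cycle ξ E t x v (ℓ + 1)).2.2 := by
        rcases hz.position (hpos (ℓ + 1)) with h | h
        · exact absurd hbd (ne_of_lt h)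
        · exact h.2
      rw [kinetic_of_boundary hbd] at hk
      rw [Real.sqrt_le_left hnp.le]
      refine le_trans ?_ hk
      rw [hW0]
      apply mul_le_mul_of_nonneg_right _ hW.le
      apply Real.exp_le_exp.2
      have h1 : t - (cycle ξ E t x v (ℓ + 1)).1 ≤ T := by linarith [ht.2, hpos (ℓ + 1)]
      have h2 : 9 * A ^ 3 / m * b * (t - (cycle ξ E t x v (ℓ + 1)).1) ≤ 9 * A ^ 3 / m * b * T := by
        gcongr
      linarith
    have he := hz.exit_pos hξ hB ht.2 (hpos (ℓ + 1))
    obtain ⟨h1, h2, -, -⟩ := charPair_spec hξ hB ⟨hz.mem.1, hz.mem.2.trans ht.2⟩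
      hz.mem_closure (cycle ξ E t x v (ℓ + 1)).2.2
    rw [cycle_succ] at hp
    obtain ⟨g1, g2, g3⟩ := hz.exit_spec hξ hB ht hx hp
    rw [show ℓ + 2 = (ℓ + 1) + 1 from rfl, cycle_succ]
    set z := cycle ξ E t x v (ℓ + 1)
    set a := z.1 - exitTime ξ E z.1 z.2.1 z.2.2 with ha
    have haz : a ≤ z.1 := by linarith
    have hmv := (convex_Icc a z.1).image_sub_le_mul_sub_of_deriv_le (C := A ^ 2 * b ^ 2)
      (h2.continuousOn_normal hξ) (by
        rw [interior_Icc]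
        exact fun s hs => (h2.hasDerivAt_normal hξ hs).differentiableAt.differentiableWithinAt) (by
        rw [interior_Icc]
        intro s hs
        rw [(h2.hasDerivAt_normal hξ hs).deriv]
        have hsT : s ∈ Icc 0 T := ⟨hp.le.trans hs.1.le, hs.2.le.trans (hz.mem.2.trans ht.2)⟩
        refine (le_abs_self _).trans ((abs_normalAccel_le hB hsT
          (subset_closure (h2.2.2.2 s hs)) _).trans ?_)
        have := (hz.bracket_le hB ht.2 hξ (Ioo_subset_Icc_self hs)).2.1
        have := bracket_pos (charV ξ E z.1 z.2.1 z.2.2 s)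
        gcongr) a (left_mem_Icc.2 haz) z.1 (right_mem_Icc.2 haz) haz
    rw [h2.1, h2.2.1] at hmv
    have hAb : 0 < A ^ 2 * b ^ 2 := by positivity
    have : η ≤ z.1 - a := by
      rw [hη, div_le_iff₀ hAb]
      linarith
    simp only
    linarith
  have hlin : ∀ ℓ : ℕ, (cycle ξ E t x v (ℓ + 1)).1 ≤ t - ℓ * η := by
    intro ℓ
    induction ℓ with
    | zero =>
      have := (cycleInvariant (v := v) hξ hB ht hx (0 + 1)).mem.2
      simpa using this
    | succ ℓ ih =>
      have := key ℓ
      push_cast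
      linarith
  obtain ⟨N, hN⟩ := exists_nat_gt (t / η)
  rw [div_lt_iff₀ hη0] at hN
  have := hlin N
  have := hpos (N + 1)
  linarith

theorem cycleX_eq {ℓ : ℕ} {s : ℝ} (hs : s ∈ Ico (cycle ξ E t x v (ℓ + 1)).1 (cycle ξ E t x v ℓ).1) :
    cycleX ξ E t x v s = charX ξ E (cycle ξ E t x v ℓ).1 (cycle ξ E t x v ℓ).2.1
      (cycle ξ E t x v ℓ).2.2 s ∧
    cycleV ξ E t x v s = charV ξ E (cycle ξ E t x v ℓ).1 (cycle ξ E t x v ℓ).2.1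
      (cycle ξ E t x v ℓ).2.2 s := by
  have hanti := cycle_antitone (v := v) hξ hB ht hx
  have hnot : ∀ k, k ≠ ℓ → s ∉ Ico (cycle ξ E t x v (k + 1)).1 (cycle ξ E t x v k).1 := by
    intro k hk hsk
    rcases lt_or_gt_of_ne hk with h | h
    · have h1 : (cycle ξ E t x v ℓ).1 ≤ (cycle ξ E t x v (k + 1)).1 := hanti (by omega : k + 1 ≤ ℓ)
      linarith [hs.2, hsk.1]
    · have h1 : (cycle ξ E t x v k).1 ≤ (cycle ξ E t x v (ℓ + 1)).1 := hanti (by omega : ℓ + 1 ≤ k)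
      linarith [hs.1, hsk.2]
  constructor
  · unfold cycleX
    rw [tsum_eq_single ℓ fun k hk => indicator_of_notMem (hnot k hk) _, indicator_of_mem hs]
  · unfold cycleV
    rw [tsum_eq_single ℓ fun k hk => indicator_of_notMem (hnot k hk) _, indicator_of_mem hs]

theorem exists_cycle_interval {s : ℝ} (hs : s ∈ Ico 0 t) :
    ∃ ℓ, s ∈ Ico (cycle ξ E t x v (ℓ + 1)).1 (cycle ξ E t x v ℓ).1 := by
  obtain ⟨N, hN⟩ := exists_cycle_eq_zero (v := v) hξ hB ht hx
  have hex : ∃ k, (cycle ξ E t x v k).1 ≤ s := ⟨N, hN.le.trans hs.1⟩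
  classical
  set k := Nat.find hex with hk
  have h1 : (cycle ξ E t x v k).1 ≤ s := Nat.find_spec hex
  have h0 : k ≠ 0 := by
    intro h
    rw [h] at h1
    exact absurd h1 (not_le.2 hs.2)
  obtain ⟨j, hj⟩ := Nat.exists_eq_succ_of_ne_zero h0
  refine ⟨j, ?_, ?_⟩
  · rw [hj] at h1; exact h1
  · exact not_le.1 (Nat.find_min hex (by omega : j < k))

/-- For almost every time, the cycle is in the domain and its speed is comparable to `|v|`. -/
theorem ae_cycle_mem : ∀ᵐ s : ℝ, s ∈ Ico 0 t → cycleX ξ E t x v s ∈ domain ξ ∧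
    bracket (cycleV ξ E t x v s) ≤ (1 + A * T) * bracket v ∧
    bracket v ≤ (1 + A * T) * bracket (cycleV ξ E t x v s) := by
  have hcount : (range fun ℓ => (cycle ξ E t x v ℓ).1).Countable := countable_range _
  filter_upwards [hcount.ae_notMem volume] with s hsn hs
  obtain ⟨ℓ, hℓ⟩ := exists_cycle_interval (v := v) hξ hB ht hx hs
  obtain ⟨e1, e2⟩ := cycleX_eq hξ hB ht hx hℓ
  rw [e1, e2]
  have hz := cycleInvariant (v := v) hξ hB ht hx ℓ
  obtain ⟨h1, h2, -, -⟩ := charPair_spec hξ hB ⟨hz.mem.1, hz.mem.2.trans ht.2⟩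
    hz.mem_closure (cycle ξ E t x v ℓ).2.2
  have hne : (cycle ξ E t x v (ℓ + 1)).1 ≠ s := fun h => hsn ⟨ℓ + 1, h⟩
  have hlt : (cycle ξ E t x v (ℓ + 1)).1 < s := lt_of_le_of_ne hℓ.1 hne
  exact ⟨h2.2.2.2 s ⟨hlt, hℓ.2⟩, (hz.bracket_le hB ht.2 hξ ⟨hlt.le, hℓ.2.le⟩).2⟩

/-- The singular integral along the specular cycles. -/
theorem lintegral_cycle_le {p c M w l : ℝ} (hp0 : 0 ≤ p) (hp : p < 1) (hc : 0 < c) (hc1 : c ≤ 1)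
    (hM : 0 < M) (hw : 0 < w) (hl : 0 < l) (hkin : c * w ^ 2 ≤ kinetic ξ E A t x v) :
    ∫⁻ s in Ico 0 t, ENNReal.ofReal ((1 - p) * c / 16 * w *
      Real.exp (-((l + 9 * A ^ 3 / m * ((1 + A * T) * bracket v)) * (t - s))) *
        (-ξ (cycleX ξ E t x v s)) ^ (-p)) ≤
      ENNReal.ofReal (2 * archConst p c (4 * A ^ 2 * ((1 + A * T) * bracket v) ^ 2) M w l) := by
  have hA := hB.one_le
  have hm := hB.m_pos
  have hbv := bracket_pos v
  have hT0 : 0 ≤ T := ht.1.trans ht.2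
  set b := (1 + A * T) * bracket v with hb
  have hbp : 0 < b := by positivity
  set F : ℝ → ℝ≥0∞ := fun s => ENNReal.ofReal ((1 - p) * c / 16 * w *
    Real.exp (-((l + 9 * A ^ 3 / m * b) * (t - s))) * (-ξ (cycleX ξ E t x v s)) ^ (-p)) with hF
  set P : ℕ → ℝ := fun ℓ => phasePotential ξ p c (4 * A ^ 2 * b ^ 2) M w l t
    (cycle ξ E t x v ℓ).1 (cycle ξ E t x v ℓ).2.1 (cycle ξ E t x v ℓ).2.2 with hP
  have hcl0 : ∀ {y : R3}, y ∈ closure (domain ξ) → 0 ≤ -ξ y := fun hy => by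
    linarith [hξ.mem_closure_iff.1 hy]
  have hP0 : ∀ ℓ, 0 ≤ P ℓ := fun ℓ => archPotential_nonneg hp hc (by positivity) hM hw hl
    (hcl0 (cycleInvariant (v := v) hξ hB ht hx ℓ).mem_closure)
  have hPtop : P 0 ≤ 2 * archConst p c (4 * A ^ 2 * b ^ 2) M w l :=
    archPotential_le hp hc (by positivity) hM hw hl
      (by linarith [(cycleInvariant (v := v) hξ hB ht hx 0).mem.2])
      (hcl0 (cycleInvariant (v := v) hξ hB ht hx 0).mem_closure)
  -- At time 0 the trajectory is usually interior, and the reflection built into the cycle would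
  -- change the potential there. Its value is dropped instead, which nonnegativity permits.
  set Q : ℕ → ℝ := fun ℓ => if (cycle ξ E t x v ℓ).1 = 0 then 0 else P ℓ with hQ
  have hQ0 : ∀ ℓ, 0 ≤ Q ℓ := fun ℓ => by
    simp only [hQ]; split_ifs <;> [exact le_rfl; exact hP0 ℓ]
  have hstep : ∀ ℓ, 0 < (cycle ξ E t x v ℓ).1 →
      ∫⁻ s in Ioo (cycle ξ E t x v (ℓ + 1)).1 (cycle ξ E t x v ℓ).1, F s ≤
        ENNReal.ofReal (P ℓ - Q (ℓ + 1)) ∧ Q (ℓ + 1) ≤ P ℓ := by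
    intro ℓ h0
    have hz := cycleInvariant (v := v) hξ hB ht hx ℓ
    obtain ⟨h1, h2, -, -⟩ := charPair_spec hξ hB ⟨hz.mem.1, hz.mem.2.trans ht.2⟩
      hz.mem_closure (cycle ξ E t x v ℓ).2.2
    have hs1 := cycle_succ_mem (v := v) hξ hB ht hx ℓ
    have hk : c * w ^ 2 * Real.exp (-(9 * A ^ 3 / m * b * (t - (cycle ξ E t x v ℓ).1))) ≤
        kinetic ξ E A (cycle ξ E t x v ℓ).1 (cycle ξ E t x v ℓ).2.1 (cycle ξ E t x v ℓ).2.2 := by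
      refine le_trans ?_ (hz.kinetic_ge h0)
      rw [mul_comm]
      exact mul_le_mul_of_nonneg_left hkin (Real.exp_pos _).le
    have h3 := h2.lintegral_arch_le hξ hB hp0 hp hc hc1 hM hw hl (t := t) (b := b)
      (by linarith [h1.2]) (by linarith [h1.1]) hz.mem.2 ht.2 hz.mem_closure hbp.le
      (fun s hs => (hz.bracket_le hB ht.2 hξ hs).2.1) hk
    have h4 : Q (ℓ + 1) ≤ phasePotential ξ p c (4 * A ^ 2 * b ^ 2) M w l t
        (cycle ξ E t x v (ℓ + 1)).1 (cycle ξ E t x v (ℓ + 1)).2.1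
        (charV ξ E (cycle ξ E t x v ℓ).1 (cycle ξ E t x v ℓ).2.1 (cycle ξ E t x v ℓ).2.2
          (cycle ξ E t x v (ℓ + 1)).1) := by
      simp only [hQ]
      split_ifs with h
      · exact archPotential_nonneg hp hc (by positivity) hM hw hl
          (hcl0 (h2.mem_closure hz.mem_closure _ ⟨le_rfl, by linarith [h1.1]⟩))
      · have hpos : 0 < (cycle ξ E t x v (ℓ + 1)).1 := lt_of_le_of_ne hs1.1 (Ne.symm h)
        rw [cycle_succ] at hpos
        obtain ⟨g1, -, -⟩ := hz.exit_spec hξ hB ht hx hpos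
        exact (phasePotential_congr hp g1).le
    refine ⟨?_, h4.trans h3.2⟩
    calc _ = _ := ?_
      _ ≤ _ := h3.1
      _ ≤ _ := ENNReal.ofReal_le_ofReal (sub_le_sub_left h4 _)
    refine setLIntegral_congr_fun measurableSet_Ioo fun s hs => ?_
    simp only [hF]
    rw [(cycleX_eq hξ hB ht hx (Ioo_subset_Ico_self hs)).1]
  have hind : ∀ ℓ, ∫⁻ s in Ico (cycle ξ E t x v ℓ).1 t, F s ≤ ENNReal.ofReal (P 0 - Q ℓ) ∧
      Q ℓ ≤ P 0 := by
    intro ℓ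
    induction ℓ with
    | zero =>
      refine ⟨?_, ?_⟩
      · simp [cycle]
      · simp only [hQ]; split_ifs <;> [exact hP0 0; exact le_rfl]
    | succ ℓ ih =>
      have hs1 := cycle_succ_mem (v := v) hξ hB ht hx ℓ
      rcases (cycleInvariant (v := v) hξ hB ht hx ℓ).mem.1.eq_or_lt with h0 | h0
      · have h1 : (cycle ξ E t x v (ℓ + 1)).1 = (cycle ξ E t x v ℓ).1 :=
          le_antisymm hs1.2 (by linarith [hs1.1])
        have h2 : Q (ℓ + 1) = Q ℓ := by simp only [hQ]; rw [h1, if_pos h0.symm, if_pos h0.symm]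
        rw [h1, h2]
        exact ih
      · obtain ⟨g1, g2⟩ := hstep ℓ h0
        have hQP : Q ℓ = P ℓ := by simp only [hQ]; rw [if_neg h0.ne']
        have hmt := (cycleInvariant (v := v) hξ hB ht hx ℓ).mem.2
        refine ⟨?_, by linarith [ih.2]⟩
        rw [← Ico_union_Ico_eq_Ico hs1.2 hmt]
        refine (lintegral_union_le _ _ _).trans ?_
        rw [setLIntegral_congr Ioo_ae_eq_Ico.symm]
        refine (add_le_add g1 ih.1).trans ?_
        rw [← ENNReal.ofReal_add (by linarith) (by linarith [ih.2])]
        exact ENNReal.ofReal_le_ofReal (by linarith)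
  obtain ⟨N, hN⟩ := exists_cycle_eq_zero (v := v) hξ hB ht hx
  have h1 := (hind N).1
  rw [hN] at h1
  exact h1.trans (ENNReal.ofReal_le_ofReal (by linarith [hQ0 N]))

end Cycles

end SpecularBoltzmann

namespace SpecularBoltzmann

/-! ### The kernel along the specular cycles -/

theorem lintegral_exp_Ico_le {L t : ℝ} (hL : 0 < L) :
    ∫⁻ s in Ico 0 t, ENNReal.ofReal (Real.exp (-(L * (t - s)))) ≤ ENNReal.ofReal (1 / L) := by
  have h1 : ∀ s, Real.exp (-(L * (t - s))) = Real.exp (-(L * t)) * Real.exp (L * s) := fun s => by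
    rw [← Real.exp_add]; congr 1; ring
  have h2 : IntegrableOn (fun s => Real.exp (-(L * (t - s)))) (Iic t) := by
    simp only [h1]
    exact (integrableOn_exp_mul_Iic hL t).const_mul _
  calc _ ≤ ∫⁻ s in Iic t, ENNReal.ofReal (Real.exp (-(L * (t - s)))) :=
        lintegral_mono_set fun s hs => hs.2.le
    _ = ENNReal.ofReal (∫ s in Iic t, Real.exp (-(L * (t - s)))) :=
        (ofReal_integral_eq_lintegral_ofReal h2
          (Filter.Eventually.of_forall fun s => (Real.exp_pos _).le)).symm
    _ = _ := by
        simp only [h1]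
        rw [integral_const_mul, integral_exp_mul_Iic hL, mul_div_assoc', ← Real.exp_add]
        simp

/-- The cut depth δw²/N² is, up to δ, the one at which N² times the depth equals w²: it balances the
two sources of kinetic energy and produces the gain N^{-2} with the power w^{1-2p}. -/
theorem archConst_le {p c k N δ w l : ℝ} (hp0 : 0 ≤ p) (hp : p < 1) (hc : 0 < c) (hc1 : c ≤ 1)
    (hk : 0 ≤ k) (hN : 0 < N) (hδ : 0 < δ) (hδ1 : δ ≤ 1) (hw : 0 < w) (hl : 0 < l) :
    archConst p c (k * N ^ 2) (δ * w ^ 2 / N ^ 2) w l * N ^ (-(2 * p)) ≤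
      (2 * k + 1) * w * (δ ^ (1 - p) * w ^ (1 - 2 * p) / N ^ 2 + δ ^ (-p) * w ^ (-(2 * p)) / l) := by
  have hM : ∀ q : ℝ, (δ * w ^ 2 / N ^ 2) ^ q = δ ^ q * w ^ (2 * q) * N ^ (-(2 * q)) := fun q => by
    rw [Real.div_rpow (by positivity) (by positivity), Real.mul_rpow hδ.le (by positivity),
      ← Real.rpow_natCast, ← Real.rpow_natCast, ← Real.rpow_mul hw.le, ← Real.rpow_mul hN.le,
      Real.rpow_neg hN.le, div_eq_mul_inv]
    norm_num
  have e1 : w ^ (2 * (1 - p)) = w * w ^ (1 - 2 * p) := by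
    rw [← Real.rpow_one_add' hw.le (by linarith)]; congr 1; ring
  have e1' : w * w ^ (1 - 2 * p) = w ^ 2 * w ^ (-(2 * p)) := by
    rw [← e1, ← Real.rpow_natCast, ← Real.rpow_add hw]; congr 1; norm_num; ring
  have e2 : N ^ (-(2 * (1 - p))) * N ^ (-(2 * p)) = 1 / N ^ 2 := by
    rw [← Real.rpow_add hN, show -(2 * (1 - p)) + -(2 * p) = -((2 : ℕ) : ℝ) by norm_num; ring,
      Real.rpow_neg hN.le, Real.rpow_natCast, one_div]
  have e3 : N ^ (-(2 * -p)) * N ^ (-(2 * p)) = 1 := by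
    rw [← Real.rpow_add hN]; norm_num
  have e4 : w ^ (2 * -p) = w ^ (-(2 * p)) := by congr 1; ring
  have hd : δ ^ (1 - p) ≤ δ ^ (-p) := Real.rpow_le_rpow_of_exponent_ge hδ hδ1 (by linarith)
  set D := δ ^ (1 - p)
  set D' := δ ^ (-p)
  set W := w ^ (-(2 * p))
  have hD : 0 < D := Real.rpow_pos_of_pos hδ _
  have hW : 0 < W := Real.rpow_pos_of_pos hw _
  have e5 : w ^ (1 - 2 * p) = w * W := by
    have := e1'
    field_simp at this
    rw [this]
  unfold archConst
  rw [hM, hM, e1, e4, e5]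
  calc _ = D * (w * (w * W)) * (N ^ (-(2 * (1 - p))) * N ^ (-(2 * p))) +
        (2 * k * N ^ 2 * (D * (w * (w * W))) * (N ^ (-(2 * (1 - p))) * N ^ (-(2 * p))) / w +
          (1 - p) * c / 16 * w * (D' * W) * (N ^ (-(2 * -p)) * N ^ (-(2 * p)))) / l := by ring
    _ = w * (D * (w * W) / N ^ 2) + (2 * k * D + (1 - p) * c / 16 * D') * (w * (W / l)) := by
        rw [e2, e3]; field_simp
    _ ≤ (2 * k + 1) * (w * (D * (w * W) / N ^ 2)) + (2 * k * D' + 1 * D') * (w * (W / l)) := by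
        have h1 : (1 - p) * c / 16 ≤ 1 := by nlinarith
        have h2 : 0 ≤ w * (D * (w * W) / N ^ 2) := by positivity
        have h3 : 0 < D' := hD.trans_le hd
        refine add_le_add (le_mul_of_one_le_left h2 (by linarith)) ?_
        gcongr
    _ = _ := by ring

variable {ξ : R3 → ℝ} {T A m : ℝ} {E : ℝ → R3 → R3}

/-- The kernel of both estimates, integrated along the specular cycles. -/
theorem exists_lintegral_cycle_kernel_le (hξ : IsDefiningFunction ξ) (hT : 0 ≤ T)
    (hB : FieldBounds ξ T E A m) {ρ : ℝ} (hρ : 0 < ρ) {χ : ℝ → ℝ} {c : ℝ}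
    (hδ : 0 < collarDepth ξ ρ) (hχ : IsCutoff (collarDepth ξ ρ) χ c)
    {θ κ β r : ℝ} (hθ : 0 < θ) (hκ : 0 < κ) (hκ1 : κ ≤ 1) (hβ : 1 < β) (hβ3 : β < 3)
    (hr : 0 ≤ r) :
    ∃ K > (0 : ℝ), ∀ t ∈ Icc 0 T, ∀ x ∈ domain ξ, ∀ v : R3, ∀ l > (0 : ℝ), ∀ δ > (0 : ℝ), δ ≤ 1 →
      ∫⁻ s in Ico 0 t, ∫⁻ u : R3, ENNReal.ofReal (
        Real.exp (-((l + 9 * A ^ 3 / m * ((1 + A * T) * bracket v)) * (t - s))) *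
        (Real.exp (-θ * ‖cycleV ξ E t x v s - u‖ ^ 2) / ‖cycleV ξ E t x v s - u‖ ^ (2 - κ) *
          bracket u ^ r * (1 / weight ξ ρ χ c E s (cycleX ξ E t x v s) u ^ β))) ≤
      ENNReal.ofReal (K * bracket v ^ r *
        (δ ^ ((3 - β) / 2) * weight ξ ρ χ c E t x v ^ (2 - β) / bracket v ^ 2 +
          δ ^ (-((β - 1) / 2)) * weight ξ ρ χ c E t x v ^ (-(β - 1)) / l)) := by
  obtain ⟨hc, a, ha, C, hC, hw⟩ := exists_weight_bounds hξ hB hρ hδ hχ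
  obtain ⟨K, hK, hin⟩ := exists_lintegral_kernel_inv_weight_le (r := r) hB ha
    (fun s hs x hx u => (hw s hs x hx u).1) hθ hκ hκ1 hβ hr
  have hA := hB.one_le
  have hm := hB.m_pos
  obtain ⟨p, hp⟩ : ∃ p, p = (β - 1) / 2 := ⟨_, rfl⟩
  have hp0 : 0 < p := by rw [hp]; linarith
  have hp1 : p < 1 := by rw [hp]; linarith
  obtain ⟨N, hN⟩ : ∃ N, N = 1 + A * T := ⟨_, rfl⟩
  have hN1 : 1 ≤ N := by rw [hN]; nlinarith
  -- Chosen so that c'α² is at most the kinetic functional at (t,x,v).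
  set c' := min 1 (min 1 (2 * m) / C) with hc'
  have hc0 : 0 < c' := by positivity
  set k := 4 * A ^ 2 * N ^ 2 with hk
  have hk0 : 0 ≤ k := by positivity
  set q := (1 - p) * c' / 16 with hq
  have hq0 : 0 < q := by have : 0 < 1 - p := by linarith
                         positivity
  set K2 := N ^ (2 * p) * (2 * (2 * k + 1) / q) with hK2
  refine ⟨K * N ^ r * (c ^ (2 * p) + K2), by positivity, fun t ht x hx v l hl δ hδ0 hδ1 => ?_⟩
  rw [show (3 - β) / 2 = 1 - p by rw [hp]; ring, show (2 - β) = 1 - 2 * p by rw [hp]; ring,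
    show β - 1 = 2 * p by rw [hp]; ring, show 2 * p / 2 = p by ring]
  simp only [← hp, ← hN] at hin ⊢
  have hbv := bracket_pos v
  have hx0 : 0 < -ξ x := neg_pos.2 hx
  obtain ⟨w1, w2, w3⟩ := hw t ht x hx v
  set α := weight ξ ρ χ c E t x v
  have hQ : 0 < (fderiv ℝ ξ x v) ^ 2 + bracket v ^ 2 * (-ξ x) := by positivity
  have hα : 0 < α := lt_of_lt_of_le (by positivity) w1
  have hkin : c' * α ^ 2 ≤ kinetic ξ E A t x v := by
    refine le_trans ?_ (kinetic_ge hB hξ ht (subset_closure hx) v)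
    calc c' * α ^ 2 ≤ min 1 (2 * m) / C * (C * ((fderiv ℝ ξ x v) ^ 2 + bracket v ^ 2 * (-ξ x))) :=
          mul_le_mul (min_le_right _ _) w2 (sq_nonneg _) (by positivity)
      _ = min 1 (2 * m) * (fderiv ℝ ξ x v) ^ 2 + min 1 (2 * m) * (bracket v ^ 2 * (-ξ x)) := by
          field_simp
      _ ≤ 1 * (fderiv ℝ ξ x v) ^ 2 + 2 * m * (bracket v ^ 2 * (-ξ x)) := by
          gcongr
          · exact min_le_left _ _
          · exact min_le_right _ _
      _ = _ := by ring
  have hcyc := lintegral_cycle_le (M := δ * α ^ 2 / bracket v ^ 2) (l := l) hξ hB ht hx hp0.le hp1 hc0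
    (min_le_left _ _) (by positivity) hα hl hkin
  rw [← hN, mul_pow, show 4 * A ^ 2 * (N ^ 2 * bracket v ^ 2) = k * bracket v ^ 2 by
    rw [hk]; ring] at hcyc
  have harch := archConst_le (c := c') (k := k) hp0.le hp1 hc0 (min_le_left _ _) hk0 hbv hδ0 hδ1 hα hl
  set R := δ ^ (1 - p) * α ^ (1 - 2 * p) / bracket v ^ 2 + δ ^ (-p) * α ^ (-(2 * p)) / l with hR
  set L := l + 9 * A ^ 3 / m * (N * bracket v) with hL
  have hlL : l ≤ L := by
    have : 0 ≤ 9 * A ^ 3 / m * (N * bracket v) := by positivity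
    linarith
  set e : ℝ → ℝ := fun s => Real.exp (-(L * (t - s))) with he
  have he0 : ∀ s, 0 < e s := fun s => Real.exp_pos _
  -- The cycle estimate carries the factor qα in front of the singular power; dividing by it
  -- normalizes that estimate, and the α is recovered from the arch constant.
  set q2 := K * N ^ r * bracket v ^ r * (N ^ (2 * p) * bracket v ^ (-(2 * p)) / (q * α)) with hq2
  have hbN : ∀ V : R3, bracket v ≤ N * bracket V →
      bracket V ^ (-(2 * p)) ≤ N ^ (2 * p) * bracket v ^ (-(2 * p)) := fun V hV => by
    have hbV := bracket_pos V
    have h1 : (N * bracket V) ^ (-(2 * p)) ≤ bracket v ^ (-(2 * p)) :=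
      Real.rpow_le_rpow_of_nonpos hbv hV (by linarith)
    rw [Real.mul_rpow (by linarith) hbV.le, Real.rpow_neg (by linarith : 0 ≤ N)] at h1
    have : 0 < N ^ (2 * p) := by positivity
    rwa [inv_mul_le_iff₀ this] at h1
  have hae : ∀ᵐ s ∂(volume.restrict (Ico 0 t)), ∫⁻ u : R3, ENNReal.ofReal (e s *
        (Real.exp (-θ * ‖cycleV ξ E t x v s - u‖ ^ 2) / ‖cycleV ξ E t x v s - u‖ ^ (2 - κ) *
          bracket u ^ r * (1 / weight ξ ρ χ c E s (cycleX ξ E t x v s) u ^ β))) ≤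
      ENNReal.ofReal (K * N ^ r * bracket v ^ r) * ENNReal.ofReal (e s) +
      ENNReal.ofReal q2 *
        ENNReal.ofReal (q * α * e s * (-ξ (cycleX ξ E t x v s)) ^ (-p)) := by
    rw [ae_restrict_iff' measurableSet_Ico]
    filter_upwards [ae_cycle_mem (v := v) hξ hB ht hx] with s hs hst
    obtain ⟨g1, g2, g3⟩ := hs hst
    rw [← hN] at g2 g3
    have hsT : s ∈ Icc 0 T := ⟨hst.1, hst.2.le.trans ht.2⟩
    have h1 := hin s hsT _ g1 (cycleV ξ E t x v s)
    set V := cycleV ξ E t x v s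
    set X := cycleX ξ E t x v s
    have hX0 : 0 < -ξ X := neg_pos.2 g1
    have hbV := bracket_pos V
    simp only [ENNReal.ofReal_mul (he0 s).le]
    rw [lintegral_const_mul' _ _ ENNReal.ofReal_ne_top]
    refine (mul_le_mul_right h1 _).trans ?_
    rw [← ENNReal.ofReal_mul (he0 s).le, ← ENNReal.ofReal_mul (by positivity),
      ← ENNReal.ofReal_mul (by positivity), ← ENNReal.ofReal_add (by positivity) (by positivity)]
    apply ENNReal.ofReal_le_ofReal
    have h2 : (bracket V ^ 2 * (-ξ X)) ^ (-p) = bracket V ^ (-(2 * p)) * (-ξ X) ^ (-p) := by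
      rw [Real.mul_rpow (by positivity) hX0.le, ← Real.rpow_natCast, ← Real.rpow_mul hbV.le]
      congr 2; norm_num
    have h3 : bracket V ^ r ≤ N ^ r * bracket v ^ r := by
      rw [← Real.mul_rpow (by linarith) hbv.le]
      exact Real.rpow_le_rpow hbV.le g2 hr
    have hes := he0 s
    rw [h2]
    calc _ ≤ e s * (K * (N ^ r * bracket v ^ r) *
          (1 + N ^ (2 * p) * bracket v ^ (-(2 * p)) * (-ξ X) ^ (-p))) := by
          have := hbN V g3
          gcongr
      _ = _ := by rw [hq2]; field_simp
  refine (lintegral_mono_ae hae).trans ?_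
  rw [lintegral_add_left (by fun_prop), lintegral_const_mul' _ _ ENNReal.ofReal_ne_top,
    lintegral_const_mul' _ _ ENNReal.ofReal_ne_top]
  refine (add_le_add (mul_le_mul_right (lintegral_exp_Ico_le (hl.trans_le hlL)) _)
    (mul_le_mul_right hcyc _)).trans ?_
  rw [← ENNReal.ofReal_mul (by positivity), ← ENNReal.ofReal_mul (by positivity)]
  set B := archConst p c' (k * bracket v ^ 2) (δ * α ^ 2 / bracket v ^ 2) α l with hB'
  have hB0 : 0 ≤ B := by
    have : 0 < 1 - p := by linarith
    rw [hB']; unfold archConst; positivity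
  rw [← ENNReal.ofReal_add (by positivity) (by positivity)]
  apply ENNReal.ofReal_le_ofReal
  -- The nonsingular part of the u-integral contributes only 1/L. As α ≤ c and δ ≤ 1, this is
  -- absorbed by the term in α^{-(β-1)}.
  have h1 : 1 / L ≤ c ^ (2 * p) * R := by
    have i1 : 1 / L ≤ 1 / l := one_div_le_one_div_of_le hl hlL
    have i2 : 1 ≤ δ ^ (-p) := Real.one_le_rpow_of_pos_of_le_one_of_nonpos hδ0 hδ1 (by linarith)
    have i3 : c ^ (-(2 * p)) ≤ α ^ (-(2 * p)) :=
      Real.rpow_le_rpow_of_nonpos hα w3 (by linarith)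
    have i4 : 0 ≤ δ ^ (1 - p) * α ^ (1 - 2 * p) / bracket v ^ 2 := by positivity
    calc 1 / L ≤ 1 * (c ^ (2 * p) * c ^ (-(2 * p))) / l := by
          rw [← Real.rpow_add hc]; simpa using i1
      _ ≤ δ ^ (-p) * (c ^ (2 * p) * α ^ (-(2 * p))) / l := by gcongr
      _ = c ^ (2 * p) * (0 + δ ^ (-p) * α ^ (-(2 * p)) / l) := by ring
      _ ≤ c ^ (2 * p) * R := by rw [hR]; gcongr
  have h2 : N ^ (2 * p) * bracket v ^ (-(2 * p)) / (q * α) * (2 * B) ≤ K2 * R := by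
    calc _ = N ^ (2 * p) * (2 * (B * bracket v ^ (-(2 * p))) / (q * α)) := by ring
      _ ≤ N ^ (2 * p) * (2 * ((2 * k + 1) * α * R) / (q * α)) := by gcongr
      _ = K2 * R := by rw [hK2]; field_simp
  calc _ = K * N ^ r * bracket v ^ r * (1 / L +
        N ^ (2 * p) * bracket v ^ (-(2 * p)) / (q * α) * (2 * B)) := by rw [hq2]; ring
    _ ≤ K * N ^ r * bracket v ^ r * (c ^ (2 * p) * R + K2 * R) := by gcongr
    _ = _ := by ring

theorem exists_mul_rpow_le {a q : ℝ} (K : ℝ) (ha : 0 < a) (hq : 0 < q) :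
    ∃ η > (0 : ℝ), η ≤ 1 ∧ ∀ y, 0 < y → y ≤ η → K * y ^ a ≤ q := by
  have h1 : Filter.Tendsto (fun y : ℝ => K * y ^ a) (nhds 0) (nhds (K * 0 ^ a)) :=
    ((Real.continuousAt_rpow_const 0 a (Or.inr ha.le)).tendsto).const_mul K
  rw [Real.zero_rpow ha.ne', mul_zero] at h1
  obtain ⟨d, hd, h2⟩ := Metric.eventually_nhds_iff.1 (h1.eventually (ge_mem_nhds hq))
  refine ⟨min (d / 2) 1, by positivity, min_le_right _ _, fun y hy hyd => h2 ?_⟩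
  rw [Real.dist_eq, sub_zero, abs_of_pos hy]
  linarith [min_le_left (d / 2) 1]

end SpecularBoltzmann

namespace SpecularBoltzmann

/-! ### The two nonlocal estimates -/

section Estimates

variable {ξ : R3 → ℝ} {T A m : ℝ} {E : ℝ → R3 → R3} {ρ : ℝ} {χ : ℝ → ℝ} {c θ κ β : ℝ}

theorem weight_pos (hξ : IsDefiningFunction ξ) (hB : FieldBounds ξ T E A m) (hρ : 0 < ρ)
    (hδ : 0 < collarDepth ξ ρ) (hχ : IsCutoff (collarDepth ξ ρ) χ c) {t : ℝ} (ht : t ∈ Icc 0 T)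
    {x : R3} (hx : x ∈ domain ξ) (v : R3) : 0 < weight ξ ρ χ c E t x v := by
  obtain ⟨hc, a, ha, C, hC, hw⟩ := exists_weight_bounds hξ hB hρ hδ hχ
  have hx0 : 0 < -ξ x := neg_pos.2 hx
  have hbv := bracket_pos v
  have hQ : 0 < (fderiv ℝ ξ x v) ^ 2 + bracket v ^ 2 * (-ξ x) := by positivity
  exact lt_of_lt_of_le (by positivity) (hw t ht x hx v).1

/-- Along the arch ⟨V⟩ stays at least ⟨v⟩/(1 + AT), so the collision damping decays at a rate
proportional to ϖ⟨v⟩. -/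
theorem mul_bracket_le_integral (hξ : IsDefiningFunction ξ) (hB : FieldBounds ξ T E A m)
    {t : ℝ} (ht : t ∈ Icc 0 T) {x : R3} (hx : x ∈ domain ξ) (v : R3) {ϖ s : ℝ} (hϖ : 0 ≤ ϖ)
    (hs : s ∈ Ico (t - exitTime ξ E t x v) t) :
    ϖ / 2 * (bracket v / (1 + A * T)) * (t - s) ≤
      ∫ τ in s..t, ϖ / 2 * bracket (charV ξ E t x v τ) := by
  have hz := cycleInvariant (v := v) hξ hB ht hx 0
  obtain ⟨h1, h2, -, -⟩ := charPair_spec hξ hB ht (subset_closure hx) v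
  have hN : 0 < 1 + A * T := by nlinarith [hB.one_le, ht.1.trans ht.2]
  have hsub : Icc s t ⊆ Icc (t - exitTime ξ E t x v) t := Icc_subset_Icc_left hs.1
  have hcont : ContinuousOn (fun τ => ϖ / 2 * bracket (charV ξ E t x v τ)) (Icc s t) :=
    continuousOn_const.mul (continuous_bracket.comp_continuousOn (h2.continuousOn.2.mono hsub))
  have h3 := intervalIntegral.integral_mono_on hs.2.le
    (intervalIntegrable_const (μ := volume) (c := ϖ / 2 * (bracket v / (1 + A * T))))
    (hcont.intervalIntegrable_of_Icc hs.2.le) fun τ hτ => by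
      have := (hz.bracket_le hB ht.2 hξ (hsub hτ)).2.2
      refine mul_le_mul_of_nonneg_left ?_ (by linarith)
      rw [div_le_iff₀ hN, mul_comm]
      exact this
  rw [intervalIntegral.integral_const, smul_eq_mul] at h3
  linarith

/-- The estimate along the last arch. -/
theorem exists_arch_estimate (hξ : IsDefiningFunction ξ) (hT : 0 ≤ T) (hB : FieldBounds ξ T E A m)
    (hρ : 0 < ρ) (hδ : 0 < collarDepth ξ ρ) (hχ : IsCutoff (collarDepth ξ ρ) χ c)
    (hθ : 0 < θ) (hκ : 0 < κ) (hκ1 : κ ≤ 1) (hβ : 1 < β) (hβ3 : β < 3) {q₁ q₂ : ℝ} (hq₁ : 0 < q₁)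
    (hq₂ : 0 < q₂) :
    ∃ ϖ₀ > (0 : ℝ), ∃ δ₀ > (0 : ℝ), ∀ ϖ ≥ ϖ₀, ∀ δ : ℝ, 0 < δ → δ < δ₀ →
      ∀ t ∈ Icc 0 T, ∀ x ∈ domain ξ, ∀ v : R3,
      ∫⁻ s in Icc (t - exitTime ξ E t x v) t, ∫⁻ u : R3, ENNReal.ofReal (
          Real.exp (-∫ τ in s..t, ϖ / 2 * bracket (charV ξ E t x v τ)) *
          (Real.exp (-θ * ‖charV ξ E t x v s - u‖ ^ 2) / ‖charV ξ E t x v s - u‖ ^ (2 - κ)) *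
          (1 / weight ξ ρ χ c E s (charX ξ E t x v s) u ^ β)) ≤
      ENNReal.ofReal (q₁ * (δ ^ ((3 - β) / 2) * weight ξ ρ χ c E t x v ^ (2 - β) / bracket v ^ 2) +
        q₂ * (δ ^ (-(β - 1)) * weight ξ ρ χ c E t x v ^ (-(β - 1)) * (2 / ϖ))) := by
  obtain ⟨K, hK, hker⟩ := exists_lintegral_cycle_kernel_le (r := 0) hξ hT hB hρ hδ hχ hθ hκ hκ1 hβ hβ3
    le_rfl
  have hA := hB.one_le
  have hm := hB.m_pos
  obtain ⟨N, hN⟩ : ∃ N, N = 1 + A * T := ⟨_, rfl⟩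
  have hN0 : 0 < N := by rw [hN]; nlinarith
  -- First η is fixed to bring the first term under q₁. This enlarges the constant of the second,
  -- which the spare power δ^{(β-1)/2} then brings under q₂.
  obtain ⟨η, hη, hη1, hη2⟩ := exists_mul_rpow_le K (by linarith : 0 < (3 - β) / 2) hq₁
  obtain ⟨d, hd, hd1, hd2⟩ := exists_mul_rpow_le (K * η ^ (-((β - 1) / 2)) * (2 * N))
    (by linarith : 0 < (β - 1) / 2) hq₂
  refine ⟨4 * N * (9 * A ^ 3 / m * N), by positivity, d, hd, fun ϖ hϖ δ hδ0 hδd t ht x hx v => ?_⟩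
  have hϖ0 : 0 < ϖ := lt_of_lt_of_le (by positivity) hϖ
  have hbv := bracket_pos v
  have hα := weight_pos hξ hB hρ hδ hχ ht hx v
  -- Half of the damping rate serves as l. For ϖ ≥ ϖ₀ the other half covers the loss rate of the
  -- velocity lemma.
  have hl : 0 < ϖ * bracket v / (4 * N) := by positivity
  have h1 := hker t ht x hx v _ hl (η * δ) (by positivity) (by nlinarith)
  obtain ⟨hex, hchar, -, -⟩ := charPair_spec hξ hB ht (subset_closure hx) v
  rw [← setLIntegral_congr Ioo_ae_eq_Icc]
  calc _ ≤ _ := ?_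
    _ ≤ _ := lintegral_mono_set (Ioo_subset_Ico_self.trans
      (Ico_subset_Ico_left (sub_nonneg.2 hex.2)))
    _ ≤ _ := h1
    _ ≤ _ := ?_
  · refine setLIntegral_mono' measurableSet_Ioo fun s hs => lintegral_mono fun u => ?_
    obtain ⟨e1, e2⟩ := cycleX_eq (v := v) hξ hB ht hx (ℓ := 0) (s := s) (Ioo_subset_Ico_self hs)
    rw [e1, e2]
    apply ENNReal.ofReal_le_ofReal
    have hsT : s ∈ Icc 0 T := ⟨(sub_nonneg.2 hex.2).trans hs.1.le, hs.2.le.trans ht.2⟩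
    have hw0 := weight_pos hξ hB hρ hδ hχ hsT (hchar.2.2.2 s hs) u
    have hint := mul_bracket_le_integral hξ hB ht hx v hϖ0.le (Ioo_subset_Ico_self hs)
    rw [Real.rpow_zero, mul_one, mul_assoc]
    refine mul_le_mul_of_nonneg_right (Real.exp_le_exp.2 (neg_le_neg ?_))
      (mul_nonneg (by positivity) (one_div_nonneg.2 (Real.rpow_nonneg hw0.le _)))
    refine le_trans ?_ hint
    have hts : 0 ≤ t - s := by linarith [hs.2]
    rw [← hN]
    refine mul_le_mul_of_nonneg_right ?_ hts
    have h4 : 9 * A ^ 3 / m * (N * bracket v) ≤ ϖ * bracket v / (4 * N) := by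
      rw [le_div_iff₀ (by positivity)]
      calc _ = 4 * N * (9 * A ^ 3 / m * N) * bracket v := by ring
        _ ≤ ϖ * bracket v := by gcongr
    have h5 : ϖ / 2 * (bracket v / N) = ϖ * bracket v / (4 * N) + ϖ * bracket v / (4 * N) := by
      field_simp; norm_num
    linarith
  · apply ENNReal.ofReal_le_ofReal
    rw [Real.rpow_zero, mul_one, Real.mul_rpow hη.le hδ0.le, Real.mul_rpow hη.le hδ0.le]
    have h2 := hη2 η hη le_rfl
    have h3 := hd2 δ hδ0 hδd.le
    have h4 := one_le_bracket v
    have h5 : δ ^ (-((β - 1) / 2)) = δ ^ ((β - 1) / 2) * δ ^ (-(β - 1)) := by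
      rw [← Real.rpow_add hδ0]; congr 1; ring
    set α := weight ξ ρ χ c E t x v
    rw [mul_add]
    refine add_le_add ?_ ?_
    · calc _ = K * η ^ ((3 - β) / 2) * (δ ^ ((3 - β) / 2) * α ^ (2 - β) / bracket v ^ 2) := by ring
        _ ≤ _ := by gcongr
    · rw [h5]
      calc _ = K * η ^ (-((β - 1) / 2)) * (2 * N) * δ ^ ((β - 1) / 2) *
            (δ ^ (-(β - 1)) * α ^ (-(β - 1)) * (2 / (ϖ * bracket v))) := by field_simp; norm_num
        _ ≤ q₂ * (δ ^ (-(β - 1)) * α ^ (-(β - 1)) * (2 / (ϖ * bracket v))) := by gcongr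
        _ ≤ _ := by
          gcongr
          exact le_mul_of_one_le_right hϖ0.le h4

/-- The estimate along the specular cycles, with a rate that does not depend on the moment. -/
theorem exists_cycle_estimate (hξ : IsDefiningFunction ξ) (hT : 0 ≤ T) (hB : FieldBounds ξ T E A m)
    (hρ : 0 < ρ) (hδ : 0 < collarDepth ξ ρ) (hχ : IsCutoff (collarDepth ξ ρ) χ c)
    (hθ : 0 < θ) (hκ : 0 < κ) (hκ1 : κ ≤ 1) (hβ : 1 < β) (hβ3 : β < 3) :
    ∃ K : ℝ → ℝ, ∀ ε > (0 : ℝ), ∃ l₀ ≥ (1 : ℝ), ∀ l ≥ l₀, ∀ r > (0 : ℝ),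
      ∀ Z : ℝ → R3 → R3 → ℝ,
      (∃ M : ℝ, ∀ s ∈ Icc 0 T, ∀ x ∈ domain ξ, ∀ v : R3, 0 ≤ Z s x v ∧ Z s x v ≤ M) →
      ∀ t ∈ Icc 0 T, ∀ x ∈ domain ξ, ∀ v : R3,
      ∫⁻ s in Icc 0 t, ∫⁻ u : R3, ENNReal.ofReal (
          Real.exp (-l * bracket v * (t - s)) *
          (Real.exp (-θ * ‖cycleV ξ E t x v s - u‖ ^ 2) / ‖cycleV ξ E t x v s - u‖ ^ (2 - κ)) *
          (bracket u ^ r / bracket v ^ r) *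
          (Z s x v / weight ξ ρ χ c E s (cycleX ξ E t x v s) u ^ β))
      ≤ ENNReal.ofReal (K r * ε / (bracket v * weight ξ ρ χ c E t x v ^ (β - 1)) *
          sSup ((fun s => Real.exp (-(l / 2) * bracket v * (t - s)) * Z s x v) '' Icc 0 t)) := by
  have hK : ∀ r : ℝ, ∃ K : ℝ, 0 ≤ r → 0 < K ∧
      ∀ t ∈ Icc 0 T, ∀ x ∈ domain ξ, ∀ v : R3, ∀ l > (0 : ℝ), ∀ δ > (0 : ℝ), δ ≤ 1 →
      ∫⁻ s in Ico 0 t, ∫⁻ u : R3, ENNReal.ofReal (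
        Real.exp (-((l + 9 * A ^ 3 / m * ((1 + A * T) * bracket v)) * (t - s))) *
        (Real.exp (-θ * ‖cycleV ξ E t x v s - u‖ ^ 2) / ‖cycleV ξ E t x v s - u‖ ^ (2 - κ) *
          bracket u ^ r * (1 / weight ξ ρ χ c E s (cycleX ξ E t x v s) u ^ β))) ≤
      ENNReal.ofReal (K * bracket v ^ r *
        (δ ^ ((3 - β) / 2) * weight ξ ρ χ c E t x v ^ (2 - β) / bracket v ^ 2 +
          δ ^ (-((β - 1) / 2)) * weight ξ ρ χ c E t x v ^ (-(β - 1)) / l)) := by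
    intro r
    by_cases hr : 0 ≤ r
    · obtain ⟨K, hK⟩ :=
        exists_lintegral_cycle_kernel_le hξ hT hB hρ hδ hχ hθ hκ hκ1 hβ hβ3 hr
      exact ⟨K, fun _ => hK⟩
    · exact ⟨0, fun h => absurd h hr⟩
  -- The constant must be a function of r fixed before ε, l and Z.
  choose K hK using hK
  obtain ⟨hc, a, -, C, -, hwc⟩ := exists_weight_bounds hξ hB hρ hδ hχ
  have hA := hB.one_le
  have hm := hB.m_pos
  obtain ⟨N, hN⟩ : ∃ N, N = 1 + A * T := ⟨_, rfl⟩
  have hN0 : 0 < N := by rw [hN]; nlinarith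
  -- The c comes from α ≤ c in the first term, the 4 from the rate l⟨v⟩/4 in the second.
  refine ⟨fun r => K r * (c + 4), fun ε hε => ?_⟩
  obtain ⟨δ, hδ0, hδ1, hδ2⟩ := exists_mul_rpow_le 1 (by linarith : 0 < (3 - β) / 2) hε
  have hδε := hδ2 δ hδ0 le_rfl
  rw [one_mul] at hδε
  set D := δ ^ (-((β - 1) / 2)) with hD
  have hD0 : 0 < D := Real.rpow_pos_of_pos hδ0 _
  -- Of the rate l⟨v⟩, half goes to the supremum of Z, a quarter pays the velocity-lemma loss and a
  -- quarter is kept as decay. The condition D/ε ≤ l makes the second term of size ε.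
  refine ⟨max 1 (max (4 * (9 * A ^ 3 / m * N)) (D / ε)), le_max_left _ _,
    fun l hl r hr Z hZ t ht x hx v => ?_⟩
  have hl1 : 1 ≤ l := (le_max_left _ _).trans hl
  have hl2 : 4 * (9 * A ^ 3 / m * N) ≤ l := ((le_max_left _ _).trans (le_max_right _ _)).trans hl
  have hl3 : D / ε ≤ l := ((le_max_right _ _).trans (le_max_right _ _)).trans hl
  obtain ⟨M, hZM⟩ := hZ
  obtain ⟨hK0, hker⟩ := hK r hr.le
  have hbv := bracket_pos v
  have hbv1 := one_le_bracket v
  have hα := weight_pos hξ hB hρ hδ hχ ht hx v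
  have hαc := (hwc t ht x hx v).2.2
  have h1 := hker t ht x hx v (l / 4 * bracket v) (by positivity) δ hδ0 hδ1
  rw [← hN, ← hD] at h1
  set S := sSup ((fun s => Real.exp (-(l / 2) * bracket v * (t - s)) * Z s x v) '' Icc 0 t) with hS
  have hsT : ∀ s ∈ Icc 0 t, s ∈ Icc 0 T := fun s hs => ⟨hs.1, hs.2.trans ht.2⟩
  have hSs : ∀ s ∈ Icc 0 t, Real.exp (-(l / 2) * bracket v * (t - s)) * Z s x v ≤ S := by
    intro s hs
    refine le_csSup ⟨M, ?_⟩ (mem_image_of_mem _ hs)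
    rintro _ ⟨s', hs', rfl⟩
    obtain ⟨z0, z1⟩ := hZM s' (hsT s' hs') x hx v
    have h2 : Real.exp (-(l / 2) * bracket v * (t - s')) ≤ 1 := by
      apply Real.exp_le_one_iff.2
      have h3 : 0 ≤ t - s' := by linarith [hs'.2]
      have h4 : 0 ≤ l / 2 * bracket v * (t - s') := by positivity
      linarith
    exact (mul_le_of_le_one_left z0 h2).trans z1
  have hS0 : 0 ≤ S := by
    have h2 := hSs t (right_mem_Icc.2 ht.1)
    have h3 := (hZM t ht x hx v).1
    exact le_trans (by positivity) h2
  set α := weight ξ ρ χ c E t x v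
  rw [← setLIntegral_congr Ico_ae_eq_Icc]
  set e : ℝ → ℝ := fun s =>
    Real.exp (-((l / 4 * bracket v + 9 * A ^ 3 / m * (N * bracket v)) * (t - s))) with he
  have hes : ∀ s ∈ Icc 0 t, Real.exp (-l * bracket v * (t - s)) * Z s x v ≤ S * e s := by
    intro s hs
    have h2 : 0 ≤ t - s := by linarith [hs.2]
    have h3 : Real.exp (-l * bracket v * (t - s)) = Real.exp (-(l / 2) * bracket v * (t - s)) *
        Real.exp (-(l / 2) * bracket v * (t - s)) := by
      rw [← Real.exp_add]; congr 1; ring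
    have h4 : Real.exp (-(l / 2) * bracket v * (t - s)) ≤ e s := by
      apply Real.exp_le_exp.2
      have h5 : (9 * A ^ 3 / m * N) * (bracket v * (t - s)) ≤ l / 4 * (bracket v * (t - s)) := by
        gcongr ?_ * _
        linarith
      linarith
    rw [h3, mul_right_comm]
    exact mul_le_mul (hSs s hs) h4 (Real.exp_pos _).le hS0
  calc _ ≤ ∫⁻ s in Ico 0 t, ENNReal.ofReal (S / bracket v ^ r) * ∫⁻ u : R3, ENNReal.ofReal (e s *
        (Real.exp (-θ * ‖cycleV ξ E t x v s - u‖ ^ 2) / ‖cycleV ξ E t x v s - u‖ ^ (2 - κ) *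
          bracket u ^ r * (1 / weight ξ ρ χ c E s (cycleX ξ E t x v s) u ^ β))) := ?_
    _ ≤ _ := ?_
  · refine setLIntegral_mono_ae' measurableSet_Ico ?_
    filter_upwards [ae_cycle_mem (v := v) hξ hB ht hx] with s hs hst
    obtain ⟨g1, -, -⟩ := hs hst
    rw [← lintegral_const_mul' _ _ ENNReal.ofReal_ne_top]
    refine lintegral_mono fun u => ?_
    rw [← ENNReal.ofReal_mul (by positivity)]
    apply ENNReal.ofReal_le_ofReal
    have hw0 := weight_pos hξ hB hρ hδ hχ (hsT s (Ico_subset_Icc_self hst)) g1 u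
    have hbu := bracket_pos u
    set k := Real.exp (-θ * ‖cycleV ξ E t x v s - u‖ ^ 2) / ‖cycleV ξ E t x v s - u‖ ^ (2 - κ) with hk
    have hk0 : 0 ≤ k := by rw [hk]; positivity
    calc _ = Real.exp (-l * bracket v * (t - s)) * Z s x v * (k * (bracket u ^ r / bracket v ^ r) *
          (1 / weight ξ ρ χ c E s (cycleX ξ E t x v s) u ^ β)) := by ring
      _ ≤ S * e s * (k * (bracket u ^ r / bracket v ^ r) *
          (1 / weight ξ ρ χ c E s (cycleX ξ E t x v s) u ^ β)) :=
          mul_le_mul_of_nonneg_right (hes s (Ico_subset_Icc_self hst)) (by positivity)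
      _ = _ := by ring
  · rw [lintegral_const_mul' _ _ ENNReal.ofReal_ne_top]
    refine (mul_le_mul_right h1 _).trans ?_
    rw [← ENNReal.ofReal_mul (by positivity)]
    apply ENNReal.ofReal_le_ofReal
    have e1 : α ^ (2 - β) = α * α ^ (-(β - 1)) := by
      rw [show 2 - β = 1 + -(β - 1) by ring, Real.rpow_add hα, Real.rpow_one]
    have h2 : D / l ≤ ε := by
      rw [div_le_iff₀ hε] at hl3
      rw [div_le_iff₀ (by linarith)]; linarith
    have hW : 0 < α ^ (-(β - 1)) := Real.rpow_pos_of_pos hα _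
    calc _ = K r * S * (α ^ (-(β - 1)) * (δ ^ ((3 - β) / 2) * α / bracket v ^ 2 +
          4 * (D / l) / bracket v)) := by rw [e1]; field_simp
      _ ≤ K r * S * (α ^ (-(β - 1)) * (ε * c / bracket v + 4 * ε / bracket v)) := by
          gcongr
          exact le_self_pow₀ hbv1 (by norm_num)
      _ = _ := by rw [Real.rpow_neg hα.le]; field_simp

end Estimates

end SpecularBoltzmann
-- The two estimates combined.
theorem mainTheorem3 (ξ : SpecularBoltzmann.R3 → ℝ)
    (hξ : SpecularBoltzmann.IsDefiningFunction ξ) :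
    ∃ ρ₀ > (0 : ℝ), ∃ Cξ > (0 : ℝ),
    ∀ ρ : ℝ, 0 < ρ → ρ < ρ₀ → ∀ (χ : ℝ → ℝ) (c : ℝ),
    SpecularBoltzmann.IsCutoff (SpecularBoltzmann.collarDepth ξ ρ) χ c →
    ∀ T β κ Cθ θ : ℝ, 0 < T → 1 < β → β < 3 → 0 < κ → κ ≤ 1 → 0 < Cθ → 0 < θ →
    ∃ C > (0 : ℝ), ∀ (E : ℝ → SpecularBoltzmann.R3 → SpecularBoltzmann.R3) (CE : ℝ),
    SpecularBoltzmann.IsC2Field ξ T E → SpecularBoltzmann.SignCondition ξ T E CE →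
    -- Part (1)
    (∃ ϖ₀ > (0 : ℝ), ∃ δ₀ > (0 : ℝ), ∀ ϖ ≥ ϖ₀, ∀ δ : ℝ, 0 < δ → δ < δ₀ →
      ∀ t ∈ Set.Icc 0 T, ∀ x ∈ SpecularBoltzmann.domain ξ, ∀ v : SpecularBoltzmann.R3,
      ∫⁻ s in Set.Icc (t - SpecularBoltzmann.exitTime ξ E t x v) t,
        ∫⁻ u : SpecularBoltzmann.R3, ENNReal.ofReal (
          Real.exp (-∫ τ in s..t,
            ϖ / 2 * SpecularBoltzmann.bracket (SpecularBoltzmann.charV ξ E t x v τ)) *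
          (Real.exp (-(Cθ / 2) * ‖SpecularBoltzmann.charV ξ E t x v s - u‖ ^ 2) /
            ‖SpecularBoltzmann.charV ξ E t x v s - u‖ ^ (2 - κ)) *
          (1 / SpecularBoltzmann.weight ξ ρ χ c E s
            (SpecularBoltzmann.charX ξ E t x v s) u ^ β))
      ≤ ENNReal.ofReal (C * (
          Real.exp (2 * Cξ * ((SpecularBoltzmann.fieldGradSup ξ T E
              + SpecularBoltzmann.fieldSup ξ T E ^ 2
              + SpecularBoltzmann.fieldSup ξ T E) / CE)) *
            (δ ^ ((3 - β) / 2) /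
              (SpecularBoltzmann.bracket v ^ 2 * (CE + 1) ^ ((β - 1) / 2) *
                SpecularBoltzmann.weight ξ ρ χ c E t x v ^ (β - 2) *
                (SpecularBoltzmann.fieldSup ξ T E ^ 2 + 1) ^ ((3 - β) / 2)))
          + (SpecularBoltzmann.fieldSup ξ T E ^ 2 + 1) ^ (β - 1) /
              (CE ^ (β - 1) * δ ^ (β - 1) *
                SpecularBoltzmann.weight ξ ρ χ c E t x v ^ (β - 1)) * (2 / ϖ)))) ∧
    -- Part (2)
    (∃ K : ℝ → ℝ, ∀ ε > (0 : ℝ), ∃ l₀ ≥ (1 : ℝ), ∀ l ≥ l₀, ∀ r > (0 : ℝ),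
      ∀ Z : ℝ → SpecularBoltzmann.R3 → SpecularBoltzmann.R3 → ℝ,
      (∃ M : ℝ, ∀ s ∈ Set.Icc 0 T, ∀ x ∈ SpecularBoltzmann.domain ξ,
        ∀ v : SpecularBoltzmann.R3, 0 ≤ Z s x v ∧ Z s x v ≤ M) →
      ∀ t ∈ Set.Icc 0 T, ∀ x ∈ SpecularBoltzmann.domain ξ, ∀ v : SpecularBoltzmann.R3,
      ∫⁻ s in Set.Icc 0 t, ∫⁻ u : SpecularBoltzmann.R3, ENNReal.ofReal (
          Real.exp (-l * SpecularBoltzmann.bracket v * (t - s)) *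
          (Real.exp (-θ * ‖SpecularBoltzmann.cycleV ξ E t x v s - u‖ ^ 2) /
            ‖SpecularBoltzmann.cycleV ξ E t x v s - u‖ ^ (2 - κ)) *
          (SpecularBoltzmann.bracket u ^ r / SpecularBoltzmann.bracket v ^ r) *
          (Z s x v / SpecularBoltzmann.weight ξ ρ χ c E s
            (SpecularBoltzmann.cycleX ξ E t x v s) u ^ β))
      ≤ ENNReal.ofReal (K r * ε /
          (SpecularBoltzmann.bracket v *
            SpecularBoltzmann.weight ξ ρ χ c E t x v ^ (β - 1)) *
          sSup ((fun s => Real.exp (-(l / 2) * SpecularBoltzmann.bracket v * (t - s)) * Z s x v) ''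
            Set.Icc 0 t))) := by
  obtain ⟨ρ₀, hρ₀, hdepth⟩ := SpecularBoltzmann.exists_collarDepth_pos hξ
  -- Both C_ξ and C are 1, since the thresholds ϖ₀ and δ₀ are chosen after the field and absorb
  -- every other constant.
  refine ⟨ρ₀, hρ₀, 1, one_pos, fun ρ hρ hρ' χ c hχ T β κ Cθ θ hT hβ hβ3 hκ hκ1 hCθ hθ =>
    ⟨1, one_pos, fun E CE hE hs => ?_⟩⟩
  obtain ⟨A, m, hB⟩ := SpecularBoltzmann.exists_fieldBounds hξ hE hs
  have hCE := hs.1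
  rcases (SpecularBoltzmann.domain ξ).eq_empty_or_nonempty with he | hne
  · refine ⟨⟨1, one_pos, 1, one_pos, fun ϖ _ δ _ _ t _ x hx => ?_⟩,
      ⟨fun _ => 0, fun ε _ => ⟨1, le_rfl, fun l _ r _ Z _ t _ x hx => ?_⟩⟩⟩ <;>
    simp [he] at hx
  have hδ := hdepth ρ hρ hρ' hne
  refine ⟨?_, SpecularBoltzmann.exists_cycle_estimate hξ hT.le hB hρ hδ hχ hθ hκ hκ1 hβ hβ3⟩
  set F := SpecularBoltzmann.fieldSup ξ T E
  set G := Real.exp (2 * 1 * ((SpecularBoltzmann.fieldGradSup ξ T E + F ^ 2 + F) / CE))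
  have hF : 0 < F ^ 2 + 1 := by positivity
  have hG : 0 < G := Real.exp_pos _
  -- The numbers q₁ and q₂ are exactly the field-dependent prefactors of the claimed bound; only
  -- their positivity matters.
  obtain ⟨ϖ₀, hϖ₀, δ₀, hδ₀, hmain⟩ := SpecularBoltzmann.exists_arch_estimate (θ := Cθ / 2)
    (q₁ := G / ((CE + 1) ^ ((β - 1) / 2) * (F ^ 2 + 1) ^ ((3 - β) / 2)))
    (q₂ := (F ^ 2 + 1) ^ (β - 1) / CE ^ (β - 1)) hξ hT.le hB hρ hδ hχ (by positivity) hκ hκ1 hβ hβ3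
    (by positivity) (by positivity)
  refine ⟨ϖ₀, hϖ₀, δ₀, hδ₀, fun ϖ hϖ δ hδ0 hδ1 t ht x hx v =>
    (hmain ϖ hϖ δ hδ0 hδ1 t ht x hx v).trans_eq ?_⟩
  have hα := SpecularBoltzmann.weight_pos hξ hB hρ hδ hχ ht hx v
  have hbv := SpecularBoltzmann.bracket_pos v
  congr 1
  rw [show 2 - β = -(β - 2) by ring, Real.rpow_neg hα.le, Real.rpow_neg hα.le,
    Real.rpow_neg hδ0.le]
  field_simp
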